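/- **Setting.** Let $\mathfrak J$ be the exceptional Jordan algebra of Hermitian $3\times3$ octonionic matrices with product $X\circ Y=\frac12(XY+YX)$, inner product $\langle X,Y\rangle=\mathrm{Tr}(X\circ Y)$, multiplication operators $L_X Y=X\circ Y$ and Freudenthal product $X\rhd Y=X\circ Y-\frac12\mathrm{Tr}(X)Y-\frac12\mathrm{Tr}(Y)X+\frac12(\mathrm{Tr}X\,\mathrm{Tr}Y-\mathrm{Tr}(X\circ Y))I_3$. Fix the orthogonal basis $j_1,\dots,j_{27}$ with $\langle j_\mu,j_\nu\rangle=2\delta_{\mu\nu}$, where $j_1=\mathrm{diag}(1,-1,0)$, $j_{18}=\frac1{\sqrt3}\mathrm{diag}(1,1,-2)$, $j_{27}=\sqrt{2/3}\,I_3$, and $j_2,\dots,j_9$; $j_{10},\dots,j_{17}$; $j_{19},\dots,j_{26}$ have a standard octonion unit in position $(1,2)$; $(1,3)$; $(2,3)$ respectively. Identify $\mathfrak J\cong\mathbb R^{27}$ and let $A_\alpha$ be the matrix of $X\mapsto j_\alpha\rhd X$. Let $\mathrm{Lie}(F_4)$ be the derivations of $\mathfrak J$, $\mathrm{Lie}(SO(9))$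 those that annihilate $\mathrm{diag}(1,0,0)$, $\mathrm{Lie}(SO(8))$ those that commute with $L_{j_1}$ and $L_{j_{18}}$, and $\mathrm{Lie}(E_6)=\mathrm{Lie}(F_4)\oplus\mathrm{span}_{\mathbb R}\{\tilde C_a=-iL_{j_a}: a\le 26\}\subset M_{27}(\mathbb C)$. On $\mathbb C^{27}\oplus\mathbb C\oplus\mathbb C^{27}\oplus\mathbb C$ put $\psi(\phi)=\mathrm{diag}(\phi,0,-\phi^t,0)$, $Y_1=\frac i{\sqrt6}\mathrm{diag}(I_{27},-3,-I_{27},3)$ and, for $z\in\mathbb C^{27}$, $$P(z)=\begin{pmatrix}0&0&-\sum\bar z^\alpha A_\alpha&\frac1{\sqrt2}z\\0&0&\frac1{\sqrt2}z^t&0\\ \sum z^\alpha A_\alpha&-\frac1{\sqrt2}\bar z&0&0\\-\frac1{\sqrt2}\bar z^t&0&0&0\end{pmatrix}.$$ Then $\mathrm{Lie}(U)=\mathbb RY_1\oplus\psi(\mathrm{Lie}(E_6))$ and $\mathrm{Lie}(E_7)=\mathrm{Lie}(U)\oplus\mathfrak p$ with $\mathfrak p=P(\mathbb C^{27})$; the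 groups $E_7$, $U=(E_6\times U(1))/\mathbb Z_3$, $E_6$, $F_4$, $SO(9)$ are those generated by the exponentials of their Lie algebras, and $\psi_*(k)=\mathrm{diag}(k,1,k^{-t},1)$ embeds $E_6$ in $E_7$. Use the product $\langle X,Y\rangle=-\frac1{12}\mathrm{Re}\,\mathrm{Tr}(XY)$. With $e_\alpha$ the standard basis, $Y_2=P(ie_{27})$, $Y_3=P(e_{27})$, $Y_{81+a}=P(ie_a)$, $Y_{107+a}=P(e_a)$ ($a\le26$). For $K\supset H$ with Lie algebras $\mathfrak k\supset\mathfrak h$, $n=\dim\mathfrak k-\dim\mathfrak h$, and a differentiable map $\sigma$ from $\mathbb R^n$ to $K$, let $|\det J_\sigma^\perp|$ be the modulus of the determinant of the orthogonal projection of $\sigma^{-1}d\sigma$ on $\mathfrak k\ominus\mathfrak h$, in an orthonormal basis; $|\det J^\perp_\sigma|\,dx$ is the invariant measure of $K/H$ in these coordinates. **Theorem.** (a) Orthonormal bases of $\mathrm{Lie}(E_7)\ominus\mathrm{Lie}(U)$, $\mathrm{Lie}(E_6)\ominus\mathrm{Lie}(F_4)$, $\mathrm{Lie}(F_4)\ominus\mathrm{Lie}(SO(9))$,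 $\mathrm{Lie}(SO(9))\ominus\mathrm{Lie}(SO(8))$ are, respectively, the 54 matrices $Y_2,Y_3,Y_{82},\dots,Y_{133}$; the 26 matrices $\psi(\tilde C_a)$; the 16 matrices $\psi([L_{\mathrm{diag}(1,-1,0)},L_{j_a}])$, $2\le a\le 9$, and $\psi([L_{\mathrm{diag}(1,0,-1)},L_{j_a}])$, $10\le a\le17$; the 8 matrices $\psi([L_{\mathrm{diag}(0,1,-1)},L_{j_a}])$, $19\le a\le 26$. (b) The density on $E_7/U$ is well defined and invariant: if $g\in E_7$ and $\sigma,\sigma':\mathbb R^{54}\to E_7$, $f:\mathbb R^{54}\to\mathbb R^{54}$ satisfy $\sigma'(q)U=g\,\sigma(f(q))U$ for all $q$ near $p$, with $f,\sigma'$ differentiable at $p$ and $\sigma$ at $f(p)$, then $|\det J^\perp_{\sigma'}(p)|=|\det df(p)|\,|\det J^\perp_\sigma(f(p))|$. (c) Let $B_{E_6}:\mathbb R^{26}\to E_6$, $B_{F_4}:\mathbb R^{16}\to F_4$, $B_{SO(9)}:\mathbb R^8\to SO(9)$ be any differentiable maps (in particular the Euler parametrizations of $E_6/F_4$, $F_4/SO(9)$,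 $SO(9)/SO(8)$), and let $d\mu_{B_{E_6}}$, $d\mu_{B_{F_4}}$, $d\mu_{B_{SO(9)}}$ be the corresponding measures $|\det J^\perp|\,dx$. Then $$\sigma(x_1,\dots,x_{54})=e^{x_1Y_1}\,\psi_*(B_{E_6}[x_2,\dots,x_{27}])\,\psi_*(B_{F_4}[x_{28},\dots,x_{43}])\,\psi_*(B_{SO(9)}[x_{44},\dots,x_{51}])\,e^{x_{52}Y_2+x_{53}Y_{82}+x_{54}Y_{99}}$$ is differentiable with values in $E_7$, and the invariant measure $d\mu_{B_{E_7}}=|\det J^\perp_\sigma|\,dx_1\cdots dx_{54}$ of $E_7/U$ is, pointwise as a density and as a measure, $$d\mu_{B_{E_7}}=dx_1\,d\mu_{B_{E_6}}(x_2,\dots,x_{27})\,d\mu_{B_{F_4}}(x_{28},\dots,x_{43})\,d\mu_{B_{SO(9)}}(x_{44},\dots,x_{51})\,|W(x_{52},x_{53},x_{54})|\,dx_{52}dx_{53}dx_{54},$$ $$\begin{aligned}W(x_1,x_2,x_3)=\ &\sin\tfrac{\sqrt3x_2+\sqrt2x_1+x_3}{\sqrt3}\,\sin\tfrac{\sqrt3x_2-\sqrt2x_1-x_3}{\sqrt3}\,\sin\tfrac{\sqrt6x_1-2\sqrt3x_3}{3}\,\sin^8\tfrac{\sqrt3x_2+2\sqrt2x_1-x_3}{2\sqrt3}\,\sin^8\tfrac{\sqrt3x_2-2\sqrt2x_1+x_3}{2\sqrt3}\\&\cdot\sin^8\tfrac{x_2-\sqrt3x_3}{2}\,\sin^8\tfrac{x_2+\sqrt3x_3}{2}\,\sin^8\tfrac{\sqrt2x_1+x_3}{\sqrt3}\,\sin^8x_2.\end{aligned}$$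 (d) With $x=\frac{\sqrt6x_{52}-2\sqrt3x_{54}}3$, $y=\frac{\sqrt3x_{53}+\sqrt2x_{52}+x_{54}}{\sqrt3}$, $z=\frac{\sqrt3x_{53}-\sqrt2x_{52}-x_{54}}{\sqrt3}$ one has $dx_{52}dx_{53}dx_{54}=\frac1{2\sqrt2}dx\,dy\,dz$ and $$W(x_{52},x_{53},x_{54})=\sin x\sin y\sin z\,\sin^8\tfrac{x-y}2\sin^8\tfrac{x+y}2\sin^8\tfrac{x-z}2\sin^8\tfrac{x+z}2\sin^8\tfrac{y-z}2\sin^8\tfrac{y+z}2,$$ which is nonnegative for $0\le z\le y\le x\le\pi$ (so that $|W|=W$ there). -/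

import Mathlib

open Matrix MeasureTheory Filter Topology
open scoped Quaternion

noncomputable section

/-! ### Octonions and the exceptional Jordan algebra -/

/-- The octonions `fst + snd ℓ`, as pairs of quaternions (Cayley–Dickson). -/
@[ext]
structure Oct where
  fst : ℍ[ℝ]
  snd : ℍ[ℝ]

namespace Oct

/-- Octonions as a real vector space. -/
def equivProd : Oct ≃ ℍ[ℝ] × ℍ[ℝ] where
  toFun x := (x.fst, x.snd)
  invFun x := ⟨x.1, x.2⟩

instance : AddCommGroup Oct := equivProd.addCommGroup
instance : Module ℝ Oct := equivProd.module ℝ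

instance : Mul Oct :=
  ⟨fun x y => ⟨x.fst * y.fst - star y.snd * x.snd, y.snd * x.fst + x.snd * star y.fst⟩⟩

instance : One Oct := ⟨⟨1, 0⟩⟩

@[simp] theorem zero_fst : (0 : Oct).fst = 0 := rfl
@[simp] theorem zero_snd : (0 : Oct).snd = 0 := rfl
@[simp] theorem one_fst : (1 : Oct).fst = 1 := rfl
@[simp] theorem one_snd : (1 : Oct).snd = 0 := rfl
@[simp] theorem add_fst (x y : Oct) : (x + y).fst = x.fst + y.fst := rfl
@[simp] theorem add_snd (x y : Oct) : (x + y).snd = x.snd + y.snd := rfl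
@[simp] theorem neg_fst (x : Oct) : (-x).fst = -x.fst := rfl
@[simp] theorem neg_snd (x : Oct) : (-x).snd = -x.snd := rfl
@[simp] theorem smul_fst (r : ℝ) (x : Oct) : (r • x).fst = r • x.fst := rfl
@[simp] theorem smul_snd (r : ℝ) (x : Oct) : (r • x).snd = r • x.snd := rfl
@[simp] theorem mul_fst (x y : Oct) : (x * y).fst = x.fst * y.fst - star y.snd * x.snd := rfl
@[simp] theorem mul_snd (x y : Oct) : (x * y).snd = y.snd * x.fst + x.snd * star y.fst := rfl

/-- Octonionic conjugation. -/
def conj (x : Oct) : Oct := ⟨star x.fst, -x.snd⟩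

/-- The real part of an octonion. -/
def re (x : Oct) : ℝ := x.fst.re

/-- The quaternion `a + b i + c j + d k`. -/
def quat (a b c d : ℝ) : ℍ[ℝ] := ⟨a, b, c, d⟩

@[simp] theorem quat_re (a b c d : ℝ) : (quat a b c d).re = a := rfl
@[simp] theorem quat_imI (a b c d : ℝ) : (quat a b c d).imI = b := rfl
@[simp] theorem quat_imJ (a b c d : ℝ) : (quat a b c d).imJ = c := rfl
@[simp] theorem quat_imK (a b c d : ℝ) : (quat a b c d).imK = d := rfl

/-- The standard orthonormal basis of the octonions, starting with the unit. -/
def unit : Fin 8 → Oct :=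
  ![⟨quat 1 0 0 0, 0⟩, ⟨quat 0 1 0 0, 0⟩, ⟨quat 0 0 1 0, 0⟩, ⟨quat 0 0 0 1, 0⟩,
    ⟨0, quat 1 0 0 0⟩, ⟨0, quat 0 1 0 0⟩, ⟨0, quat 0 0 1 0⟩, ⟨0, quat 0 0 0 1⟩]

end Oct

namespace E7

/-- `3 × 3` octonionic matrices. -/
abbrev Mat3 := Matrix (Fin 3) (Fin 3) Oct

/-- The general element of the exceptional Jordan algebra `𝔍` of Hermitian octonionic matrices. -/
def herm (a b c : ℝ) (o₁ o₂ o₃ : Oct) : Mat3 :=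
  !![a • (1 : Oct), o₁, o₂;
     Oct.conj o₁, b • (1 : Oct), o₃;
     Oct.conj o₂, Oct.conj o₃, c • (1 : Oct)]

/-- The Jordan product. -/
def jordan (X Y : Mat3) : Mat3 := (1 / 2 : ℝ) • (X * Y + Y * X)

/-- The trace of a Hermitian octonionic matrix. -/
def trJ (X : Mat3) : ℝ := ∑ i, Oct.re (X i i)

/-- The inner product `⟨X, Y⟩ = Tr (X ∘ Y)` of `𝔍`. -/
def innerJ (X Y : Mat3) : ℝ := trJ (jordan X Y)

/-- The Freudenthal product `X ▷ Y`. -/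
def freudenthal (X Y : Mat3) : Mat3 :=
  jordan X Y - (trJ X / 2) • Y - (trJ Y / 2) • X
    + ((trJ X * trJ Y - trJ (jordan X Y)) / 2) • (1 : Mat3)

/-- Index set of the basis of the traceless part `𝔍'`: two diagonal elements, and eight for each of
the three off-diagonal positions (12), (13), (23). -/
abbrev I26 := Fin 2 ⊕ (Fin 3 × Fin 8)

/-- Index set of the basis of `𝔍`; the last element is the multiple of the identity. -/
abbrev I27 := I26 ⊕ Unit

/-- Index set of the basis of `𝔍_ℂ ⊕ ℂ ⊕ 𝔍_ℂ ⊕ ℂ`. -/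
abbrev I56 := (I27 ⊕ Unit) ⊕ (I27 ⊕ Unit)

/-- The orthogonal basis `j_μ` of `𝔍`, normalized by `⟨j_μ, j_ν⟩ = 2 δ_{μν}`. -/
def jb : I27 → Mat3
  | Sum.inl (Sum.inl 0) => herm 1 (-1) 0 0 0 0
  | Sum.inl (Sum.inl 1) => herm (1 / √3) (1 / √3) (-2 / √3) 0 0 0
  | Sum.inl (Sum.inr (s, k)) =>
      herm 0 0 0 (if s = 0 then Oct.unit k else 0) (if s = 1 then Oct.unit k else 0)
        (if s = 2 then Oct.unit k else 0)
  | Sum.inr _ => herm (√(2 / 3)) (√(2 / 3)) (√(2 / 3)) 0 0 0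

/-- The element of `𝔍` with given coordinates. -/
def jvec (v : I27 → ℝ) : Mat3 := ∑ μ, v μ • jb μ

/-- The coordinates of an element of `𝔍` (inverse to `jvec`). -/
def jcoord (X : Mat3) : I27 → ℝ := fun μ => innerJ (jb μ) X / 2

/-- The Jordan product in coordinates. -/
def jmul (u v : I27 → ℝ) : I27 → ℝ := jcoord (jordan (jvec u) (jvec v))

/-- The matrix of the multiplication operator `L_X : Y ↦ X ∘ Y` on `𝔍`. -/
def mulMat (X : Mat3) : Matrix I27 I27 ℝ :=
  Matrix.of fun μ ν => jcoord (jordan X (jb ν)) μ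

/-- The matrix `A_α` of `Y ↦ j_α ▷ Y` on `𝔍`. -/
def freudMat (α : I27) : Matrix I27 I27 ℝ :=
  Matrix.of fun μ ν => jcoord (freudenthal (jb α) (jb ν)) μ

/-- A real matrix regarded as a complex one. -/
def toC (M : Matrix I27 I27 ℝ) : Matrix I27 I27 ℂ := M.map Complex.ofReal

/-! ### The Lie algebras, in the representations 27 and 56 -/

/-- `D` is a derivation of the Jordan algebra `𝔍`, in coordinates. -/
def IsDerivation (D : Matrix I27 I27 ℝ) : Prop :=
  ∀ u v, D *ᵥ jmul u v = jmul (D *ᵥ u) v + jmul u (D *ᵥ v)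

/-- `Lie(F₄)`: the derivations of `𝔍`. -/
def lieF4 : Set (Matrix I27 I27 ℂ) := {X | ∃ D, IsDerivation D ∧ X = toC D}

/-- The generators `C̃_a = -i L_{j_a}`, which extend `Lie(F₄)` to the compact `Lie(E₆)`. -/
def cTilde (a : I26) : Matrix I27 I27 ℂ := (-Complex.I) • toC (mulMat (jb (Sum.inl a)))

/-- The compact form of `Lie(E₆)`, in the representation 27. -/
def lieE6 : Set (Matrix I27 I27 ℂ) :=
  {X | ∃ D ∈ lieF4, ∃ y : I26 → ℝ, X = D + ∑ a, y a • cTilde a}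

/-- `Lie(SO(9)) ⊆ Lie(F₄)`: the derivations that annihilate `diag(1,0,0)`. -/
def lieSO9 : Set (Matrix I27 I27 ℂ) :=
  {X | ∃ D, IsDerivation D ∧ D *ᵥ jcoord (herm 1 0 0 0 0 0) = 0 ∧ X = toC D}

/-- `Lie(SO(8)) ⊆ Lie(F₄)`: the elements that commute with the two diagonal generators `C̃_a`. -/
def lieSO8 : Set (Matrix I27 I27 ℂ) :=
  {X ∈ lieF4 | ∀ s : Fin 2, X * cTilde (Sum.inl s) = cTilde (Sum.inl s) * X}

/-- The embedding `ψ` of `Lie(E₆)` in `Lie(E₇)`, as `27 ⊕ 1 ⊕ 27' ⊕ 1`. -/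
def psi (X : Matrix I27 I27 ℂ) : Matrix I56 I56 ℂ :=
  fromBlocks (fromBlocks X 0 0 0) 0 0 (fromBlocks (-Xᵀ) 0 0 0)

/-- The generator `Y₁` of the factor `U(1)`. -/
def Y1 : Matrix I56 I56 ℂ :=
  (Complex.I / (√6 : ℝ)) •
    fromBlocks (fromBlocks 1 0 0 ((-3 : ℂ) • 1)) 0 0 (fromBlocks (-1) 0 0 ((3 : ℂ) • 1))

/-- The elements of `Lie(E₇)` complementary to `Lie(E₆ × U(1))`, parametrized by `z ∈ ℂ²⁷`. -/
def offDiag (z : I27 → ℂ) : Matrix I56 I56 ℂ :=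
  fromBlocks 0
    (fromBlocks (-∑ α, star (z α) • toC (freudMat α)) (Matrix.of fun μ _ => z μ / (√2 : ℝ))
      (Matrix.of fun _ μ => z μ / (√2 : ℝ)) 0)
    (fromBlocks (∑ α, z α • toC (freudMat α)) (Matrix.of fun μ _ => -star (z μ) / (√2 : ℝ))
      (Matrix.of fun _ μ => -star (z μ) / (√2 : ℝ)) 0)
    0

/-- `Lie(U)`, `U = (E₆ × U(1)) / ℤ₃`. -/
def lieU : Set (Matrix I56 I56 ℂ) := {T | ∃ ν : ℝ, ∃ X ∈ lieE6, T = ν • Y1 + psi X}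

/-- The compact form of `Lie(E₇)`, in the representation 56. -/
def lieE7 : Set (Matrix I56 I56 ℂ) := {T | ∃ S ∈ lieU, ∃ z, T = S + offDiag z}

/-! ### The groups -/

/-- The matrix exponential, as an invertible matrix. -/
def expGL {n : Type} [Fintype n] [DecidableEq n] (X : Matrix n n ℂ) : GL n ℂ where
  val := NormedSpace.exp X
  inv := NormedSpace.exp (-X)
  val_inv := by
    rw [← Matrix.exp_add_of_commute _ _ (Commute.neg_right (Commute.refl X))]; simp
  inv_val := by
    rw [← Matrix.exp_add_of_commute _ _ (Commute.neg_left (Commute.refl X))]; simp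

/-- The connected group generated by the exponentials of a matrix Lie algebra. -/
def expGroup {n : Type} [Fintype n] [DecidableEq n] (𝔥 : Set (Matrix n n ℂ)) : Subgroup (GL n ℂ) :=
  Subgroup.closure (expGL '' 𝔥)

/-- The embedding of the group `E₆` in `E₇` induced by `ψ`. -/
def psiGL (k : GL I27 ℂ) : GL I56 ℂ where
  val := fromBlocks (fromBlocks k.val 0 0 1) 0 0 (fromBlocks k⁻¹.valᵀ 0 0 1)
  inv := fromBlocks (fromBlocks k⁻¹.val 0 0 1) 0 0 (fromBlocks k.valᵀ 0 0 1)
  val_inv := by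
    simp [fromBlocks_multiply, ← Matrix.transpose_mul]
  inv_val := by
    simp [fromBlocks_multiply, ← Matrix.transpose_mul]

/-! ### Orthonormal frames of the complements of the subalgebras -/

/-- The invariant product `⟨X, Y⟩ = -(1/12) Tr (X Y)` of `Lie(E₇)`. -/
def ip (X Y : Matrix I56 I56 ℂ) : ℝ := -(1 / 12) * (X * Y).trace.re

/-- `Y` is an orthonormal basis of the orthogonal complement of `𝔥` in `𝔨`. -/
def IsOrthoFrame {κ : Type} [DecidableEq κ] (𝔨 𝔥 : Set (Matrix I56 I56 ℂ))
    (Y : κ → Matrix I56 I56 ℂ) : Prop :=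
  (∀ k l, ip (Y k) (Y l) = if k = l then 1 else 0) ∧
    (Submodule.span ℝ (Set.range Y) : Set (Matrix I56 I56 ℂ)) =
      {X ∈ 𝔨 | ∀ Z ∈ 𝔥, ip X Z = 0}

/-- Frame of `Lie(E₇) ⊖ Lie(U)`. In the numbering `Y₁, …, Y₁₃₃` the elements `(0, α)` are
`Y₈₂, …, Y₁₀₇` and, for the last `α`, `Y₂`; the elements `(1, α)` are `Y₁₀₈, …, Y₁₃₃` and `Y₃`. -/
def frameE7 (q : Fin 2 × I27) : Matrix I56 I56 ℂ :=
  offDiag (Pi.single q.2 (if q.1 = 0 then Complex.I else 1))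

/-- Frame of `Lie(E₆) ⊖ Lie(F₄)`: the generators `Y₅₆, …, Y₈₁`. -/
def frameE6 (a : I26) : Matrix I56 I56 ℂ := psi (cTilde a)

/-- The inner derivation `[L_X, L_Y]`, embedded in `Lie(E₇)`. -/
def innerDer (X Y : Mat3) : Matrix I56 I56 ℂ :=
  psi (toC (mulMat X * mulMat Y - mulMat Y * mulMat X))

/-- Frame of `Lie(F₄) ⊖ Lie(SO(9))`. -/
def frameF4 (q : Fin 2 × Fin 8) : Matrix I56 I56 ℂ :=
  if q.1 = 0 then innerDer (herm 1 (-1) 0 0 0 0) (herm 0 0 0 (Oct.unit q.2) 0 0)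
  else innerDer (herm 1 0 (-1) 0 0 0) (herm 0 0 0 0 (Oct.unit q.2) 0)

/-- Frame of `Lie(SO(9)) ⊖ Lie(SO(8))`. -/
def frameSO9 (k : Fin 8) : Matrix I56 I56 ℂ :=
  innerDer (herm 0 1 (-1) 0 0 0) (herm 0 0 0 0 0 (Oct.unit k))

/-! ### Invariant densities -/

/-- Entrywise differentiability of a matrix-valued map. -/
def MatDiffAt {E : Type} [NormedAddCommGroup E] [NormedSpace ℝ E] {n : Type} [Fintype n]
    [DecidableEq n] (σ : E → GL n ℂ) (p : E) : Prop :=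
  ∀ i j, DifferentiableAt ℝ (fun q => (σ q).val i j) p

/-- The (left) current `σ⁻¹ dσ` at `p`, evaluated on the tangent vector `v`. -/
def current {E : Type} [NormedAddCommGroup E] [NormedSpace ℝ E] (σ : E → GL I56 ℂ) (p v : E) :
    Matrix I56 I56 ℂ :=
  (σ p)⁻¹.val * Matrix.of fun i j => fderiv ℝ (fun q => (σ q).val i j) p v

/-- The modulus of the determinant of a real matrix with as many rows as columns, whose rows and
columns may be labelled by different sets (see `absDet_eq`). -/
def absDet {κ ι : Type} [Fintype κ] [Fintype ι] [DecidableEq ι] (M : Matrix κ ι ℝ) : ℝ :=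
  √(Mᵀ * M).det

theorem absDet_eq {κ ι : Type} [Fintype κ] [Fintype ι] [DecidableEq ι] (M : Matrix κ ι ℝ)
    (e : ι ≃ κ) : absDet M = |(M.submatrix e id).det| := by
  have h : Mᵀ * M = (M.submatrix e id)ᵀ * M.submatrix e id := by
    ext i j
    simp only [Matrix.mul_apply, Matrix.transpose_apply, Matrix.submatrix_apply, id]
    exact (Equiv.sum_comp e fun k => M k i * M k j).symm
  rw [absDet, h, Matrix.det_mul, Matrix.det_transpose, Real.sqrt_mul_self_eq_abs]

/-- `|det J^⊥|` in the coordinates of the basis `b`, where `J^⊥` is the orthogonal projection of the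
current `σ⁻¹ dσ` on the space with orthonormal basis `Y`. -/
def density {E ι κ : Type} [NormedAddCommGroup E] [NormedSpace ℝ E] [Fintype ι] [DecidableEq ι]
    [Fintype κ] (b : Module.Basis ι ℝ E) (Y : κ → Matrix I56 I56 ℂ) (σ : E → GL I56 ℂ) (p : E) : ℝ :=
  absDet (Matrix.of fun k i => ip (Y k) (current σ p (b i)))

/-- The measure with this density with respect to the Lebesgue measure in the coordinates. -/
def densityMeasure {E ι κ : Type} [NormedAddCommGroup E] [NormedSpace ℝ E] [MeasureSpace E]
    [Fintype ι] [DecidableEq ι] [Fintype κ] (b : Module.Basis ι ℝ E) (Y : κ → Matrix I56 I56 ℂ)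
    (σ : E → GL I56 ℂ) : Measure E :=
  volume.withDensity fun p => ENNReal.ofReal (density b Y σ p)

/-! ### The Euler parametrization of `E₇ / U` -/

/-- The coordinates `x₁; x₂, …, x₂₇; x₂₈, …, x₄₃; x₄₄, …, x₅₁; x₅₂, x₅₃, x₅₄`. -/
abbrev Coord := ℝ × (Fin 26 → ℝ) × (Fin 16 → ℝ) × (Fin 8 → ℝ) × (Fin 3 → ℝ)

/-- The standard basis of the coordinate space. -/
def coordBasis : Module.Basis (Unit ⊕ Fin 26 ⊕ Fin 16 ⊕ Fin 8 ⊕ Fin 3) ℝ Coord :=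
  (Module.Basis.singleton Unit ℝ).prod ((Pi.basisFun ℝ (Fin 26)).prod
    ((Pi.basisFun ℝ (Fin 16)).prod ((Pi.basisFun ℝ (Fin 8)).prod (Pi.basisFun ℝ (Fin 3)))))

/-- `x₅₂ Y₂ + x₅₃ Y₈₂ + x₅₄ Y₉₉`. -/
def cartanV (v : Fin 3 → ℝ) : Matrix I56 I56 ℂ :=
  v 0 • frameE7 (0, Sum.inr ()) + v 1 • frameE7 (0, Sum.inl (Sum.inl 0))
    + v 2 • frameE7 (0, Sum.inl (Sum.inl 1))

/-- `e^{x₁ Y₁} B_{E₆} B_{F₄} B_{SO(9)} e^V`. -/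
def euler (B₆ : (Fin 26 → ℝ) → GL I27 ℂ) (B₄ : (Fin 16 → ℝ) → GL I27 ℂ)
    (B₉ : (Fin 8 → ℝ) → GL I27 ℂ) (x : Coord) : GL I56 ℂ :=
  expGL (x.1 • Y1) * psiGL (B₆ x.2.1) * psiGL (B₄ x.2.2.1) * psiGL (B₉ x.2.2.2.1)
    * expGL (cartanV x.2.2.2.2)

/-- The function `W`. -/
def W (x₁ x₂ x₃ : ℝ) : ℝ :=
  Real.sin ((√3 * x₂ + √2 * x₁ + x₃) / √3) * Real.sin ((√3 * x₂ - √2 * x₁ - x₃) / √3)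
    * Real.sin ((√6 * x₁ - 2 * √3 * x₃) / 3)
    * Real.sin ((√3 * x₂ + 2 * √2 * x₁ - x₃) / (2 * √3)) ^ 8
    * Real.sin ((√3 * x₂ - 2 * √2 * x₁ + x₃) / (2 * √3)) ^ 8
    * Real.sin ((x₂ - √3 * x₃) / 2) ^ 8 * Real.sin ((x₂ + √3 * x₃) / 2) ^ 8
    * Real.sin ((√2 * x₁ + x₃) / √3) ^ 8 * Real.sin x₂ ^ 8

/-- The measure `|W(x₅₂, x₅₃, x₅₄)| dx₅₂ dx₅₃ dx₅₄`. -/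
def measureW : Measure (Fin 3 → ℝ) :=
  volume.withDensity fun v => ENNReal.ofReal |W (v 0) (v 1) (v 2)|

/-- The change of variables `(x₅₂, x₅₃, x₅₄) ↦ (x, y, z)`. -/
def changeVar (v : Fin 3 → ℝ) : Fin 3 → ℝ :=
  ![(√6 * v 0 - 2 * √3 * v 2) / 3, (√3 * v 1 + √2 * v 0 + v 2) / √3,
    (√3 * v 1 - √2 * v 0 - v 2) / √3]

/-- The function `W` in the variables `(x, y, z)`. -/
def Wxyz (x y z : ℝ) : ℝ :=
  Real.sin x * Real.sin y * Real.sin z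
    * Real.sin ((x - y) / 2) ^ 8 * Real.sin ((x + y) / 2) ^ 8
    * Real.sin ((x - z) / 2) ^ 8 * Real.sin ((x + z) / 2) ^ 8
    * Real.sin ((y - z) / 2) ^ 8 * Real.sin ((y + z) / 2) ^ 8

end E7

end

noncomputable section

/-! ### Octonion identities: alternativity and the associative trace. -/

namespace Oct

/-! Write the parametrization as `u * e^V` with `u` in `U`. Since `V` runs over an abelian subspace
of 𝔭, the current is `e^{-V} (u⁻¹ du) e^V + dV`. By invariance of the trace form, its component
along `Y ∈ 𝔭` is `⟨e^V Y e^{-V}, u⁻¹ du⟩ + ⟨Y, dV⟩`. Here `V = P(i d)` with `d` a real diagonal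
element of 𝔍, and conjugation by `e^V` acts by plane rotations. For `j_a` in position `(i,j)`, `P(i
j_a)` turns towards the derivation `[L_{e_i-e_j}, L_{j_a}]` with angle `(d_i-d_j)/2` up to sign, and
`P(j_a)` turns towards `C̃_a` with angle `(d_i+d_j)/2`. `P(e_i)` turns towards a combination of `Y₁`
and the two diagonal `C̃` with angle `d_i`, and the `P(i d')` with `d'` diagonal are fixed
(`exp_conj_pI_off`, `exp_conj_pR_off`, `exp_conj_pR_eD`, `exp_conj_pI_dg`). The part of the rotated
vector that stays in 𝔭 is orthogonal to `u⁻¹ du`, so only the sines survive. These angles are the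
restricted roots of the symmetric space: three simple ones and six of multiplicity eight, whence
`|W|` (`ip_frameE7_current_euler`, `abs_W_eq`).

What remains is the determinant of `u⁻¹ du` on the frames of the successive quotients. Each factor
of `u` is conjugated by the later ones. This rotates the corresponding frame by an orthogonal
matrix, and the resulting matrix is block triangular, so the determinant is the product of the
densities of the factors (`absDet_factorForm`). Here the currents of the maps to `F₄` and `SO(9)`
must be known to lie in the respective Lie algebras (`lieF4_current_mem`, `lieSO9_current_mem`).

The brackets rest on one fact about 𝔍, besides the associativity of its trace form: every element
satisfies its cubic characteristic equation. The polarized equation `jmul_cube_polarized` gives the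
anticommutators of the `A_α` among themselves and with `L_y`. It also gives the Jordan identity,
hence the fact that `[L_u, L_v]` is a derivation, and the trace of `L_u L_v`. Bordering `A(u)` by
`±u/√2` (`hat`) turns these into the brackets of the representation 56.

Invariance of the density follows from the same mechanism: two lifts of a map to the quotient differ
by a map `u` to `U`. Conjugation by `u` rotates the frame of 𝔭, while `u⁻¹ du` commutes with the
grading `Gr` and is therefore orthogonal to 𝔭 (`density_invariant`). -/

@[simp] theorem conj_fst (x : Oct) : (conj x).fst = star x.fst := rfl
@[simp] theorem conj_snd (x : Oct) : (conj x).snd = -x.snd := rfl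
@[simp] theorem sub_fst (x y : Oct) : (x - y).fst = x.fst - y.fst := rfl
@[simp] theorem sub_snd (x y : Oct) : (x - y).snd = x.snd - y.snd := rfl

theorem smul_one_mul (a : ℝ) (x : Oct) : (a • (1 : Oct)) * x = a • x := by
  ext <;> simp

theorem mul_smul_one (a : ℝ) (x : Oct) : x * (a • (1 : Oct)) = a • x := by
  ext <;> simp

theorem conj_conj (x : Oct) : conj (conj x) = x := by
  ext <;> simp

theorem conj_add (x y : Oct) : conj (x + y) = conj x + conj y := by
  ext <;> simp <;> ring

theorem conj_smul (a : ℝ) (x : Oct) : conj (a • x) = a • conj x := by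
  ext <;> simp

theorem conj_mul (x y : Oct) : conj (x * y) = conj y * conj x := by
  ext <;> simp

theorem mul_conj_add (x y : Oct) : x * conj y + y * conj x = (2 * re (x * conj y)) • (1 : Oct) := by
  ext <;> simp [re] <;> ring

theorem conj_mul_add (x y : Oct) : conj x * y + conj y * x = (2 * re (x * conj y)) • (1 : Oct) := by
  ext <;> simp [re] <;> ring

theorem mul_add' (x y z : Oct) : x * (y + z) = x * y + x * z := by
  ext <;> simp <;> ring

theorem add_mul' (x y z : Oct) : (x + y) * z = x * z + y * z := by
  ext <;> simp <;> ring

theorem smul_mul' (a : ℝ) (x y : Oct) : (a • x) * y = a • (x * y) := by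
  ext <;> simp <;> ring

theorem mul_smul' (a : ℝ) (x y : Oct) : x * (a • y) = a • (x * y) := by
  ext <;> simp <;> ring

theorem re_add (x y : Oct) : re (x + y) = re x + re y := rfl
theorem re_smul (a : ℝ) (x : Oct) : re (a • x) = a * re x := rfl
theorem re_conj (x : Oct) : re (conj x) = re x := by simp [re]
theorem re_mul_comm (x y : Oct) : re (x * y) = re (y * x) := by
  simp [re]; ring
theorem re_mul_assoc (x y z : Oct) : re ((x * y) * z) = re (x * (y * z)) := by
  simp [re]; ring

/-- The alternative laws, in the form that the norm produces. With the associativity of the real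
part they take the place of associativity in all that follows. -/
theorem mul_conj_mul (x y : Oct) : x * (conj x * y) = re (x * conj x) • y := by
  ext <;> simp [re] <;> ring

theorem mul_mul_conj (x y : Oct) : (x * y) * conj y = re (y * conj y) • x := by
  ext <;> simp [re] <;> ring

theorem conj_mul_mul (x y : Oct) : conj x * (x * y) = re (x * conj x) • y := by
  have h := mul_conj_mul (conj x) y
  rwa [conj_conj, re_mul_comm (conj x)] at h

theorem mul_conj_mul_self (x y : Oct) : (x * conj y) * y = re (y * conj y) • x := by
  have h := mul_mul_conj x (conj y)
  rwa [conj_conj, re_mul_comm (conj y)] at h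

theorem re_mul_conj_mul (x y z : Oct) : re (z * (conj y * x)) = re (x * (z * conj y)) := by
  rw [← re_mul_assoc, re_mul_comm]

theorem re_conj_mul_mul_conj (x y z : Oct) :
    re (conj x * (y * conj z)) = re (x * (z * conj y)) := by
  rw [← re_conj, conj_mul, conj_mul, conj_conj, conj_conj, re_mul_assoc, re_mul_conj_mul]

end Oct

/-! ### Hermitian octonionic matrices: product, trace form and cubic equation. -/

namespace E7

/-- The sums of products with their conjugates on the diagonal are real, which is why the product is
Hermitian again. All later computations in 𝔍 reduce to six entries through this formula. -/
theorem jordan_herm (a b c a' b' c' : ℝ) (x y z x' y' z' : Oct) :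
    jordan (herm a b c x y z) (herm a' b' c' x' y' z') =
      herm (a * a' + Oct.re (x * Oct.conj x') + Oct.re (y * Oct.conj y'))
        (b * b' + Oct.re (x * Oct.conj x') + Oct.re (z * Oct.conj z'))
        (c * c' + Oct.re (y * Oct.conj y') + Oct.re (z * Oct.conj z'))
        ((1 / 2 : ℝ) • ((a + b) • x' + (a' + b') • x + (y * Oct.conj z' + y' * Oct.conj z)))
        ((1 / 2 : ℝ) • ((a + c) • y' + (a' + c') • y + (x * z' + x' * z)))
        ((1 / 2 : ℝ) • ((b + c) • z' + (b' + c') • z + (Oct.conj x * y' + Oct.conj x' * y))) := by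
  have hx := Oct.mul_conj_add x x'
  have hy := Oct.mul_conj_add y y'
  have hz := Oct.mul_conj_add z z'
  have hx' := Oct.conj_mul_add x x'
  have hy' := Oct.conj_mul_add y y'
  have hz' := Oct.conj_mul_add z z'
  funext i j
  fin_cases i <;> fin_cases j <;>
    simp only [jordan, herm, Matrix.mul_apply, Fin.sum_univ_three, Matrix.smul_apply,
      Matrix.add_apply, Matrix.of_apply, Matrix.cons_val', Matrix.cons_val_zero,
      Matrix.cons_val_one, Matrix.cons_val, Fin.zero_eta, Fin.mk_one, Fin.reduceFinMk,
      Oct.smul_one_mul, Oct.mul_smul_one, Oct.conj_add, Oct.conj_smul, Oct.conj_mul, Oct.conj_conj]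
  · linear_combination (norm := module) (1 / 2 : ℝ) • hx + (1 / 2 : ℝ) • hy
  · module
  · module
  · module
  · linear_combination (norm := module) (1 / 2 : ℝ) • hx' + (1 / 2 : ℝ) • hz
  · module
  · module
  · module
  · linear_combination (norm := module) (1 / 2 : ℝ) • hy' + (1 / 2 : ℝ) • hz'

theorem trJ_herm (a b c : ℝ) (x y z : Oct) : trJ (herm a b c x y z) = a + b + c := by
  simp [trJ, herm, Fin.sum_univ_three, Oct.re]

theorem herm_add (a b c a' b' c' : ℝ) (x y z x' y' z' : Oct) :
    herm a b c x y z + herm a' b' c' x' y' z' =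
      herm (a + a') (b + b') (c + c') (x + x') (y + y') (z + z') := by
  funext i j
  fin_cases i <;> fin_cases j <;> simp [herm, add_smul, Oct.conj_add]

theorem smul_herm (r a b c : ℝ) (x y z : Oct) :
    r • herm a b c x y z = herm (r * a) (r * b) (r * c) (r • x) (r • y) (r • z) := by
  funext i j
  fin_cases i <;> fin_cases j <;> simp [herm, mul_smul, Oct.conj_smul]

theorem one_eq_herm : (1 : Mat3) = herm 1 1 1 0 0 0 := by
  funext i j
  fin_cases i <;> fin_cases j <;> simp [herm, Oct.conj] <;> rfl

theorem innerJ_herm (a b c a' b' c' : ℝ) (x y z x' y' z' : Oct) :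
    innerJ (herm a b c x y z) (herm a' b' c' x' y' z') =
      a * a' + b * b' + c * c' + 2 * (Oct.re (x * Oct.conj x') + Oct.re (y * Oct.conj y')
        + Oct.re (z * Oct.conj z')) := by
  rw [innerJ, jordan_herm, trJ_herm]; ring

/-- Only the cyclicity and associativity of the real part of a triple product of octonions enter;
this makes every `L_X` self-adjoint. -/
theorem innerJ_jordan_left (a b c a' b' c' a'' b'' c'' : ℝ) (x y z x' y' z' x'' y'' z'' : Oct) :
    innerJ (jordan (herm a b c x y z) (herm a' b' c' x' y' z')) (herm a'' b'' c'' x'' y'' z'') =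
      innerJ (herm a b c x y z) (jordan (herm a' b' c' x' y' z') (herm a'' b'' c'' x'' y'' z'')) := by
  simp only [jordan_herm, innerJ_herm, Oct.conj_add, Oct.conj_smul, Oct.smul_mul', Oct.mul_smul', Oct.add_mul', Oct.mul_add', Oct.re_add, Oct.re_smul, Oct.conj_mul,
    Oct.conj_conj, Oct.re_mul_assoc, Oct.re_conj_mul_mul_conj, Oct.re_mul_conj_mul]
  ring

/-- The Cayley–Hamilton theorem for 𝔍. Off the diagonal it is a consequence of alternativity. The
constant term may stay anonymous, because taking traces recovers it in `jmul_cube`. -/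
theorem jordan_herm_cube (a b c : ℝ) (x y z : Oct) :
    ∃ n : ℝ, jordan (herm a b c x y z) (jordan (herm a b c x y z) (herm a b c x y z)) +
      (((a + b + c) ^ 2 - innerJ (herm a b c x y z) (herm a b c x y z)) / 2) • herm a b c x y z =
      (a + b + c) • jordan (herm a b c x y z) (herm a b c x y z) + n • (1 : Mat3) := by
  -- The witness is the determinant of the Hermitian matrix.
  refine ⟨a * b * c + 2 * Oct.re (x * (z * Oct.conj y)) - a * Oct.re (z * Oct.conj z)
         - b * Oct.re (y * Oct.conj y) - c * Oct.re (x * Oct.conj x), ?_⟩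
  simp only [one_eq_herm, jordan_herm, innerJ_herm, herm_add, smul_herm, Oct.conj_add,
    Oct.conj_smul, Oct.smul_mul', Oct.mul_smul', Oct.add_mul', Oct.mul_add', Oct.re_add,
    Oct.re_smul, Oct.conj_mul,
    Oct.conj_conj, Oct.re_conj_mul_mul_conj, Oct.re_mul_conj_mul]
  congr 1
  · ring
  · ring
  · ring
  · simp only [Oct.mul_conj_mul, Oct.mul_mul_conj]
    module
  · simp only [Oct.mul_conj_mul, Oct.mul_conj_mul_self]
    module
  · simp only [Oct.conj_mul_mul, Oct.mul_conj_mul_self]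
    module

/-! ### Coordinates on 𝔍. -/

theorem _root_.Oct.re_unit_mul_conj (k : Fin 8) (x : Oct) :
    Oct.re (Oct.unit k * Oct.conj x) = ![x.fst.re, x.fst.imI, x.fst.imJ, x.fst.imK,
      x.snd.re, x.snd.imI, x.snd.imJ, x.snd.imK] k := by
  fin_cases k <;> simp [Oct.unit, Oct.re]

theorem _root_.Oct.sum_re_unit_smul (x : Oct) :
    ∑ k, Oct.re (Oct.unit k * Oct.conj x) • Oct.unit k = x := by
  simp only [Oct.re_unit_mul_conj, Fin.sum_univ_eight]
  ext <;> simp [Oct.unit]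

theorem _root_.Oct.re_unit_mul_conj_sum (c : Fin 8 → ℝ) (k : Fin 8) :
    Oct.re (Oct.unit k * Oct.conj (∑ l, c l • Oct.unit l)) = c k := by
  simp only [Oct.re_unit_mul_conj, Fin.sum_univ_eight]
  fin_cases k <;> simp [Oct.unit]

/-- The index of the off-diagonal basis element with entry `Oct.unit k` in position `s`. -/
abbrev iOff (s : Fin 3) (k : Fin 8) : I27 := Sum.inl (Sum.inr (s, k))

/-- The index of a traceless diagonal basis element. -/
abbrev iDiag (s : Fin 2) : I27 := Sum.inl (Sum.inl s)

/-- The index of the multiple of the identity. -/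
abbrev iOne : I27 := Sum.inr ()

/-- The off-diagonal entries of the element of `𝔍` with coordinates `v`. -/
def offEntry (v : I27 → ℝ) (s : Fin 3) : Oct := ∑ k, v (iOff s k) • Oct.unit k

/-- The diagonal entries of the element of `𝔍` with coordinates `v`. -/
def diagEntry (v : I27 → ℝ) : Fin 3 → ℝ :=
  ![v (iDiag 0) + v (iDiag 1) / √3 + √(2 / 3) * v iOne,
    -v (iDiag 0) + v (iDiag 1) / √3 + √(2 / 3) * v iOne,
    -2 * v (iDiag 1) / √3 + √(2 / 3) * v iOne]

theorem herm_sum (x y z : Fin 8 → Oct) :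
    ∑ k, herm 0 0 0 (x k) (y k) (z k) = herm 0 0 0 (∑ k, x k) (∑ k, y k) (∑ k, z k) := by
  simp [Fin.sum_univ_eight, herm_add]

theorem jvec_eq (v : I27 → ℝ) :
    jvec v = herm (diagEntry v 0) (diagEntry v 1) (diagEntry v 2)
      (offEntry v 0) (offEntry v 1) (offEntry v 2) := by
  simp only [jvec, Fintype.sum_sum_type, Fin.sum_univ_two, Fintype.sum_prod_type,
    Fin.sum_univ_three, Finset.univ_unique, Finset.sum_singleton, jb, smul_herm, herm_add, mul_zero,
    herm_sum, offEntry, diagEntry]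
  congr 1 <;> simp <;> ring

theorem jcoord_herm_diag_zero (a b c : ℝ) (x y z : Oct) :
    jcoord (herm a b c x y z) (iDiag 0) = (a - b) / 2 := by
  simp only [jcoord, jb, innerJ_herm]; simp [Oct.re]; ring

theorem jcoord_herm_diag_one (a b c : ℝ) (x y z : Oct) :
    jcoord (herm a b c x y z) (iDiag 1) = (a + b - 2 * c) / (2 * √3) := by
  simp only [jcoord, jb, innerJ_herm]; simp [Oct.re]; field_simp; ring

theorem jcoord_herm_one (a b c : ℝ) (x y z : Oct) :
    jcoord (herm a b c x y z) iOne = √(2 / 3) * (a + b + c) / 2 := by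
  simp only [jcoord, jb, innerJ_herm]; simp [Oct.re]; ring

theorem jcoord_herm_off (a b c : ℝ) (x y z : Oct) (s : Fin 3) (k : Fin 8) :
    jcoord (herm a b c x y z) (iOff s k) = Oct.re (Oct.unit k * Oct.conj (![x, y, z] s)) := by
  simp only [jcoord, jb, innerJ_herm]
  fin_cases s <;> simp [Oct.re]

theorem jcoord_jvec (v : I27 → ℝ) : jcoord (jvec v) = v := by
  have h3 : √3 * √3 = 3 := Real.mul_self_sqrt (by norm_num)
  have h23 : √(2 / 3) * √(2 / 3) = 2 / 3 := Real.mul_self_sqrt (by norm_num)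
  funext μ
  rw [jvec_eq]
  rcases μ with (s | ⟨s, k⟩) | _
  · fin_cases s
    · exact (jcoord_herm_diag_zero ..).trans (by simp [diagEntry])
    · refine (jcoord_herm_diag_one ..).trans ?_
      simp [diagEntry]; field_simp; linear_combination (-2 * v (iDiag 1)) * h3
  · rw [jcoord_herm_off, ← Oct.re_unit_mul_conj_sum (fun k => v (iOff s k)) k]
    fin_cases s <;> rfl
  · refine (jcoord_herm_one ..).trans ?_
    simp only [diagEntry, Matrix.cons_val]
    linear_combination (3 / 2 * v iOne) * h23

/-- Coordinates are defined on all matrices but determine only the Hermitian ones, so a product has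
to be put in the form `herm` before it is recovered from its coordinates. -/
theorem jvec_jcoord_herm (a b c : ℝ) (x y z : Oct) :
    jvec (jcoord (herm a b c x y z)) = herm a b c x y z := by
  have h3 : √3 * √3 = 3 := Real.mul_self_sqrt (by norm_num)
  have h23 : √(2 / 3) * √(2 / 3) = 2 / 3 := Real.mul_self_sqrt (by norm_num)
  have key (s : Fin 3) : offEntry (jcoord (herm a b c x y z)) s = ![x, y, z] s := by
    simp only [offEntry, jcoord_herm_off, Oct.sum_re_unit_smul]
  have f : (a + b - 2 * c) / (2 * √3) / √3 = (a + b - 2 * c) / 6 := by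
    rw [div_div, show 2 * √3 * √3 = 6 by linear_combination 2 * h3]
  rw [jvec_eq, key, key, key]
  simp only [diagEntry, jcoord_herm_diag_zero, jcoord_herm_diag_one, jcoord_herm_one, f,
    mul_div_assoc, Matrix.cons_val]
  congr 1 <;> linear_combination ((a + b + c) / 2) * h23

/-- Supplies the distributive laws for products of octonionic matrices; associativity is neither
available nor used. -/
instance : NonUnitalNonAssocRing Oct :=
  { (inferInstance : AddCommGroup Oct), (inferInstance : Mul Oct) with
    left_distrib := Oct.mul_add'
    right_distrib := Oct.add_mul'
    zero_mul := fun x => by ext <;> simp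
    mul_zero := fun x => by ext <;> simp }

instance : IsScalarTower ℝ Oct Oct := ⟨fun a x y => Oct.smul_mul' a x y⟩
instance : SMulCommClass ℝ Oct Oct := ⟨fun a x y => (Oct.mul_smul' a x y).symm⟩

/-! ### The Jordan product in coordinates and the polarized cubic equation. -/

theorem jordan_comm (X Y : Mat3) : jordan X Y = jordan Y X := by
  rw [jordan, jordan, add_comm]

theorem jordan_add (X Y Z : Mat3) : jordan X (Y + Z) = jordan X Y + jordan X Z := by
  rw [jordan, jordan, jordan, Matrix.mul_add, Matrix.add_mul]; module

theorem jordan_smul (r : ℝ) (X Y : Mat3) : jordan X (r • Y) = r • jordan X Y := by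
  rw [jordan, jordan, Matrix.mul_smul, Matrix.smul_mul]; module

theorem trJ_add (X Y : Mat3) : trJ (X + Y) = trJ X + trJ Y := by
  simp [trJ, Oct.re_add, Finset.sum_add_distrib]

theorem trJ_smul (r : ℝ) (X : Mat3) : trJ (r • X) = r * trJ X := by
  simp [trJ, Oct.re_smul, Finset.mul_sum]

/-- `jcoord` as a linear map. -/
def jcoordₗ : Mat3 →ₗ[ℝ] (I27 → ℝ) where
  toFun := jcoord
  map_add' X Y := by
    funext μ; simp only [jcoord, innerJ, jordan_add, trJ_add, Pi.add_apply]; ring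
  map_smul' r X := by
    funext μ; simp only [jcoord, innerJ, jordan_smul, trJ_smul, Pi.smul_apply, smul_eq_mul,
      RingHom.id_apply]; ring

theorem jcoord_add (X Y : Mat3) : jcoord (X + Y) = jcoord X + jcoord Y := jcoordₗ.map_add X Y
theorem jcoord_sub (X Y : Mat3) : jcoord (X - Y) = jcoord X - jcoord Y := jcoordₗ.map_sub X Y
theorem jcoord_smul (r : ℝ) (X : Mat3) : jcoord (r • X) = r • jcoord X := jcoordₗ.map_smul r X

theorem jvec_add (u v : I27 → ℝ) : jvec (u + v) = jvec u + jvec v := by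
  simp [jvec, add_smul, Finset.sum_add_distrib]

theorem jvec_smul (r : ℝ) (u : I27 → ℝ) : jvec (r • u) = r • jvec u := by
  simp [jvec, mul_smul, Finset.smul_sum]

theorem jvec_single (μ : I27) : jvec (Pi.single μ 1) = jb μ := by
  simp [jvec, Pi.single_apply, ite_smul]

theorem jvec_injective : Function.Injective jvec :=
  Function.LeftInverse.injective jcoord_jvec

/-- The trace in coordinates. -/
def tr (u : I27 → ℝ) : ℝ := trJ (jvec u)

/-- The coordinates of the identity. -/
def jone : I27 → ℝ := jcoord 1

theorem jvec_jone : jvec jone = 1 := by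
  rw [jone, one_eq_herm, jvec_jcoord_herm]

theorem jvec_jmul (u v : I27 → ℝ) : jvec (jmul u v) = jordan (jvec u) (jvec v) := by
  rw [jmul, jvec_eq u, jvec_eq v, jordan_herm, jvec_jcoord_herm]

theorem jmul_comm (u v : I27 → ℝ) : jmul u v = jmul v u := by
  rw [jmul, jordan_comm, jmul]

theorem jmul_add (u v w : I27 → ℝ) : jmul u (v + w) = jmul u v + jmul u w := by
  rw [jmul, jvec_add, jordan_add, jcoord_add, jmul, jmul]

theorem jmul_smul (r : ℝ) (u v : I27 → ℝ) : jmul u (r • v) = r • jmul u v := by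
  rw [jmul, jvec_smul, jordan_smul, jcoord_smul, jmul]

theorem add_jmul (u v w : I27 → ℝ) : jmul (u + v) w = jmul u w + jmul v w := by
  simp only [jmul_comm _ w, jmul_add]

theorem smul_jmul (r : ℝ) (u v : I27 → ℝ) : jmul (r • u) v = r • jmul u v := by
  simp only [jmul_comm _ v, jmul_smul]

/-- `jmul` as a bilinear map. -/
def jmulₗ : (I27 → ℝ) →ₗ[ℝ] (I27 → ℝ) →ₗ[ℝ] (I27 → ℝ) :=
  LinearMap.mk₂ ℝ jmul add_jmul smul_jmul jmul_add jmul_smul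

theorem jmul_sub (u v w : I27 → ℝ) : jmul u (v - w) = jmul u v - jmul u w := (jmulₗ u).map_sub v w
theorem jmul_zero (u : I27 → ℝ) : jmul u 0 = 0 := (jmulₗ u).map_zero
theorem sub_jmul (u v w : I27 → ℝ) : jmul (u - v) w = jmul u w - jmul v w :=
  jmulₗ.map_sub₂ u v w
theorem zero_jmul (u : I27 → ℝ) : jmul 0 u = 0 := jmulₗ.map_zero₂ u

theorem jone_jmul (u : I27 → ℝ) : jmul jone u = u := by
  apply jvec_injective
  rw [jvec_jmul, jvec_jone, one_eq_herm, jvec_eq, jordan_herm]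
  simp only [show ∀ x : Oct, Oct.re (0 * x) = 0 from fun x => by simp [Oct.re]]
  have h0 : Oct.conj 0 = 0 := by ext <;> simp
  congr 1 <;> simp [h0] <;> module

theorem jmul_jone (u : I27 → ℝ) : jmul u jone = u := by rw [jmul_comm, jone_jmul]

theorem tr_add (u v : I27 → ℝ) : tr (u + v) = tr u + tr v := by
  rw [tr, jvec_add, trJ_add, tr, tr]

theorem tr_smul (r : ℝ) (u : I27 → ℝ) : tr (r • u) = r * tr u := by
  rw [tr, jvec_smul, trJ_smul, tr]

theorem tr_jone : tr jone = 3 := by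
  rw [tr, jvec_jone, one_eq_herm, trJ_herm]; norm_num

/-- The factor 2 is the normalization of the basis; it persists as `tr (u ∘ v) = 2 u·v` in all trace
identities. -/
theorem innerJ_jvec (u v : I27 → ℝ) : innerJ (jvec u) (jvec v) = 2 * (u ⬝ᵥ v) := by
  have h (μ : I27) : innerJ (jb μ) (jvec v) = 2 * v μ := by
    have := congrFun (jcoord_jvec v) μ
    rw [← this, jcoord]; ring
  have h2 : innerJ (jvec u) (jvec v) = ∑ μ, u μ * innerJ (jb μ) (jvec v) := by
    let f : Mat3 →ₗ[ℝ] ℝ :=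
      { toFun := fun X => innerJ X (jvec v)
        map_add' := fun X Y => by
          simp only [innerJ, jordan_comm _ (jvec v), jordan_add, trJ_add]
        map_smul' := fun r X => by
          simp only [innerJ, jordan_comm _ (jvec v), jordan_smul, trJ_smul]; rfl }
    have h3 : f (jvec u) = ∑ μ, f (u μ • jb μ) := by rw [← map_sum]; rfl
    simp only [map_smul] at h3
    exact h3
  rw [h2, dotProduct, Finset.mul_sum]
  exact Finset.sum_congr rfl fun μ _ => by rw [h]; ring

theorem tr_jmul (u v : I27 → ℝ) : tr (jmul u v) = 2 * (u ⬝ᵥ v) := by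
  rw [tr, jvec_jmul, ← innerJ_jvec, innerJ]

theorem tr_eq_dot (u : I27 → ℝ) : tr u = 2 * (jone ⬝ᵥ u) := by
  rw [← tr_jmul, jone_jmul]

theorem jmul_dot (u v w : I27 → ℝ) : jmul u v ⬝ᵥ w = u ⬝ᵥ jmul v w := by
  have h := innerJ_jordan_left (diagEntry u 0) (diagEntry u 1) (diagEntry u 2)
    (diagEntry v 0) (diagEntry v 1) (diagEntry v 2) (diagEntry w 0) (diagEntry w 1) (diagEntry w 2)
    (offEntry u 0) (offEntry u 1) (offEntry u 2) (offEntry v 0) (offEntry v 1) (offEntry v 2)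
    (offEntry w 0) (offEntry w 1) (offEntry w 2)
  rw [← jvec_eq, ← jvec_eq, ← jvec_eq, ← jvec_jmul, ← jvec_jmul, innerJ_jvec, innerJ_jvec] at h
  linarith

theorem dot_jmul_comm (u v w : I27 → ℝ) : u ⬝ᵥ jmul v w = v ⬝ᵥ jmul u w := by
  rw [← jmul_dot, ← jmul_dot, jmul_comm]

/-- Every element is a root of its cubic characteristic polynomial. -/
theorem jmul_cube (u : I27 → ℝ) :
    jmul u (jmul u u) + (tr u ^ 2 / 2 - u ⬝ᵥ u) • u = tr u • jmul u u +
      (2 / 3 * (u ⬝ᵥ jmul u u) + tr u ^ 3 / 6 - tr u * (u ⬝ᵥ u)) • jone := by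
  obtain ⟨n, hn⟩ := jordan_herm_cube (diagEntry u 0) (diagEntry u 1) (diagEntry u 2)
    (offEntry u 0) (offEntry u 1) (offEntry u 2)
  have ht : diagEntry u 0 + diagEntry u 1 + diagEntry u 2 = tr u := by
    rw [tr, jvec_eq, trJ_herm]
  rw [ht, ← jvec_eq, innerJ_jvec, ← jvec_jmul, ← jvec_jmul, ← jvec_jone, ← jvec_smul, ← jvec_smul,
    ← jvec_smul, ← jvec_add, ← jvec_add] at hn
  have hn := jvec_injective hn
  -- Traces fix the constant term, since the identity has trace 3.
  have h3 := congrArg tr hn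
  simp only [tr_add, tr_smul, tr_jmul, tr_jone] at h3
  have : n = 2 / 3 * (u ⬝ᵥ jmul u u) + tr u ^ 3 / 6 - tr u * (u ⬝ᵥ u) := by linarith
  rw [← this, ← hn]
  congr 2; ring

/-- The full linearization of `jmul_cube`. -/
theorem jmul_cube_polarized (u v w : I27 → ℝ) :
    (2 : ℝ) • (jmul u (jmul v w) + jmul v (jmul u w) + jmul w (jmul u v))
      + (tr u * tr v - 2 * (u ⬝ᵥ v)) • w + (tr u * tr w - 2 * (u ⬝ᵥ w)) • v
      + (tr v * tr w - 2 * (v ⬝ᵥ w)) • u =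
    (2 * tr u) • jmul v w + (2 * tr v) • jmul u w + (2 * tr w) • jmul u v
      + (4 * (u ⬝ᵥ jmul v w) + tr u * tr v * tr w
        - 2 * (tr u * (v ⬝ᵥ w) + tr v * (u ⬝ᵥ w) + tr w * (u ⬝ᵥ v))) • jone := by
  have h1 := jmul_cube (u + v + w)
  have h2 := jmul_cube (u + v)
  have h3 := jmul_cube (u + w)
  have h4 := jmul_cube (v + w)
  have h5 := jmul_cube u
  have h6 := jmul_cube v
  have h7 := jmul_cube w
  simp only [jmul_add, add_jmul, tr_add, dotProduct_add, add_dotProduct, jmul_comm v u,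
    jmul_comm w u, jmul_comm w v, dotProduct_comm v u, dotProduct_comm w u, dotProduct_comm w v,
    dot_jmul_comm v u, dot_jmul_comm w u, dot_jmul_comm w v] at h1 h2 h3 h4
  -- Inclusion–exclusion over `u + v + w` isolates the part of a cubic map that is linear in each
  -- argument.
  linear_combination (norm := module) h1 - h2 - h3 - h4 + h5 + h6 + h7

/-! ### Multiplication operators. -/

theorem eq_of_mulVec_eq {m n : Type*} [Fintype n] {M N : Matrix m n ℝ}
    (h : ∀ w, M *ᵥ w = N *ᵥ w) : M = N := by
  classical exact Matrix.toLin'.injective (LinearMap.ext h)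

/-- The matrix of multiplication by an element given in coordinates. -/
def Lm (u : I27 → ℝ) : Matrix I27 I27 ℝ := mulMat (jvec u)

theorem Lm_eq (u : I27 → ℝ) : Lm u = LinearMap.toMatrix' (jmulₗ u) := by
  ext μ ν
  rw [LinearMap.toMatrix'_apply]
  change jcoord (jordan (jvec u) (jb ν)) μ = jmul u (Pi.single ν 1) μ
  rw [jmul, jvec_single]

theorem Lm_mulVec (u v : I27 → ℝ) : Lm u *ᵥ v = jmul u v := by
  rw [Lm_eq, LinearMap.toMatrix'_mulVec]; rfl

theorem Lm_add (u v : I27 → ℝ) : Lm (u + v) = Lm u + Lm v := by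
  simp only [Lm_eq, map_add]

theorem Lm_smul (r : ℝ) (u : I27 → ℝ) : Lm (r • u) = r • Lm u := by
  simp only [Lm_eq, map_smul]

theorem Lm_sum {ι : Type*} (s : Finset ι) (f : ι → I27 → ℝ) :
    Lm (∑ i ∈ s, f i) = ∑ i ∈ s, Lm (f i) := by
  simp only [Lm_eq, map_sum]

theorem Lm_jone : Lm jone = 1 :=
  eq_of_mulVec_eq fun w => by rw [Lm_mulVec, jone_jmul, one_mulVec]

theorem transpose_eq_of_dot {M N : Matrix I27 I27 ℝ}
    (h : ∀ v w, (M *ᵥ v) ⬝ᵥ w = v ⬝ᵥ (N *ᵥ w)) : Mᵀ = N := by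
  refine eq_of_mulVec_eq fun w => dotProduct_eq _ _ fun v => ?_
  rw [dotProduct_comm, dotProduct_comm (N *ᵥ w), ← h, mulVec_transpose, dotProduct_comm v,
    ← dotProduct_mulVec, dotProduct_comm]

theorem Lm_transpose (u : I27 → ℝ) : (Lm u)ᵀ = Lm u :=
  transpose_eq_of_dot fun v w => by rw [Lm_mulVec, Lm_mulVec, jmul_comm, jmul_dot]

/-! ### The Freudenthal product and the relations between its operators and `L_u`. -/

/-- The Freudenthal product in coordinates. -/
def fmul (u v : I27 → ℝ) : I27 → ℝ :=
  jmul u v - (tr u / 2) • v - (tr v / 2) • u + ((tr u * tr v) / 2 - u ⬝ᵥ v) • jone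

/-- `fmul` as a bilinear map. -/
def fmulₗ : (I27 → ℝ) →ₗ[ℝ] (I27 → ℝ) →ₗ[ℝ] (I27 → ℝ) :=
  LinearMap.mk₂ ℝ fmul
    (fun u v w => by simp only [fmul, add_jmul, tr_add, add_dotProduct]; module)
    (fun r u v => by simp only [fmul, smul_jmul, tr_smul, smul_dotProduct, smul_eq_mul]; module)
    (fun u v w => by simp only [fmul, jmul_add, tr_add, dotProduct_add]; module)
    (fun r u v => by simp only [fmul, jmul_smul, tr_smul, dotProduct_smul, smul_eq_mul]; module)

theorem jcoord_freudenthal (u v : I27 → ℝ) :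
    jcoord (freudenthal (jvec u) (jvec v)) = fmul u v := by
  have h : trJ (jordan (jvec u) (jvec v)) = 2 * (u ⬝ᵥ v) := innerJ_jvec u v
  rw [freudenthal, jcoord_add, jcoord_sub, jcoord_sub, jcoord_smul, jcoord_smul, jcoord_smul,
    jcoord_jvec, jcoord_jvec, h, fmul]
  change jmul u v - _ - _ + _ • jone = _
  rw [tr, tr]
  module

/-- The matrix `∑ u^α A_α`. -/
def Am (u : I27 → ℝ) : Matrix I27 I27 ℝ := ∑ α, u α • freudMat α

theorem freudMat_eq (α : I27) : freudMat α = LinearMap.toMatrix' (fmulₗ (Pi.single α 1)) := by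
  ext μ ν
  rw [LinearMap.toMatrix'_apply]
  change jcoord (freudenthal (jb α) (jb ν)) μ = fmul (Pi.single α 1) (Pi.single ν 1) μ
  rw [← jcoord_freudenthal, jvec_single, jvec_single]

theorem Am_eq (u : I27 → ℝ) : Am u = LinearMap.toMatrix' (fmulₗ u) := by
  conv_rhs => rw [pi_eq_sum_univ' u]
  simp only [Am, freudMat_eq, map_sum, map_smul]

theorem Am_mulVec (u v : I27 → ℝ) : Am u *ᵥ v = fmul u v := by
  rw [Am_eq, LinearMap.toMatrix'_mulVec]; rfl

theorem Am_smul (r : ℝ) (u : I27 → ℝ) : Am (r • u) = r • Am u := by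
  simp only [Am_eq, map_smul]

theorem dot_jone (u : I27 → ℝ) : u ⬝ᵥ jone = tr u / 2 := by
  rw [tr_eq_dot, dotProduct_comm]; ring

theorem fmul_comm (u v : I27 → ℝ) : fmul u v = fmul v u := by
  rw [fmul, fmul, jmul_comm, dotProduct_comm]; module

theorem Am_transpose (u : I27 → ℝ) : (Am u)ᵀ = Am u :=
  transpose_eq_of_dot fun v w => by
    simp only [Am_mulVec, fmul, sub_dotProduct, add_dotProduct, dotProduct_sub, dotProduct_add,
      smul_dotProduct, dotProduct_smul, smul_eq_mul, dot_jone,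
      jmul_comm u v, jmul_dot]
    rw [dotProduct_comm jone w, dot_jone, dotProduct_comm u v]
    ring

theorem vecMulVec_mulVec_dot (u v w : I27 → ℝ) : vecMulVec u v *ᵥ w = (v ⬝ᵥ w) • u := by
  rw [vecMulVec_mulVec]; ext; simp [mul_comm]

theorem tr_sub (u v : I27 → ℝ) : tr (u - v) = tr u - tr v := by
  rw [tr_eq_dot, dotProduct_sub, tr_eq_dot u, tr_eq_dot v]; ring

/-- Pure bookkeeping of the trace corrections in the Freudenthal product: commutativity and the
associative trace form suffice. The rank-two term is what the border of `hat` contributes to a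
product. -/
theorem Am_commutator (u v : I27 → ℝ) :
    Am u * Am v - Am v * Am u + (1 / 2 : ℝ) • (vecMulVec u v - vecMulVec v u) =
      Lm u * Lm v - Lm v * Lm u := by
  refine eq_of_mulVec_eq fun w => ?_
  simp only [sub_mulVec, add_mulVec, smul_mulVec, ← mulVec_mulVec, Am_mulVec, Lm_mulVec,
    vecMulVec_mulVec_dot]
  simp only [fmul, jmul_add, jmul_sub, jmul_smul, jmul_jone, dotProduct_add, dotProduct_sub,
    dotProduct_smul, smul_eq_mul, dot_jone, tr_add, tr_sub, tr_smul, tr_jone, dotProduct_comm v u,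
    jmul_comm v u, dot_jmul_comm v u, tr_jmul]
  module

/-- In contrast to the commutator, the symmetric combination contains `u(vw) + v(uw)`, and the
polarized cubic equation is what reduces it to `w(uv)`. -/
theorem Am_anticommutator (u v : I27 → ℝ) :
    Am u * Am v + Am v * Am u - (1 / 2 : ℝ) • (vecMulVec u v + vecMulVec v u) =
      (u ⬝ᵥ v) • 1 - Lm (jmul u v) := by
  refine eq_of_mulVec_eq fun w => ?_
  have h := jmul_cube_polarized u v w
  simp only [sub_mulVec, add_mulVec, smul_mulVec, ← mulVec_mulVec, Am_mulVec, Lm_mulVec,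
    vecMulVec_mulVec_dot, one_mulVec]
  simp only [fmul, jmul_add, jmul_sub, jmul_smul, jmul_jone, dotProduct_add, dotProduct_sub,
    dotProduct_smul, smul_eq_mul, dot_jone, tr_add, tr_sub, tr_smul, tr_jone, dotProduct_comm v u,
    jmul_comm v u, dot_jmul_comm v u, tr_jmul, jmul_comm _ w, dotProduct_comm w v, dotProduct_comm w u]
  simp only [jmul_comm _ w, dotProduct_comm w v, dotProduct_comm w u] at h
  have e : v ⬝ᵥ jmul w u = u ⬝ᵥ jmul w v := by rw [jmul_comm, dot_jmul_comm, jmul_comm v]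
  rw [e]
  linear_combination (norm := module) (1 / 2 : ℝ) • h

/-- Applied to `w`, this is the invariance of the polarized determinant under the traceless `L_y`,
which is the reason why these operators extend `Lie(F₄)` to `Lie(E₆)`. It is again the polarized
cubic equation. -/
theorem Lm_Am_anticommutator {y : I27 → ℝ} (hy : tr y = 0) (u : I27 → ℝ) :
    Lm y * Am u + Am u * Lm y = -Am (jmul y u) := by
  refine eq_of_mulVec_eq fun w => ?_
  have h := jmul_cube_polarized y u w
  simp only [neg_mulVec, add_mulVec, ← mulVec_mulVec, Am_mulVec, Lm_mulVec]
  simp only [fmul, jmul_add, jmul_sub, jmul_smul, jmul_jone, dotProduct_add, dotProduct_sub,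
    dotProduct_smul, smul_eq_mul, dot_jone, tr_add, tr_sub, tr_smul, tr_jone,
    tr_jmul, jmul_comm _ w, hy, jmul_dot]
  simp only [jmul_comm _ w, hy] at h
  have e : u ⬝ᵥ jmul w y = y ⬝ᵥ jmul w u := by
    rw [jmul_comm, dot_jmul_comm, jmul_comm u]
  rw [← e] at h ⊢
  rw [dotProduct_comm w y]
  linear_combination (norm := module) (1 / 2 : ℝ) • h

/-- The Jordan identity. -/
theorem jmul_sq_comm (x y : I27 → ℝ) :
    jmul x (jmul (jmul x x) y) = jmul (jmul x x) (jmul x y) := by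
  have hx := jmul_cube x
  have h1 := jmul_cube_polarized x x y
  -- Multiplying the polarized equation for `(x, x, y)` by `x` and subtracting the one for `(x, x,
  -- xy)` cancels `x(x(xy))` and leaves the Jordan identity, up to terms handled by the cubic
  -- equation of `x`.
  have h2 := congrArg (jmul x) h1
  have h3 := jmul_cube_polarized x x (jmul x y)
  simp only [jmul_add, jmul_smul, jmul_jone, tr_jmul, jmul_comm _ (jmul x x),
    jmul_comm y] at h2 h3
  have e : x ⬝ᵥ jmul x (jmul x y) = jmul x (jmul x x) ⬝ᵥ y := by
    rw [← jmul_dot, ← jmul_dot, jmul_comm (jmul x x)]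
  have e2 : x ⬝ᵥ jmul x y = jmul x x ⬝ᵥ y := by rw [← jmul_dot]
  have e3 := congrArg (fun v => v ⬝ᵥ y) hx
  simp only [add_dotProduct, smul_dotProduct, smul_eq_mul] at e3
  have e4 : jone ⬝ᵥ y = tr y / 2 := by rw [dotProduct_comm, dot_jone]
  rw [e, e2] at h3
  rw [e2, jmul_comm (jmul x x) x] at h2
  -- The scalar coefficients still differ by a cubic pairing; the cubic equation of `x`, paired with
  -- `y`, evaluates it.
  have e5 : jmul x (jmul x x) ⬝ᵥ y = tr x * (jmul x x ⬝ᵥ y) +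
      (2 / 3 * (x ⬝ᵥ jmul x x) + tr x ^ 3 / 6 - tr x * (x ⬝ᵥ x)) * (tr y / 2) -
      (tr x ^ 2 / 2 - x ⬝ᵥ x) * (x ⬝ᵥ y) := by rw [← e4]; linarith
  rw [e5] at h3
  linear_combination (norm := module) (1 / 2 : ℝ) • h2 - (1 / 2 : ℝ) • h3 + tr y • hx

theorem jmul_sq_comm_polarized (a b c z : I27 → ℝ) :
    jmul a (jmul (jmul b c) z) + jmul b (jmul (jmul a c) z) + jmul c (jmul (jmul a b) z) =
      jmul (jmul b c) (jmul a z) + jmul (jmul a c) (jmul b z) + jmul (jmul a b) (jmul c z) := by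
  have h1 := jmul_sq_comm (a + b + c) z
  have h2 := jmul_sq_comm (a + b) z
  have h3 := jmul_sq_comm (a + c) z
  have h4 := jmul_sq_comm (b + c) z
  have h5 := jmul_sq_comm a z
  have h6 := jmul_sq_comm b z
  have h7 := jmul_sq_comm c z
  simp only [jmul_add, add_jmul, jmul_comm b a, jmul_comm c a, jmul_comm c b] at h1 h2 h3 h4
  linear_combination (norm := module) (1 / 2 : ℝ) • (h1 - h2 - h3 - h4 + h5 + h6 + h7)

/-- Commutators of multiplication operators are derivations. -/
theorem isDerivation_commutator (u v : I27 → ℝ) : IsDerivation (Lm u * Lm v - Lm v * Lm u) := by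
  intro b c
  simp only [sub_mulVec, ← mulVec_mulVec, Lm_mulVec, jmul_sub, sub_jmul]
  -- The linearized Jordan identity with `v` and with `u` as its fourth argument; their difference
  -- is the Leibniz rule.
  have h1 := jmul_sq_comm_polarized u b c v
  have h2 := jmul_sq_comm_polarized v b c u
  rw [jmul_comm (jmul b c) v, jmul_comm (jmul u c) v, jmul_comm (jmul u b) v, jmul_comm b v,
    jmul_comm c v, jmul_comm (jmul u c)] at h1
  rw [jmul_comm (jmul b c) u, jmul_comm (jmul v c) u, jmul_comm (jmul v b) u, jmul_comm b u,
    jmul_comm c u, jmul_comm v u, jmul_comm (jmul v c)] at h2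
  rw [jmul_comm (jmul u (jmul v b)) c, jmul_comm (jmul v (jmul u b)) c]
  linear_combination (norm := module) h1 - h2

/-! ### Traces of the multiplication and Freudenthal operators. -/

theorem _root_.Oct.re_unit_mul_conj_self (k : Fin 8) :
    Oct.re (Oct.unit k * Oct.conj (Oct.unit k)) = 1 := by
  rw [Oct.re_unit_mul_conj]; fin_cases k <;> simp [Oct.unit]

theorem _root_.Oct.conj_zero : Oct.conj 0 = 0 := by ext <;> simp

theorem _root_.Oct.re_zero : Oct.re 0 = 0 := rfl

theorem jordan_jb_off_self (s : Fin 3) (k : Fin 8) :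
    jordan (jb (iOff s k)) (jb (iOff s k)) =
      herm (![1, 1, 0] s) (![1, 0, 1] s) (![0, 1, 1] s) 0 0 0 := by
  simp only [jb, jordan_herm]
  fin_cases s <;> simp [Oct.re_unit_mul_conj_self, Oct.conj_zero, Oct.re_zero]

/-- The constant agrees with traces: each of the 27 squares has trace 2, and 54 = 18 · 3. The sum is
the vector against which `u` is paired to give the trace of `L_u`. -/
theorem sum_jmul_single : ∑ ν, jmul (Pi.single ν 1) (Pi.single ν 1) = (18 : ℝ) • jone := by
  have h3 : √3 * √3 = 3 := Real.mul_self_sqrt (by norm_num)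
  have h23 : √(2 / 3) * √(2 / 3) = 2 / 3 := Real.mul_self_sqrt (by norm_num)
  have h3' : 1 / √3 * (1 / √3) = 1 / 3 := by rw [div_mul_div_comm, h3]; norm_num
  have hs (ν : I27) : jmul (Pi.single ν 1) (Pi.single ν 1) = jcoordₗ (jordan (jb ν) (jb ν)) := by
    rw [jmul, jvec_single]; rfl
  have h1 : (18 : ℝ) • jone = jcoordₗ ((18 : ℝ) • 1) := by rw [map_smul]; rfl
  simp only [hs, h1, ← map_sum]
  congr 1
  simp only [Fintype.sum_sum_type, Fin.sum_univ_two, Fintype.sum_prod_type,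
    Fin.sum_univ_three, Finset.univ_unique, Finset.sum_singleton, one_eq_herm, jordan_jb_off_self,
    Finset.sum_const, Finset.card_univ, Fintype.card_fin, ← Nat.cast_smul_eq_nsmul ℝ]
  simp only [jb, jordan_herm, smul_herm, herm_add, Oct.conj_zero, zero_mul, Oct.re_zero,
    Matrix.cons_val]
  congr 1
  · push_cast; linear_combination h3' + h23
  · push_cast; linear_combination h3' + h23
  · push_cast; linear_combination 4 * h3' + h23
  all_goals simp

theorem mulVec_single_one_apply (M : Matrix I27 I27 ℝ) (ν : I27) :
    (M *ᵥ Pi.single ν 1) ν = M ν ν := by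
  rw [mulVec_single_one]; rfl

theorem trace_Lm (u : I27 → ℝ) : (Lm u).trace = 9 * tr u := by
  have h : (Lm u).trace = ∑ ν, u ⬝ᵥ jmul (Pi.single ν 1) (Pi.single ν 1) := by
    refine Finset.sum_congr rfl fun ν _ => ?_
    rw [dot_jmul_comm, single_one_dotProduct, ← Lm_mulVec, diag_apply, mulVec_single_one_apply]
  rw [h, ← dotProduct_sum, sum_jmul_single, dotProduct_smul, dot_jone, smul_eq_mul]
  ring

theorem trace_Am_mul_Am (u v : I27 → ℝ) : (Am u * Am v).trace = 5 * (u ⬝ᵥ v) := by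
  have h := congrArg Matrix.trace (Am_anticommutator u v)
  simp only [trace_sub, trace_add, trace_smul, trace_one, trace_vecMulVec, trace_Lm, tr_jmul,
    smul_eq_mul, trace_mul_comm (Am v), dotProduct_comm v u] at h
  norm_num [Fintype.card_sum, Fintype.card_prod] at h
  linarith

/-- For traceless `u` and `v` the polarized cubic equation is an identity of operators acting on its
third argument; its trace is an equation for the trace of `L_u L_v`, all other terms being of rank
one or multiples of the identity or of a single `L`. -/
theorem trace_Lm_mul_Lm {u v : I27 → ℝ} (hu : tr u = 0) (hv : tr v = 0) :
    (Lm u * Lm v).trace = 6 * (u ⬝ᵥ v) := by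
  have key : (2 : ℝ) • (Lm u * Lm v + Lm v * Lm u + Lm (jmul u v)) - (2 * (u ⬝ᵥ v)) • 1
      - (2 : ℝ) • vecMulVec v u - (2 : ℝ) • vecMulVec u v =
      (4 : ℝ) • vecMulVec (jmul u v) jone + (4 : ℝ) • vecMulVec jone (jmul u v)
      - (4 * (u ⬝ᵥ v)) • vecMulVec jone jone := by
    refine eq_of_mulVec_eq fun w => ?_
    have h := jmul_cube_polarized u v w
    simp only [sub_mulVec, add_mulVec, smul_mulVec, ← mulVec_mulVec, Lm_mulVec,
      vecMulVec_mulVec_dot, one_mulVec, jmul_dot, dotProduct_comm jone w, dot_jone,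
      jmul_comm _ w, hu, hv] at h ⊢
    linear_combination (norm := module) h
  have h := congrArg Matrix.trace key
  have h1 : jmul u v ⬝ᵥ jone = u ⬝ᵥ v := by rw [jmul_dot, jmul_jone]
  simp only [trace_sub, trace_add, trace_smul, trace_one, trace_vecMulVec, trace_Lm, tr_jmul,
    smul_eq_mul, trace_mul_comm (Lm v), dotProduct_comm v u, dotProduct_comm jone (jmul u v),
    h1, dot_jone, tr_jone] at h
  norm_num [Fintype.card_sum, Fintype.card_prod] at h
  linarith

/-! ### Derivations of 𝔍. -/

namespace IsDerivation

variable {D : Matrix I27 I27 ℝ}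

theorem commutator_Lm (hD : IsDerivation D) (u : I27 → ℝ) :
    D * Lm u - Lm u * D = Lm (D *ᵥ u) :=
  eq_of_mulVec_eq fun w => by
    simp only [sub_mulVec, ← mulVec_mulVec, Lm_mulVec, hD u w]; abel

/-- `L_{Du}` is the commutator `[D, L_u]`, hence traceless, and the trace of `L` is proportional to
`tr`. Skewness of `D` follows by applying this to a product. -/
theorem tr_mulVec (hD : IsDerivation D) (u : I27 → ℝ) : tr (D *ᵥ u) = 0 := by
  have h := congrArg Matrix.trace (hD.commutator_Lm u)
  rw [trace_sub, trace_mul_comm, sub_self, trace_Lm] at h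
  linarith

theorem mulVec_jone (hD : IsDerivation D) : D *ᵥ jone = 0 := by
  have h := hD jone jone
  simp only [jone_jmul, jmul_jone] at h
  exact left_eq_add.mp h

theorem dot_mulVec (hD : IsDerivation D) (u v : I27 → ℝ) :
    (D *ᵥ u) ⬝ᵥ v = -(u ⬝ᵥ (D *ᵥ v)) := by
  have h := hD.tr_mulVec (jmul u v)
  rw [hD, tr_add, tr_jmul, tr_jmul] at h
  linarith

theorem transpose_eq (hD : IsDerivation D) : Dᵀ = -D :=
  transpose_eq_of_dot fun u v => by rw [hD.dot_mulVec, neg_mulVec, dotProduct_neg]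

theorem commutator_Am (hD : IsDerivation D) (u : I27 → ℝ) :
    D * Am u - Am u * D = Am (D *ᵥ u) :=
  eq_of_mulVec_eq fun w => by
    simp only [sub_mulVec, ← mulVec_mulVec, Am_mulVec, fmul, mulVec_add, mulVec_sub, mulVec_smul,
      hD u w, hD.mulVec_jone, hD.tr_mulVec, hD.dot_mulVec]
    module

theorem add {D' : Matrix I27 I27 ℝ} (hD : IsDerivation D) (hD' : IsDerivation D') :
    IsDerivation (D + D') := fun u v => by
  simp only [add_mulVec, hD u v, hD' u v, add_jmul, jmul_add]; abel

theorem smul (hD : IsDerivation D) (r : ℝ) : IsDerivation (r • D) := fun u v => by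
  simp only [smul_mulVec, hD u v, smul_jmul, jmul_smul, smul_add]

theorem commutator {D' : Matrix I27 I27 ℝ} (hD : IsDerivation D) (hD' : IsDerivation D') :
    IsDerivation (D * D' - D' * D) := fun u v => by
  simp only [sub_mulVec, ← mulVec_mulVec, hD _ _, hD' _ _, mulVec_add, sub_jmul, jmul_sub]; abel

end IsDerivation

theorem isDerivation_zero : IsDerivation 0 := fun u v => by
  simp [zero_jmul, jmul_zero]

/-! ### Brackets in the representation 56 -/

/-- A real matrix regarded as a complex one, as a ring homomorphism. -/
def cM {n : Type} [Fintype n] [DecidableEq n] : Matrix n n ℝ →+* Matrix n n ℂ :=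
  Complex.ofRealHom.mapMatrix

theorem cM_smul {n : Type} [Fintype n] [DecidableEq n] (r : ℝ) (M : Matrix n n ℝ) :
    cM (r • M) = (r : ℂ) • cM M := by
  ext; simp [cM]

theorem cM_apply {n : Type} [Fintype n] [DecidableEq n] (M : Matrix n n ℝ) (i j : n) :
    cM M i j = M i j := rfl

theorem toC_eq_cM (M : Matrix I27 I27 ℝ) : toC M = cM M := rfl

/-- Extension by zero from `27` to `27 ⊕ 1`. -/
def ext0 (M : Matrix I27 I27 ℝ) : Matrix (I27 ⊕ Unit) (I27 ⊕ Unit) ℝ := fromBlocks M 0 0 0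

/-- The symmetric matrix with blocks `∑ u^α A_α` and `ε u / √2`. -/
def hat (ε : ℝ) (u : I27 → ℝ) : Matrix (I27 ⊕ Unit) (I27 ⊕ Unit) ℝ :=
  fromBlocks (Am u) ((ε / √2) • replicateCol Unit u) ((ε / √2) • replicateRow Unit u) 0

/-- `diag(1, -3)` on `27 ⊕ 1`. -/
def Km : Matrix (I27 ⊕ Unit) (I27 ⊕ Unit) ℝ := fromBlocks 1 0 0 ((-3 : ℝ) • 1)

theorem hat_smul (ε r : ℝ) (u : I27 → ℝ) : hat ε (r • u) = r • hat ε u := by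
  simp [hat, fromBlocks_smul, Am_smul, replicateCol_smul, replicateRow_smul, smul_comm r]

theorem mul_replicateCol (M : Matrix I27 I27 ℝ) (u : I27 → ℝ) :
    M * replicateCol Unit u = replicateCol Unit (M *ᵥ u) := by
  rw [replicateCol_mulVec]

theorem replicateRow_mul (M : Matrix I27 I27 ℝ) (u : I27 → ℝ) :
    replicateRow Unit u * M = replicateRow Unit (Mᵀ *ᵥ u) := by
  rw [mulVec_transpose, replicateRow_vecMul]

theorem ext0_commutator_hat {D : Matrix I27 I27 ℝ} (hD : IsDerivation D) (ε : ℝ) (u : I27 → ℝ) :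
    ext0 D * hat ε u - hat ε u * ext0 D = hat ε (D *ᵥ u) := by
  rw [ext0, hat, hat, fromBlocks_multiply, fromBlocks_multiply, sub_eq_add_neg, fromBlocks_neg,
    fromBlocks_add, ← hD.commutator_Am]
  simp [mul_replicateCol, replicateRow_mul, hD.transpose_eq, sub_eq_add_neg, neg_mulVec]
  ext; simp

/-- Relative to the border, the block `A` acquires a sign. This flip of `ε` is what makes `C̃`
exchange the real and imaginary directions of 𝔭. -/
theorem ext0_anticommutator_hat {y : I27 → ℝ} (hy : tr y = 0) (ε : ℝ) (u : I27 → ℝ) :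
    ext0 (Lm y) * hat ε u + hat ε u * ext0 (Lm y) = -hat (-ε) (jmul y u) := by
  rw [ext0, hat, hat, fromBlocks_multiply, fromBlocks_multiply, fromBlocks_neg,
    fromBlocks_add, ← Lm_Am_anticommutator hy]
  simp [mul_replicateCol, replicateRow_mul, Lm_transpose, Lm_mulVec, neg_div]

theorem Km_anticommutator_hat (ε : ℝ) (u : I27 → ℝ) :
    Km * hat ε u + hat ε u * Km = (2 : ℝ) • hat (-ε) u := by
  rw [Km, hat, hat, fromBlocks_multiply, fromBlocks_multiply, fromBlocks_smul,
    fromBlocks_add]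
  simp [neg_div]
  refine ⟨?_, ?_, ?_⟩ <;> module

theorem replicateCol_mul_replicateRow' (u v : I27 → ℝ) :
    replicateCol Unit u * replicateRow Unit v = vecMulVec u v := (vecMulVec_eq Unit u v).symm

theorem replicateRow_mul_replicateCol' (u v : I27 → ℝ) :
    replicateRow Unit u * replicateCol Unit v = (u ⬝ᵥ v) • (1 : Matrix Unit Unit ℝ) := by
  ext; simp [mul_apply, dotProduct]

/-- The borders cancel because the Freudenthal product is commutative, the corner because the dot
product is; the block on 𝔍 is `Am_commutator`. -/
theorem hat_commutator (u v : I27 → ℝ) :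
    hat 1 u * hat 1 v - hat 1 v * hat 1 u = ext0 (Lm u * Lm v - Lm v * Lm u) := by
  have h2 : √2 * √2 = 2 := Real.mul_self_sqrt (by norm_num)
  have h2' : (√2)⁻¹ * (√2)⁻¹ = (1 / 2 : ℝ) := by rw [← mul_inv, h2]; norm_num
  rw [ext0, hat, hat, fromBlocks_multiply, fromBlocks_multiply, sub_eq_add_neg, fromBlocks_neg,
    fromBlocks_add, ← Am_commutator]
  simp only [replicateCol_mul_replicateRow', replicateRow_mul_replicateCol', smul_mul_smul_comm,
    Matrix.mul_smul, Matrix.smul_mul, one_div, smul_smul, h2',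
    mul_replicateCol, replicateRow_mul, Am_transpose, Am_mulVec, fmul_comm v u,
    dotProduct_comm v u, Matrix.mul_zero, Matrix.zero_mul, add_zero]
  congr 1
  · module
  · module
  · module
  · module

/-- The corner is `-u·v`, which fixes the coefficient of `diag(1,-3)` to be a third of `u·v`. The
remaining two thirds on 𝔍 are exactly what makes the multiplication operator that of a traceless
element. -/
theorem hat_anticommutator (u v : I27 → ℝ) :
    hat 1 u * hat (-1) v + hat (-1) v * hat 1 u =
      ((u ⬝ᵥ v) / 3) • Km - ext0 (Lm (jmul u v - (2 / 3 * (u ⬝ᵥ v)) • jone)) := by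
  have h2 : √2 * √2 = 2 := Real.mul_self_sqrt (by norm_num)
  have hinv : (√2)⁻¹ * (√2)⁻¹ = (1 / 2 : ℝ) := by rw [← mul_inv, h2]; norm_num
  have hL : Lm (jmul u v - (2 / 3 * (u ⬝ᵥ v)) • jone) =
      Lm (jmul u v) - (2 / 3 * (u ⬝ᵥ v)) • 1 := by
    rw [← Lm_jone, ← Lm_smul, sub_eq_add_neg, ← neg_smul, Lm_add, Lm_smul, Lm_smul]; module
  have hA := Am_anticommutator u v
  rw [ext0, hat, hat, Km, fromBlocks_multiply, fromBlocks_multiply, fromBlocks_smul,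
    sub_eq_add_neg, fromBlocks_neg, fromBlocks_add, fromBlocks_add, hL]
  simp only [replicateCol_mul_replicateRow', replicateRow_mul_replicateCol', smul_mul_smul_comm,
    Matrix.mul_smul, Matrix.smul_mul, one_div, smul_smul, neg_div, neg_mul, mul_neg, hinv,
    mul_replicateCol, replicateRow_mul, Am_transpose, Am_mulVec, fmul_comm v u,
    dotProduct_comm v u, Matrix.mul_zero, Matrix.zero_mul, add_zero]
  congr 1
  · linear_combination (norm := module) hA
  · module
  · module
  · match_scalars; linear_combination (-2 * (u ⬝ᵥ v)) * hinv

/-- The elements `P(u)` with real `u`. -/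
def pR (u : I27 → ℝ) : Matrix I56 I56 ℂ := offDiag fun μ => (u μ : ℂ)

/-- The elements `P(i u)` with real `u`. -/
def pI (u : I27 → ℝ) : Matrix I56 I56 ℂ := offDiag fun μ => Complex.I * (u μ : ℂ)

theorem sum_smul_toC_freudMat (u : I27 → ℝ) :
    ∑ α, (u α : ℂ) • toC (freudMat α) = cM (Am u) := by
  simp only [Am, map_sum, cM_smul, toC_eq_cM]

theorem pR_eq (u : I27 → ℝ) :
    pR u = fromBlocks 0 (-cM (hat (-1) u)) (cM (hat (-1) u)) 0 := by
  have h : cM (hat (-1) u) = fromBlocks (cM (Am u)) (of fun μ _ => -(u μ : ℂ) / (√2 : ℝ))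
      (of fun _ μ => -(u μ : ℂ) / (√2 : ℝ)) 0 := by
    ext (i | i) (j | j) <;> simp [cM_apply, hat, div_eq_inv_mul]
  rw [pR, offDiag, h]
  simp only [Complex.star_def, Complex.conj_ofReal, sum_smul_toC_freudMat, fromBlocks_neg]
  congr 2
  · ext; simp [neg_div]
  · ext; simp [neg_div]
  · simp

theorem pI_eq (u : I27 → ℝ) :
    pI u = fromBlocks 0 (Complex.I • cM (hat 1 u)) (Complex.I • cM (hat 1 u)) 0 := by
  have h : cM (hat 1 u) = fromBlocks (cM (Am u)) (of fun μ _ => (u μ : ℂ) / (√2 : ℝ))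
      (of fun _ μ => (u μ : ℂ) / (√2 : ℝ)) 0 := by
    ext (i | i) (j | j) <;> simp [cM_apply, hat, div_eq_inv_mul]
  rw [pI, offDiag, h]
  simp only [Complex.star_def, map_mul, Complex.conj_I, Complex.conj_ofReal, mul_smul,
    ← Finset.smul_sum, sum_smul_toC_freudMat, fromBlocks_smul]
  congr 2
  · simp
  · ext; simp [mul_div_assoc]
  · ext; simp [mul_div_assoc]
  · simp
  · ext; simp [mul_div_assoc]
  · ext; simp [mul_div_assoc]
  · simp

theorem psi_toC {D : Matrix I27 I27 ℝ} (hD : IsDerivation D) :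
    psi (toC D) = fromBlocks (cM (ext0 D)) 0 0 (cM (ext0 D)) := by
  have h : cM (ext0 D) = fromBlocks (cM D) 0 0 0 := by
    ext (i | i) (j | j) <;> simp [cM_apply, ext0]
  have ht : -(cM D)ᵀ = cM D := by
    have : (cM D)ᵀ = cM Dᵀ := rfl
    rw [this, hD.transpose_eq, map_neg, neg_neg]
  rw [psi, h, toC_eq_cM, ht]

/-- The elements `ψ(-i L_y)`. -/
def psiL (y : I27 → ℝ) : Matrix I56 I56 ℂ := psi ((-Complex.I) • toC (Lm y))

theorem psiL_eq (y : I27 → ℝ) :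
    psiL y = fromBlocks ((-Complex.I) • cM (ext0 (Lm y))) 0 0 (Complex.I • cM (ext0 (Lm y))) := by
  have h : cM (ext0 (Lm y)) = fromBlocks (cM (Lm y)) 0 0 0 := by
    ext (i | i) (j | j) <;> simp [cM_apply, ext0]
  have ht : (cM (Lm y))ᵀ = cM (Lm y) := by
    have : (cM (Lm y))ᵀ = cM (Lm y)ᵀ := rfl
    rw [this, Lm_transpose]
  rw [psiL, psi, h, toC_eq_cM, transpose_smul, ht, fromBlocks_smul, fromBlocks_smul]
  simp

theorem Y1_eq : Y1 = fromBlocks ((Complex.I / (√6 : ℝ)) • cM Km) 0 0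
    (-((Complex.I / (√6 : ℝ)) • cM Km)) := by
  have h : cM Km = fromBlocks 1 0 0 ((-3 : ℂ) • 1) := by
    rw [Km]
    ext (i | i) (j | j) <;> simp [cM_apply, Matrix.one_apply, apply_ite Complex.ofReal]
  rw [Y1, h, fromBlocks_smul, ← smul_neg, fromBlocks_neg]
  simp

theorem lie_psi_toC_pR {D : Matrix I27 I27 ℝ} (hD : IsDerivation D) (u : I27 → ℝ) :
    ⁅psi (toC D), pR u⁆ = pR (D *ᵥ u) := by
  have h := congrArg cM (ext0_commutator_hat hD (-1) u)
  simp only [map_sub, map_mul] at h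
  rw [Ring.lie_def, psi_toC hD, pR_eq, pR_eq, fromBlocks_multiply, fromBlocks_multiply, ← h,
    sub_eq_add_neg, fromBlocks_neg, fromBlocks_add]
  simp only [Matrix.mul_zero, Matrix.zero_mul, add_zero, zero_add, neg_zero, Matrix.mul_neg,
    Matrix.neg_mul]
  congr 1; abel

theorem lie_psi_toC_pI {D : Matrix I27 I27 ℝ} (hD : IsDerivation D) (u : I27 → ℝ) :
    ⁅psi (toC D), pI u⁆ = pI (D *ᵥ u) := by
  have h := congrArg cM (ext0_commutator_hat hD 1 u)
  simp only [map_sub, map_mul] at h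
  rw [Ring.lie_def, psi_toC hD, pI_eq, pI_eq, fromBlocks_multiply, fromBlocks_multiply, ← h,
    sub_eq_add_neg, fromBlocks_neg, fromBlocks_add]
  simp only [Matrix.mul_zero, Matrix.zero_mul, add_zero, zero_add, neg_zero, Matrix.mul_smul,
    Matrix.smul_mul]
  congr 1 <;> module

theorem lie_psiL_pI {y : I27 → ℝ} (hy : tr y = 0) (u : I27 → ℝ) :
    ⁅psiL y, pI u⁆ = pR (jmul y u) := by
  have h := congrArg cM (ext0_anticommutator_hat hy 1 u)
  simp only [map_add, map_mul, map_neg] at h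
  rw [Ring.lie_def, psiL_eq, pI_eq, pR_eq, fromBlocks_multiply, fromBlocks_multiply,
    sub_eq_add_neg, fromBlocks_neg, fromBlocks_add, ← h, ← neg_eq_iff_eq_neg.mpr h]
  simp only [Matrix.mul_zero, Matrix.zero_mul, add_zero, zero_add, neg_zero, Matrix.mul_smul,
    Matrix.smul_mul, smul_smul, mul_neg, neg_mul, Complex.I_mul_I]
  congr 1 <;> module

theorem lie_psiL_pR {y : I27 → ℝ} (hy : tr y = 0) (u : I27 → ℝ) :
    ⁅psiL y, pR u⁆ = -pI (jmul y u) := by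
  have h := congrArg cM (ext0_anticommutator_hat hy (-1) u)
  simp only [map_add, map_mul, map_neg, neg_neg] at h
  rw [Ring.lie_def, psiL_eq, pI_eq, pR_eq, fromBlocks_multiply, fromBlocks_multiply,
    sub_eq_add_neg, fromBlocks_neg, fromBlocks_neg, fromBlocks_add, ← smul_neg, ← h]
  simp only [Matrix.mul_zero, Matrix.zero_mul, add_zero, zero_add, neg_zero, Matrix.mul_smul,
    Matrix.smul_mul, Matrix.mul_neg, Matrix.neg_mul]
  congr 1 <;> module

theorem lie_Y1_pI (u : I27 → ℝ) : ⁅Y1, pI u⁆ = (2 / √6) • pR u := by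
  have h := congrArg cM (Km_anticommutator_hat 1 u)
  simp only [map_add, map_mul, cM_smul] at h
  have h' : cM (hat (-1) u) = (1 / 2 : ℂ) • (cM Km * cM (hat 1 u) + cM (hat 1 u) * cM Km) := by
    rw [h, smul_smul]; norm_num
  rw [Ring.lie_def, Y1_eq, pI_eq, pR_eq, fromBlocks_multiply, fromBlocks_multiply,
    sub_eq_add_neg, fromBlocks_neg, fromBlocks_add, fromBlocks_smul, h', ← Complex.coe_smul,
    ← Complex.coe_smul]
  simp only [Matrix.mul_zero, Matrix.zero_mul, add_zero, zero_add, neg_zero, Matrix.mul_smul,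
    Matrix.smul_mul, Matrix.neg_mul, Matrix.mul_neg, smul_smul, smul_neg, smul_zero, smul_add,
    Complex.ofReal_div, div_mul_eq_mul_div, mul_div_assoc', Complex.I_mul_I]
  push_cast
  congr 1
  · module
  · module

theorem lie_Y1_pR (u : I27 → ℝ) : ⁅Y1, pR u⁆ = -(2 / √6) • pI u := by
  have h := congrArg cM (Km_anticommutator_hat (-1) u)
  simp only [map_add, map_mul, cM_smul, neg_neg] at h
  have h' : cM (hat 1 u) = (1 / 2 : ℂ) • (cM Km * cM (hat (-1) u) + cM (hat (-1) u) * cM Km) := by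
    rw [h, smul_smul]; norm_num
  rw [Ring.lie_def, Y1_eq, pI_eq, pR_eq, fromBlocks_multiply, fromBlocks_multiply,
    sub_eq_add_neg, fromBlocks_neg, fromBlocks_add, fromBlocks_smul, h', ← Complex.coe_smul]
  simp only [Matrix.mul_zero, Matrix.zero_mul, add_zero, zero_add, neg_zero, Matrix.mul_smul,
    Matrix.smul_mul, Matrix.neg_mul, Matrix.mul_neg, smul_smul, smul_neg, smul_zero, smul_add,
    Complex.ofReal_div]
  congr 1
  · module
  · module

/-- As the exponent `V` is of the form `pI`, only the brackets of 𝔭 with such an element are needed;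
against `pI` they are derivations, against `pR` they lie in the span of the `C̃` and `Y₁`. -/
theorem lie_pI_pI (u v : I27 → ℝ) :
    ⁅pI u, pI v⁆ = -psi (toC (Lm u * Lm v - Lm v * Lm u)) := by
  have h := congrArg cM (hat_commutator u v)
  rw [map_sub, map_mul, map_mul] at h
  rw [Ring.lie_def, psi_toC (isDerivation_commutator u v), pI_eq, pI_eq, fromBlocks_multiply,
    fromBlocks_multiply, ← h, sub_eq_add_neg, fromBlocks_neg, fromBlocks_neg, fromBlocks_add]
  simp only [Matrix.mul_zero, Matrix.zero_mul, add_zero, zero_add, neg_zero, Matrix.mul_smul,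
    Matrix.smul_mul, smul_smul, Complex.I_mul_I]
  congr 1 <;> module

theorem lie_pI_pR (u v : I27 → ℝ) :
    ⁅pI u, pR v⁆ =
      psiL (jmul u v - (2 / 3 * (u ⬝ᵥ v)) • jone) + (√6 / 3 * (u ⬝ᵥ v)) • Y1 := by
  have h := congrArg cM (hat_anticommutator u v)
  rw [map_sub, map_add, map_mul, map_mul, cM_smul] at h
  have h6 : (√6 : ℂ) ≠ 0 := by
    rw [Complex.ofReal_ne_zero]; positivity
  have h' : cM (ext0 (Lm (jmul u v - (2 / 3 * (u ⬝ᵥ v)) • jone))) = ((u ⬝ᵥ v / 3 : ℝ) : ℂ) • cM Km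
      - (cM (hat 1 u) * cM (hat (-1) v) + cM (hat (-1) v) * cM (hat 1 u)) := by rw [h]; abel
  rw [Ring.lie_def, psiL_eq, Y1_eq, pI_eq, pR_eq, fromBlocks_multiply,
    fromBlocks_multiply, h', sub_eq_add_neg, fromBlocks_neg, ← Complex.coe_smul, fromBlocks_smul,
    fromBlocks_add, fromBlocks_add]
  simp only [Matrix.mul_zero, Matrix.zero_mul, add_zero, zero_add, neg_zero, Matrix.mul_smul,
    Matrix.smul_mul, Matrix.neg_mul, Matrix.mul_neg, smul_zero]
  push_cast
  congr 1
  · match_scalars <;> field_simp <;> ring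
  · match_scalars <;> field_simp <;> ring

/-! ### Peirce decomposition with respect to the diagonal idempotents -/

/-- The diagonal element with entries `d`, in coordinates. -/
def dg (d : Fin 3 → ℝ) : I27 → ℝ := jcoord (herm (d 0) (d 1) (d 2) 0 0 0)

/-- The off-diagonal basis elements, in coordinates. -/
def off (s : Fin 3) (k : Fin 8) : I27 → ℝ := Pi.single (iOff s k) 1

/-- The row of the position `s` in `(12), (13), (23)`. -/
def fstIdx : Fin 3 → Fin 3 := ![0, 0, 1]

/-- The column of the position `s` in `(12), (13), (23)`. -/
def sndIdx : Fin 3 → Fin 3 := ![1, 2, 2]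

theorem jvec_dg (d : Fin 3 → ℝ) : jvec (dg d) = herm (d 0) (d 1) (d 2) 0 0 0 :=
  jvec_jcoord_herm ..

theorem jvec_off (s : Fin 3) (k : Fin 8) :
    jvec (off s k) = herm 0 0 0 (if s = 0 then Oct.unit k else 0) (if s = 1 then Oct.unit k else 0)
        (if s = 2 then Oct.unit k else 0) := jvec_single _

theorem dg_add (d d' : Fin 3 → ℝ) : dg (d + d') = dg d + dg d' := by
  apply jvec_injective; simp [jvec_add, jvec_dg, herm_add]

theorem dg_smul (r : ℝ) (d : Fin 3 → ℝ) : dg (r • d) = r • dg d := by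
  apply jvec_injective; simp [jvec_smul, jvec_dg, smul_herm]

theorem dg_one : dg 1 = jone := by
  apply jvec_injective; simp [jvec_dg, jvec_jone, one_eq_herm]

theorem jmul_dg_dg (d d' : Fin 3 → ℝ) : jmul (dg d) (dg d') = dg (d * d') := by
  apply jvec_injective
  rw [jvec_jmul, jvec_dg, jvec_dg, jvec_dg, jordan_herm]
  simp [Oct.conj_zero, Oct.re_zero]

theorem jmul_dg_off (d : Fin 3 → ℝ) (s : Fin 3) (k : Fin 8) :
    jmul (dg d) (off s k) = ((d (fstIdx s) + d (sndIdx s)) / 2) • off s k := by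
  apply jvec_injective
  rw [jvec_jmul, jvec_smul, jvec_dg, jvec_off, jordan_herm, smul_herm]
  congr 1 <;> fin_cases s <;>
    simp [Oct.conj_zero, Oct.re_zero, fstIdx, sndIdx, smul_smul, div_eq_inv_mul]

theorem tr_dg (d : Fin 3 → ℝ) : tr (dg d) = d 0 + d 1 + d 2 := by
  rw [tr, jvec_dg, trJ_herm]

theorem tr_off (s : Fin 3) (k : Fin 8) : tr (off s k) = 0 := by
  rw [tr, jvec_off, trJ_herm]; norm_num

theorem dg_dot_dg (d d' : Fin 3 → ℝ) : dg d ⬝ᵥ dg d' = (d 0 * d' 0 + d 1 * d' 1 + d 2 * d' 2) / 2 := by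
  have h := tr_jmul (dg d) (dg d')
  rw [jmul_dg_dg, tr_dg] at h
  simp only [Pi.mul_apply] at h
  linarith

theorem dot_off (u : I27 → ℝ) (s : Fin 3) (k : Fin 8) : u ⬝ᵥ off s k = u (iOff s k) := by
  rw [off, dotProduct_single_one]

theorem off_dot_off (s s' : Fin 3) (k k' : Fin 8) :
    off s k ⬝ᵥ off s' k' = if (s, k) = (s', k') then 1 else 0 := by
  rw [dot_off, off, Pi.single_apply]
  simp [eq_comm]

theorem dg_apply_off (d : Fin 3 → ℝ) (s : Fin 3) (k : Fin 8) : dg d (iOff s k) = 0 := by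
  rw [dg, jcoord_herm_off]; fin_cases s <;> simp [Oct.conj_zero, Oct.re_zero]

theorem dg_dot_off (d : Fin 3 → ℝ) (s : Fin 3) (k : Fin 8) : dg d ⬝ᵥ off s k = 0 := by
  rw [dot_off, dg_apply_off]

theorem herm_eq_dg (a b c : ℝ) : herm a b c 0 0 0 = jvec (dg ![a, b, c]) := by
  rw [jvec_dg]; rfl

/-- The diagonal entries of `j₁`, `j₁₈`, `j₂₇`. -/
def dgRow : Fin 2 ⊕ Unit → Fin 3 → ℝ :=
  Sum.elim ![![1, -1, 0], ![1 / √3, 1 / √3, -2 / √3]] fun _ => ![√(2 / 3), √(2 / 3), √(2 / 3)]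

theorem single_iDiag (s : Fin 2) : Pi.single (iDiag s) 1 = dg (dgRow (Sum.inl s)) := by
  apply jvec_injective
  rw [jvec_single, jvec_dg]
  fin_cases s <;> rfl

theorem single_iOne : Pi.single iOne 1 = dg (dgRow (Sum.inr ())) := by
  apply jvec_injective
  rw [jvec_single, jvec_dg]
  rfl

theorem eq_sum_off {w : I27 → ℝ} (h : ∀ d, w ⬝ᵥ dg d = 0) :
    w = ∑ s, ∑ k, w (iOff s k) • off s k := by
  have h0 (s : Fin 2) : w (iDiag s) = 0 := by
    rw [← dotProduct_single_one w (iDiag s), single_iDiag, h]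
  have h1 : w iOne = 0 := by
    rw [← dotProduct_single_one w iOne, single_iOne, h]
  funext μ
  rcases μ with (s | ⟨s, k⟩) | x
  · simpa [Finset.sum_apply, off, Pi.single_apply] using h0 s
  · simp only [Finset.sum_apply, off, Pi.smul_apply, Pi.single_apply, smul_eq_mul]
    rw [Finset.sum_eq_single s, Finset.sum_eq_single k] <;> simp +contextual [eq_comm]
  · simpa [Finset.sum_apply, off, Pi.single_apply] using h1

/-- The vector `δ_s = e_i - e_j`, where `(i, j)` is the position `s`. -/
def dlt : Fin 3 → Fin 3 → ℝ := ![![1, -1, 0], ![1, 0, -1], ![0, 1, -1]]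

/-- The derivations `[L_{e_i - e_j}, L_{j_a}]`. -/
def fD (s : Fin 3) (k : Fin 8) : Matrix I27 I27 ℝ :=
  Lm (dg (dlt s)) * Lm (off s k) - Lm (off s k) * Lm (dg (dlt s))

theorem isDerivation_fD (s : Fin 3) (k : Fin 8) : IsDerivation (fD s k) :=
  isDerivation_commutator _ _

/-- The entries of `dlt s` at the two places of the position `s` cancel, so `L_{dlt s}` kills `off s
k` and only one order of the commutator contributes. -/
theorem fD_mulVec_dg (s : Fin 3) (k : Fin 8) (d : Fin 3 → ℝ) :
    fD s k *ᵥ dg d = (-((d (fstIdx s) - d (sndIdx s)) / 2)) • off s k := by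
  rw [fD, sub_mulVec, ← mulVec_mulVec, ← mulVec_mulVec]
  simp only [Lm_mulVec, jmul_dg_dg, jmul_comm (off s k), jmul_dg_off, jmul_smul]
  fin_cases s <;> simp [dlt, fstIdx, sndIdx] <;> module

theorem fD_apply_dot (s s' : Fin 3) (k k' : Fin 8) :
    dg (dlt s) ⬝ᵥ (fD s' k' *ᵥ off s k) = if (s, k) = (s', k') then 1 else 0 := by
  rw [dotProduct_comm, (isDerivation_fD s' k').dot_mulVec, fD_mulVec_dg, dotProduct_smul,
    off_dot_off]
  by_cases h : (s, k) = (s', k')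
  · rw [if_pos h]
    obtain ⟨rfl, -⟩ := Prod.mk.inj h
    fin_cases s <;> simp [dlt, fstIdx, sndIdx]
  · rw [if_neg h]; simp

theorem tr_dg_dlt (s : Fin 3) : tr (dg (dlt s)) = 0 := by
  rw [tr_dg]; fin_cases s <;> simp [dlt]

/-! ### The invariant product -/

theorem ip_comm (X Y : Matrix I56 I56 ℂ) : ip X Y = ip Y X := by
  rw [ip, ip, trace_mul_comm]

theorem ip_add_left (X Y Z : Matrix I56 I56 ℂ) : ip (X + Y) Z = ip X Z + ip Y Z := by
  simp only [ip, Matrix.add_mul, trace_add, Complex.add_re]; ring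

theorem ip_smul_left (r : ℝ) (X Y : Matrix I56 I56 ℂ) : ip (r • X) Y = r * ip X Y := by
  simp only [ip, Matrix.smul_mul, trace_smul, Complex.smul_re, smul_eq_mul]; ring

/-- `ip` as a bilinear form. -/
def ipₗ : Matrix I56 I56 ℂ →ₗ[ℝ] Matrix I56 I56 ℂ →ₗ[ℝ] ℝ :=
  LinearMap.mk₂ ℝ ip ip_add_left ip_smul_left
    (fun X Y Z => by rw [ip_comm, ip_add_left, ip_comm Y, ip_comm Z])
    (fun r X Y => by rw [ip_comm, ip_smul_left, ip_comm Y, smul_eq_mul])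

theorem ip_add_right (X Y Z : Matrix I56 I56 ℂ) : ip X (Y + Z) = ip X Y + ip X Z :=
  (ipₗ X).map_add Y Z

theorem ip_smul_right (r : ℝ) (X Y : Matrix I56 I56 ℂ) : ip X (r • Y) = r * ip X Y :=
  (ipₗ X).map_smul r Y

theorem ip_zero_right (X : Matrix I56 I56 ℂ) : ip X 0 = 0 := (ipₗ X).map_zero

theorem ip_sum_left {ι : Type*} (s : Finset ι) (f : ι → Matrix I56 I56 ℂ) (X : Matrix I56 I56 ℂ) :
    ip (∑ i ∈ s, f i) X = ∑ i ∈ s, ip (f i) X := ipₗ.map_sum₂ s f X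

theorem ip_sum_right {ι : Type*} (s : Finset ι) (f : ι → Matrix I56 I56 ℂ) (X : Matrix I56 I56 ℂ) :
    ip X (∑ i ∈ s, f i) = ∑ i ∈ s, ip X (f i) := map_sum (ipₗ X) f s

theorem ip_lie (X Y Z : Matrix I56 I56 ℂ) : ip ⁅X, Y⁆ Z = -ip Y ⁅X, Z⁆ := by
  have h : (X * Y * Z).trace = (Y * Z * X).trace := by
    rw [Matrix.mul_assoc, trace_mul_comm]
  simp only [ip, Ring.lie_def, Matrix.sub_mul, Matrix.mul_sub, trace_sub, Complex.sub_re, h,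
    ← Matrix.mul_assoc]
  ring

theorem ip_conj (g : GL I56 ℂ) (X Y : Matrix I56 I56 ℂ) :
    ip (g.val * X * g⁻¹.val) Y = ip X (g⁻¹.val * Y * g.val) := by
  simp only [ip, Matrix.mul_assoc]
  rw [trace_mul_comm, Matrix.mul_assoc, Matrix.mul_assoc]

theorem trace_blocks {m n R : Type*} [Fintype m] [Fintype n] [AddCommMonoid R]
    (A : Matrix m m R) (B : Matrix m n R) (C : Matrix n m R) (D : Matrix n n R) :
    (fromBlocks A B C D).trace = A.trace + D.trace := by
  simp [trace]

/-- Five from the blocks `A` and a half from each border. With the two halves of the representation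
56 the total is twelve, the normalization of `ip`. -/
theorem trace_hat_mul_hat {ε : ℝ} (hε : ε * ε = 1) (u v : I27 → ℝ) :
    (hat ε u * hat ε v).trace = 6 * (u ⬝ᵥ v) := by
  have h2 : √2 * √2 = 2 := Real.mul_self_sqrt (by norm_num)
  have h2' : ε / √2 * (ε / √2) = (1 / 2 : ℝ) := by rw [div_mul_div_comm, hε, h2]
  rw [hat, hat, fromBlocks_multiply, trace_blocks]
  simp only [replicateCol_mul_replicateRow', replicateRow_mul_replicateCol',
    Matrix.mul_smul, Matrix.smul_mul, smul_smul, h2', trace_add, trace_Am_mul_Am, trace_smul,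
    trace_vecMulVec, Matrix.mul_zero, add_zero, trace_one, smul_eq_mul, mul_one]
  rw [← mul_assoc, h2']
  simp
  ring

theorem trace_cM {n : Type} [Fintype n] [DecidableEq n] (M : Matrix n n ℝ) :
    (cM M).trace = (M.trace : ℂ) := by
  simp [trace, cM_apply]

theorem ip_pR_pR (u v : I27 → ℝ) : ip (pR u) (pR v) = u ⬝ᵥ v := by
  rw [ip, pR_eq, pR_eq, fromBlocks_multiply, trace_blocks]
  simp only [Matrix.mul_zero, Matrix.neg_mul, Matrix.mul_neg, trace_neg, trace_add, add_zero,
    zero_add, ← map_mul, trace_cM, trace_hat_mul_hat (show (-1 : ℝ) * -1 = 1 by norm_num)]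
  simp
  ring

theorem ip_pI_pI (u v : I27 → ℝ) : ip (pI u) (pI v) = u ⬝ᵥ v := by
  rw [ip, pI_eq, pI_eq, fromBlocks_multiply, trace_blocks]
  simp only [Matrix.mul_zero, Matrix.smul_mul, Matrix.mul_smul, smul_smul, Complex.I_mul_I,
    trace_smul, add_zero,
    zero_add, ← map_mul, trace_cM, trace_hat_mul_hat (show (1 : ℝ) * 1 = 1 by norm_num)]
  simp
  ring

theorem ip_pR_pI (u v : I27 → ℝ) : ip (pR u) (pI v) = 0 := by
  rw [ip, pI_eq, pR_eq, fromBlocks_multiply, trace_blocks]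
  simp [trace_neg, trace_add]

theorem ip_block_offDiag (A B : Matrix (I27 ⊕ Unit) (I27 ⊕ Unit) ℂ) (z : I27 → ℂ) :
    ip (offDiag z) (fromBlocks A 0 0 B) = 0 := by
  rw [ip, offDiag, fromBlocks_multiply, trace_blocks]
  simp

theorem ip_psi_psi (X Y : Matrix I27 I27 ℂ) : ip (psi X) (psi Y) = -(1 / 6) * (X * Y).trace.re := by
  have h : (Xᵀ * Yᵀ).trace = (X * Y).trace := by
    rw [← transpose_mul, trace_transpose, trace_mul_comm]
  rw [ip, psi, psi, fromBlocks_multiply, trace_blocks, fromBlocks_multiply, fromBlocks_multiply]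
  simp [trace_blocks, h]
  ring

theorem ip_psiL_psiL {x y : I27 → ℝ} (hx : tr x = 0) (hy : tr y = 0) :
    ip (psiL x) (psiL y) = x ⬝ᵥ y := by
  rw [psiL, psiL, ip_psi_psi]
  simp only [toC_eq_cM, Matrix.smul_mul, Matrix.mul_smul, smul_smul, neg_mul_neg, Complex.I_mul_I,
    ← map_mul, trace_smul, trace_cM, trace_Lm_mul_Lm hx hy]
  simp

theorem ip_psiL_psi_toC (y : I27 → ℝ) (M : Matrix I27 I27 ℝ) :
    ip (psiL y) (psi (toC M)) = 0 := by
  rw [psiL, ip_psi_psi]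
  simp [toC_eq_cM, ← map_mul, trace_cM]

theorem ip_psi_toC_psi_toC (M N : Matrix I27 I27 ℝ) :
    ip (psi (toC M)) (psi (toC N)) = -(1 / 6) * (M * N).trace := by
  rw [ip_psi_psi]
  simp [toC_eq_cM, ← map_mul, trace_cM]

/-- A derivation is skew, so up to a positive factor its square is the sum of the squares of its
entries. -/
theorem ip_psi_toC_self {D : Matrix I27 I27 ℝ} (hD : IsDerivation D)
    (h : ip (psi (toC D)) (psi (toC D)) = 0) : D = 0 := by
  rw [ip_psi_toC_psi_toC] at h
  have h1 : (D * D).trace = -(Dᵀ * D).trace := by rw [hD.transpose_eq]; simp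
  have h2 : (Dᵀ * D).trace = 0 := by linarith
  rw [← conjTranspose_eq_transpose_of_trivial] at h2
  exact trace_conjTranspose_mul_self_eq_zero_iff.mp h2

theorem ip_Y1_psi (X : Matrix I27 I27 ℂ) : ip Y1 (psi X) = X.trace.im / (6 * √6) := by
  rw [ip, Y1, psi, Matrix.smul_mul, fromBlocks_multiply, fromBlocks_multiply, fromBlocks_multiply,
    trace_smul, trace_blocks]
  simp [trace_blocks, Complex.div_re, Complex.div_im]
  have h6 : √6 * √6 = 6 := Real.mul_self_sqrt (by norm_num)
  field_simp
  linear_combination 2 * X.trace.im * h6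

theorem ip_Y1_Y1 : ip Y1 Y1 = 1 := by
  have h6 : √6 * √6 = 6 := Real.mul_self_sqrt (by norm_num)
  rw [ip, Y1, Matrix.smul_mul, Matrix.mul_smul, fromBlocks_multiply, fromBlocks_multiply, fromBlocks_multiply,
    trace_smul, trace_smul, trace_blocks]
  simp [trace_blocks]
  field_simp
  linear_combination -12 * h6

/-- `ip` on inner derivations. -/
theorem ip_commutator {x y : I27 → ℝ} (hx : tr x = 0) {D : Matrix I27 I27 ℝ}
    (hD : IsDerivation D) :
    ip (psi (toC (Lm x * Lm y - Lm y * Lm x))) (psi (toC D)) = x ⬝ᵥ (D *ᵥ y) := by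
  have h := hD.commutator_Lm y
  -- Cyclicity moves the commutator from `L_x, L_y` to `D, L_y`, and `[D, L_y] = L_{Dy}`.
  have h1 : ((Lm x * Lm y - Lm y * Lm x) * D).trace = -(Lm x * Lm (D *ᵥ y)).trace := by
    rw [← h, Matrix.sub_mul, Matrix.mul_sub, trace_sub, trace_sub, Matrix.mul_assoc,
      Matrix.mul_assoc (Lm y), trace_mul_comm (Lm y), Matrix.mul_assoc]
    ring
  rw [ip_psi_toC_psi_toC, h1, trace_Lm_mul_Lm hx (hD.tr_mulVec y)]
  ring

/-! ### Orthonormal frames -/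

/-- Definiteness on the subalgebra replaces a count of dimensions: if an element is orthogonal to
the subalgebra, its component there is orthogonal to itself and vanishes. -/
theorem isOrthoFrame_of_decomposition {κ : Type} [DecidableEq κ] {𝔨 𝔥 : Set (Matrix I56 I56 ℂ)}
    {Y : κ → Matrix I56 I56 ℂ} (hY : ∀ k l, ip (Y k) (Y l) = if k = l then 1 else 0)
    (hmem : ∀ W ∈ Submodule.span ℝ (Set.range Y), W ∈ 𝔨)
    (horth : ∀ k, ∀ Z ∈ 𝔥, ip (Y k) Z = 0)
    (hdec : ∀ X ∈ 𝔨, ∃ Z ∈ 𝔥, ∃ W ∈ Submodule.span ℝ (Set.range Y), X = Z + W)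
    (hpos : ∀ Z ∈ 𝔥, ip Z Z = 0 → Z = 0) : IsOrthoFrame 𝔨 𝔥 Y := by
  have hspan (W) (hW : W ∈ Submodule.span ℝ (Set.range Y)) (Z) (hZ : Z ∈ 𝔥) : ip W Z = 0 := by
    induction hW using Submodule.span_induction with
    | mem x hx => obtain ⟨k, rfl⟩ := hx; exact horth k Z hZ
    | zero => rw [ip_comm, ip_zero_right]
    | add x y _ _ hx hy => rw [ip_add_left, hx, hy, add_zero]
    | smul r x _ hx => rw [ip_smul_left, hx, mul_zero]
  refine ⟨hY, Set.Subset.antisymm (fun W hW => ⟨hmem W hW, hspan W hW⟩) ?_⟩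
  rintro X ⟨hX, hXo⟩
  obtain ⟨Z, hZ, W, hW, rfl⟩ := hdec X hX
  have h := hXo Z hZ
  rw [ip_add_left, hspan W hW Z hZ, add_zero] at h
  rw [hpos Z hZ h, zero_add]
  exact hW

theorem offDiag_add (z w : I27 → ℂ) : offDiag (z + w) = offDiag z + offDiag w := by
  simp only [offDiag, fromBlocks_add, add_zero]
  congr 2
  · simp [add_smul, Finset.sum_add_distrib]; abel
  · ext; simp [add_div]
  · ext; simp [add_div]
  · simp [add_smul, Finset.sum_add_distrib]
  · ext; simp; ring
  · ext; simp; ring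

theorem offDiag_eq (z : I27 → ℂ) :
    offDiag z = pR (fun μ => (z μ).re) + pI (fun μ => (z μ).im) := by
  rw [pR, pI, ← offDiag_add]
  congr 1
  funext μ
  simp only [Pi.add_apply]
  rw [mul_comm, Complex.re_add_im]

theorem pR_add (u v : I27 → ℝ) : pR (u + v) = pR u + pR v := by
  rw [pR, pR, pR, ← offDiag_add]; congr 1; funext; simp

theorem pI_add (u v : I27 → ℝ) : pI (u + v) = pI u + pI v := by
  rw [pI, pI, pI, ← offDiag_add]; congr 1; funext; simp [mul_add]

theorem pR_smul (r : ℝ) (u : I27 → ℝ) : pR (r • u) = r • pR u := by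
  rw [pR_eq, pR_eq, hat_smul, cM_smul, fromBlocks_smul, ← Complex.coe_smul, ← Complex.coe_smul]
  simp

theorem pI_smul (r : ℝ) (u : I27 → ℝ) : pI (r • u) = r • pI u := by
  rw [pI_eq, pI_eq, hat_smul, cM_smul, fromBlocks_smul, ← Complex.coe_smul, smul_comm]
  simp

/-- `pR` as a linear map. -/
def pRₗ : (I27 → ℝ) →ₗ[ℝ] Matrix I56 I56 ℂ := ⟨⟨pR, pR_add⟩, pR_smul⟩

/-- `pI` as a linear map. -/
def pIₗ : (I27 → ℝ) →ₗ[ℝ] Matrix I56 I56 ℂ := ⟨⟨pI, pI_add⟩, pI_smul⟩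

theorem frameE7_zero (α : I27) : frameE7 (0, α) = pI (Pi.single α 1) := by
  rw [frameE7, pI]
  congr 1
  funext μ
  by_cases h : μ = α
  · subst h; simp
  · simp [h]

theorem frameE7_one (α : I27) : frameE7 (1, α) = pR (Pi.single α 1) := by
  rw [frameE7, pR]
  congr 1
  funext μ
  by_cases h : μ = α
  · subst h; simp
  · simp [h]

theorem eq_sum_single (u : I27 → ℝ) : u = ∑ α, u α • Pi.single α (1 : ℝ) := by
  conv_lhs => rw [pi_eq_sum_univ' u]

theorem pR_mem_span (u : I27 → ℝ) : pR u ∈ Submodule.span ℝ (Set.range frameE7) := by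
  rw [eq_sum_single u]
  change pRₗ _ ∈ _
  simp only [map_sum, map_smul]
  exact Submodule.sum_mem _ fun α _ => Submodule.smul_mem _ _
    (Submodule.subset_span ⟨(1, α), frameE7_one α⟩)

theorem pI_mem_span (u : I27 → ℝ) : pI u ∈ Submodule.span ℝ (Set.range frameE7) := by
  rw [eq_sum_single u]
  change pIₗ _ ∈ _
  simp only [map_sum, map_smul]
  exact Submodule.sum_mem _ fun α _ => Submodule.smul_mem _ _
    (Submodule.subset_span ⟨(0, α), frameE7_zero α⟩)

theorem mem_span_frameE7 {W : Matrix I56 I56 ℂ} :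
    W ∈ Submodule.span ℝ (Set.range frameE7) ↔ ∃ u v, W = pR u + pI v := by
  constructor
  · intro h
    have hle : Submodule.span ℝ (Set.range frameE7) ≤
        LinearMap.range (pRₗ.coprod pIₗ) := by
      rw [Submodule.span_le]
      rintro _ ⟨⟨i, α⟩, rfl⟩
      fin_cases i
      · exact ⟨(0, Pi.single α 1), by simp; exact (frameE7_zero α).symm⟩
      · exact ⟨(Pi.single α 1, 0), by simp; exact (frameE7_one α).symm⟩
    obtain ⟨⟨u, v⟩, rfl⟩ := hle h
    exact ⟨u, v, rfl⟩
  · rintro ⟨u, v, rfl⟩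
    exact Submodule.add_mem _ (pR_mem_span u) (pI_mem_span v)

theorem psi_add (X Y : Matrix I27 I27 ℂ) : psi (X + Y) = psi X + psi Y := by
  simp only [psi, fromBlocks_add, transpose_add, neg_add, add_zero]

theorem psi_smul (r : ℝ) (X : Matrix I27 I27 ℂ) : psi (r • X) = r • psi X := by
  simp [psi, fromBlocks_smul]

/-- `psi` as a linear map. -/
def psiₗ : Matrix I27 I27 ℂ →ₗ[ℝ] Matrix I56 I56 ℂ := ⟨⟨psi, psi_add⟩, psi_smul⟩

theorem toC_add (M N : Matrix I27 I27 ℝ) : toC (M + N) = toC M + toC N := cM.map_add M N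

theorem toC_smul (r : ℝ) (M : Matrix I27 I27 ℝ) : toC (r • M) = r • toC M := by
  rw [toC_eq_cM, cM_smul, ← Complex.coe_smul]; rfl

/-- `D ↦ ψ(D)` on real matrices. -/
def psiC : Matrix I27 I27 ℝ →ₗ[ℝ] Matrix I56 I56 ℂ := psiₗ ∘ₗ ⟨⟨toC, toC_add⟩, toC_smul⟩

theorem psiL_add (x y : I27 → ℝ) : psiL (x + y) = psiL x + psiL y := by
  rw [psiL, psiL, psiL, Lm_add, toC_add, smul_add, psi_add]

theorem psiL_smul (r : ℝ) (y : I27 → ℝ) : psiL (r • y) = r • psiL y := by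
  rw [psiL, psiL, Lm_smul, toC_smul, smul_comm, psi_smul]

/-- `psiL` as a linear map. -/
def psiLₗ : (I27 → ℝ) →ₗ[ℝ] Matrix I56 I56 ℂ := ⟨⟨psiL, psiL_add⟩, psiL_smul⟩

theorem frameE6_eq (a : I26) : frameE6 a = psiL (Pi.single (Sum.inl a) 1) := by
  rw [frameE6, cTilde, psiL, Lm, jvec_single]

theorem tr_single_inl (a : I26) : tr (Pi.single (Sum.inl a) 1) = 0 := by
  rcases a with s | ⟨s, k⟩
  · rw [single_iDiag, tr_dg]
    fin_cases s
    · simp [dgRow]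
    · simp [dgRow]; ring
  · exact tr_off s k

theorem psi_sum_cTilde (y : I26 → ℝ) :
    psi (∑ a, y a • cTilde a) = psiL (∑ a, y a • Pi.single (Sum.inl a) 1) := by
  change psiₗ _ = psiLₗ _
  simp only [map_sum, map_smul]
  exact Finset.sum_congr rfl fun a _ => congrArg _ (frameE6_eq a)

theorem tr_sum {ι : Type*} (s : Finset ι) (f : ι → I27 → ℝ) :
    tr (∑ i ∈ s, f i) = ∑ i ∈ s, tr (f i) := by
  simp only [tr_eq_dot, dotProduct_sum, Finset.mul_sum]

theorem tr_sum_single_inl (y : I26 → ℝ) :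
    tr (∑ a, y a • Pi.single (Sum.inl a) (1 : ℝ)) = 0 := by
  rw [tr_sum]
  exact Finset.sum_eq_zero fun a _ => by rw [tr_smul, tr_single_inl, mul_zero]

/-- The elements of `Lie(U)`. -/
theorem mem_lieU {S : Matrix I56 I56 ℂ} (hS : S ∈ lieU) :
    ∃ (ν : ℝ) (D : Matrix I27 I27 ℝ) (y : I27 → ℝ), IsDerivation D ∧ tr y = 0 ∧
      S = ν • Y1 + (psi (toC D) + psiL y) := by
  obtain ⟨ν, X, ⟨_, ⟨D, hD, rfl⟩, y, rfl⟩, rfl⟩ := hS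
  exact ⟨ν, D, _, hD, tr_sum_single_inl y, by rw [psi_add, psi_sum_cTilde]⟩

theorem toC_zero : toC 0 = 0 := map_zero cM

theorem zero_mem_lieF4 : (0 : Matrix I27 I27 ℂ) ∈ lieF4 := ⟨0, isDerivation_zero, toC_zero.symm⟩

theorem lieF4_subset_lieE6 : lieF4 ⊆ lieE6 := fun X hX => ⟨X, hX, 0, by simp⟩

theorem psi_zero : psi 0 = 0 := psiₗ.map_zero

theorem offDiag_zero : offDiag 0 = 0 := by
  have h := offDiag_add 0 0
  rw [add_zero] at h
  exact left_eq_add.mp h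

theorem zero_mem_lieU : (0 : Matrix I56 I56 ℂ) ∈ lieU :=
  ⟨0, 0, lieF4_subset_lieE6 zero_mem_lieF4, by rw [zero_smul, psi_zero, add_zero]⟩

theorem lieU_subset_lieE7 : lieU ⊆ lieE7 := fun S hS => ⟨S, hS, 0, by rw [offDiag_zero, add_zero]⟩

theorem ip_offDiag_lieU (z : I27 → ℂ) {S : Matrix I56 I56 ℂ} (hS : S ∈ lieU) :
    ip (offDiag z) S = 0 := by
  obtain ⟨ν, D, y, hD, -, rfl⟩ := mem_lieU hS
  rw [Y1_eq, psi_toC hD, psiL_eq, fromBlocks_smul, fromBlocks_add, fromBlocks_add, smul_zero,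
    add_zero, add_zero, ip_block_offDiag]

theorem ip_Y1_psi_toC (M : Matrix I27 I27 ℝ) : ip Y1 (psi (toC M)) = 0 := by
  rw [ip_Y1_psi, toC_eq_cM, trace_cM]; simp

theorem ip_Y1_psiL {y : I27 → ℝ} (hy : tr y = 0) : ip Y1 (psiL y) = 0 := by
  rw [psiL, ip_Y1_psi, toC_eq_cM, trace_smul, trace_cM, trace_Lm, hy]; simp

/-- The three parts of `Lie(U)` (phase, derivation, multiplication) are mutually orthogonal, and
each has nonnegative square. -/
theorem lieU_eq_zero_of_ip_self {S : Matrix I56 I56 ℂ} (hS : S ∈ lieU) (h : ip S S = 0) :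
    S = 0 := by
  obtain ⟨ν, D, y, hD, hy, rfl⟩ := mem_lieU hS
  have hDD : 0 ≤ ip (psi (toC D)) (psi (toC D)) := by
    rw [ip_psi_toC_psi_toC]
    have h1 : (D * D).trace = -(Dᴴ * D).trace := by
      rw [conjTranspose_eq_transpose_of_trivial, hD.transpose_eq]; simp
    have := (posSemidef_conjTranspose_mul_self D).trace_nonneg
    linarith
  have hyy : 0 ≤ y ⬝ᵥ y := Finset.sum_nonneg fun i _ => mul_self_nonneg (y i)
  simp only [ip_add_left, ip_add_right, ip_smul_left, ip_smul_right, ip_Y1_Y1, ip_Y1_psi_toC,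
    ip_Y1_psiL hy, ip_comm (psi (toC D)) Y1, ip_comm (psiL y) Y1, ip_psiL_psiL hy hy,
    ip_comm (psi (toC D)) (psiL y), ip_psiL_psi_toC] at h
  have hν : ν * ν = 0 := by nlinarith [mul_self_nonneg ν]
  have hD0 : ip (psi (toC D)) (psi (toC D)) = 0 := by nlinarith [mul_self_nonneg ν]
  have hy0 : y ⬝ᵥ y = 0 := by nlinarith [mul_self_nonneg ν]
  rw [mul_self_eq_zero.mp hν, ip_psi_toC_self hD hD0, dotProduct_self_eq_zero.mp hy0, toC_zero,
    psi_zero]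
  simp only [zero_smul, zero_add]
  exact psiLₗ.map_zero

theorem isOrthoFrame_frameE7 : IsOrthoFrame lieE7 lieU frameE7 := by
  refine isOrthoFrame_of_decomposition ?_ ?_ ?_ ?_ fun Z hZ => lieU_eq_zero_of_ip_self hZ
  · rintro ⟨i, α⟩ ⟨j, β⟩
    have h : (Pi.single α (1 : ℝ) : I27 → ℝ) ⬝ᵥ Pi.single β 1 = if α = β then 1 else 0 := by
      rw [dotProduct_single_one, Pi.single_apply]; simp [eq_comm]
    fin_cases i <;> fin_cases j <;>
      simp [frameE7_zero, frameE7_one, ip_pR_pR, ip_pI_pI, ip_pR_pI, ip_comm (pI _) (pR _), h]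
  · intro W hW
    obtain ⟨u, v, rfl⟩ := mem_span_frameE7.mp hW
    exact ⟨0, zero_mem_lieU, _, by rw [zero_add, pR, pI, ← offDiag_add]⟩
  · rintro k Z hZ
    exact ip_offDiag_lieU _ hZ
  · rintro _ ⟨S, hS, z, rfl⟩
    exact ⟨S, hS, _, by rw [offDiag_eq]; exact mem_span_frameE7.mpr ⟨_, _, rfl⟩, rfl⟩

theorem psi_image_lieF4_eq_zero_of_ip_self {Z : Matrix I56 I56 ℂ} (hZ : Z ∈ psi '' lieF4)
    (h : ip Z Z = 0) : Z = 0 := by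
  obtain ⟨_, ⟨D, hD, rfl⟩, rfl⟩ := hZ
  rw [ip_psi_toC_self hD h, toC_zero, psi_zero]

theorem mem_psi_image_lieF4 {D : Matrix I27 I27 ℝ} (hD : IsDerivation D) :
    psi (toC D) ∈ psi '' lieF4 := ⟨_, ⟨D, hD, rfl⟩, rfl⟩

theorem isOrthoFrame_frameE6 : IsOrthoFrame (psi '' lieE6) (psi '' lieF4) frameE6 := by
  refine isOrthoFrame_of_decomposition ?_ ?_ ?_ ?_ fun Z hZ => psi_image_lieF4_eq_zero_of_ip_self hZ
  · intro a b
    rw [frameE6_eq, frameE6_eq, ip_psiL_psiL (tr_single_inl a) (tr_single_inl b),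
      dotProduct_single_one, Pi.single_apply]
    simp [eq_comm]
  · intro W hW
    obtain ⟨y, rfl⟩ := (Submodule.mem_span_range_iff_exists_fun ℝ).mp hW
    refine ⟨∑ a, y a • cTilde a, ⟨0, zero_mem_lieF4, y, by simp⟩, ?_⟩
    change psiₗ _ = _
    simp only [map_sum, map_smul]
    rfl
  · rintro a _ ⟨_, ⟨D, hD, rfl⟩, rfl⟩
    rw [frameE6_eq, ip_psiL_psi_toC]
  · rintro _ ⟨_, ⟨_, ⟨D, hD, rfl⟩, y, rfl⟩, rfl⟩
    refine ⟨_, mem_psi_image_lieF4 hD, ∑ a, y a • frameE6 a,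
      Submodule.sum_mem _ fun a _ => Submodule.smul_mem _ _ (Submodule.subset_span ⟨a, rfl⟩), ?_⟩
    rw [psi_add]
    congr 1
    change psiₗ _ = _
    simp only [map_sum, map_smul]
    rfl

theorem mulMat_herm_diag (a b c : ℝ) : mulMat (herm a b c 0 0 0) = Lm (dg ![a, b, c]) := by
  rw [herm_eq_dg, Lm]

theorem frameF4_eq (i : Fin 2) (k : Fin 8) : frameF4 (i, k) = psi (toC (fD i.castSucc k)) := by
  have h (s : Fin 3) : Lm (off s k) = mulMat (herm 0 0 0 (if s = 0 then Oct.unit k else 0)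
      (if s = 1 then Oct.unit k else 0) (if s = 2 then Oct.unit k else 0)) := by
    rw [Lm, jvec_off]
  fin_cases i <;> simp [frameF4, innerDer, fD, h, mulMat_herm_diag, dlt]

theorem frameSO9_eq (k : Fin 8) : frameSO9 k = psi (toC (fD 2 k)) := by
  have h (s : Fin 3) : Lm (off s k) = mulMat (herm 0 0 0 (if s = 0 then Oct.unit k else 0)
      (if s = 1 then Oct.unit k else 0) (if s = 2 then Oct.unit k else 0)) := by
    rw [Lm, jvec_off]
  simp [frameSO9, innerDer, fD, h, mulMat_herm_diag, dlt]

/-- The component of a derivation along a frame element is read off from its values on diagonal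
elements, so orthogonality to the frames becomes a statement about idempotents. -/
theorem ip_psi_fD {D : Matrix I27 I27 ℝ} (hD : IsDerivation D) (s : Fin 3) (k : Fin 8) :
    ip (psi (toC (fD s k))) (psi (toC D)) = -((D *ᵥ dg (dlt s)) (iOff s k)) := by
  rw [fD, ip_commutator (tr_dg_dlt s) hD, ← dot_off (D *ᵥ _), hD.dot_mulVec, neg_neg]

theorem ip_psi_fD_fD (s s' : Fin 3) (k k' : Fin 8) :
    ip (psi (toC (fD s k))) (psi (toC (fD s' k'))) = if (s, k) = (s', k') then 1 else 0 := by
  rw [fD, ip_commutator (tr_dg_dlt s) (isDerivation_fD s' k'), fD_apply_dot]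

/-- The idempotents `e_i` on the diagonal. -/
abbrev eD (i : Fin 3) : I27 → ℝ := dg (Pi.single i 1)

theorem dg_eq_sum (d : Fin 3 → ℝ) : dg d = ∑ i, d i • eD i := by
  simp only [eD, Fin.sum_univ_three, ← dg_smul, ← dg_add]
  congr 1
  funext i
  fin_cases i <;> simp

theorem lieSO9_idempotent : jcoord (herm 1 0 0 0 0 0) = eD 0 := by
  rw [eD, dg]; simp

namespace IsDerivation

variable {D : Matrix I27 I27 ℝ}

/-- Differentiating `e ∘ e = e` puts `De` in the Peirce space of eigenvalue one half. -/
theorem jmul_eD_mulVec (hD : IsDerivation D) (i : Fin 3) :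
    (2 : ℝ) • jmul (eD i) (D *ᵥ eD i) = D *ᵥ eD i := by
  have h := hD (eD i) (eD i)
  rw [jmul_dg_dg, show (Pi.single i 1 * Pi.single i 1 : Fin 3 → ℝ) = Pi.single i 1 by
    rw [← Pi.single_mul, one_mul], jmul_comm (D *ᵥ _)] at h
  rw [two_smul]; exact h.symm

theorem mulVec_eD_dot_dg (hD : IsDerivation D) (i : Fin 3) (d : Fin 3 → ℝ) :
    (D *ᵥ eD i) ⬝ᵥ dg d = 0 := by
  rw [hD.dot_mulVec, dotProduct_comm, ← neg_eq_zero, neg_neg]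
  have hsq (d : Fin 3 → ℝ) (j : Fin 3) : (D *ᵥ eD j) ⬝ᵥ eD j = 0 := by
    have h := hD.dot_mulVec (eD j) (eD j)
    rw [dotProduct_comm] at h
    rw [dotProduct_comm]; linarith
  have hj (j : Fin 3) : (D *ᵥ eD j) ⬝ᵥ eD i = 0 := by
    by_cases hij : j = i
    · rw [hij]; exact hsq d i
    · have h := congrArg (fun v => v ⬝ᵥ eD i) (hD.jmul_eD_mulVec j)
      simp only [smul_dotProduct] at h
      rw [jmul_comm, jmul_dot, jmul_dg_dg, show (Pi.single j 1 * Pi.single i 1 : Fin 3 → ℝ) = 0 by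
        funext l; by_cases hl : l = j
        · subst hl; simp [hij]
        · simp [hl], show dg 0 = 0 by simpa using dg_smul 0 0] at h
      simpa using h.symm
  rw [dg_eq_sum, ← mulVecLin_apply, map_sum, sum_dotProduct]
  refine Finset.sum_eq_zero fun j _ => ?_
  rw [map_smul, mulVecLin_apply, smul_dotProduct, hj, smul_zero]

theorem mulVec_eD_off (hD : IsDerivation D) {i : Fin 3} {s : Fin 3} (h1 : fstIdx s ≠ i)
    (h2 : sndIdx s ≠ i) (k : Fin 8) : (D *ᵥ eD i) (iOff s k) = 0 := by
  rw [← dot_off (D *ᵥ _), ← hD.jmul_eD_mulVec i, smul_dotProduct, jmul_comm, jmul_dot, jmul_dg_off]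
  simp [h1, h2]

/-- Differentiating `e_i ∘ e_j = 0` with `D e_i = 0` gives `e_i ∘ D e_j = 0`, whereas `e_i`
multiplies the entries in a position that meets row `i` once by one half. -/
theorem mulVec_eD_off_of_annihilates (hD : IsDerivation D) {i j : Fin 3} (hij : i ≠ j)
    (hi : D *ᵥ eD i = 0) {s : Fin 3} (hs : fstIdx s = i) (hs' : sndIdx s ≠ i) (k : Fin 8) :
    (D *ᵥ eD j) (iOff s k) = 0 := by
  have h := hD (eD i) (eD j)
  rw [hi, zero_jmul, zero_add, jmul_dg_dg, show (Pi.single i 1 * Pi.single j 1 : Fin 3 → ℝ) = 0 by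
        funext l; by_cases hl : l = i
        · subst hl; simp [hij]
        · simp [hl], show dg 0 = 0 by simpa using dg_smul 0 0, mulVec_zero] at h
  have h2 := congrArg (fun v => v ⬝ᵥ off s k) h
  simp only [zero_dotProduct] at h2
  rw [jmul_comm, jmul_dot, jmul_dg_off, dotProduct_smul, dot_off, hs] at h2
  simpa [hs'] using h2.symm

end IsDerivation

theorem dlt_eq (s : Fin 3) : dlt s = Pi.single (fstIdx s) 1 - Pi.single (sndIdx s) 1 := by
  funext i; fin_cases s <;> fin_cases i <;> simp [dlt, fstIdx, sndIdx]

theorem dg_sub (d d' : Fin 3 → ℝ) : dg (d - d') = dg d - dg d' := by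
  rw [sub_eq_add_neg, ← neg_one_smul ℝ d', dg_add, dg_smul, neg_one_smul, sub_eq_add_neg]

theorem psiC_apply (M : Matrix I27 I27 ℝ) : psiC M = psi (toC M) := rfl

theorem fD_mulVec_eD_fst (s : Fin 3) (k : Fin 8) :
    fD s k *ᵥ eD (fstIdx s) = (-1 / 2 : ℝ) • off s k := by
  rw [fD_mulVec_dg]
  congr 1
  fin_cases s <;> simp [fstIdx, sndIdx] <;> norm_num

theorem isDerivation_sum {ι : Type*} (s : Finset ι) (f : ι → Matrix I27 I27 ℝ)
    (hf : ∀ i, IsDerivation (f i)) : IsDerivation (∑ i ∈ s, f i) := by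
  classical
  induction s using Finset.induction with
  | empty => exact isDerivation_zero
  | insert a s ha ih => rw [Finset.sum_insert ha]; exact (hf a).add ih

/-- For a derivation `D`, the vector `D e_0` lies in the positions `(12)` and `(13)`. The frame
elements produce all such vectors from `e_0`, so subtracting a combination of them leaves a
derivation that annihilates `e_0`. -/
theorem isOrthoFrame_frameF4 : IsOrthoFrame (psi '' lieF4) (psi '' lieSO9) frameF4 := by
  refine isOrthoFrame_of_decomposition ?_ ?_ ?_ ?_ ?_
  · rintro ⟨i, k⟩ ⟨j, l⟩
    rw [frameF4_eq, frameF4_eq, ip_psi_fD_fD]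
    simp [Prod.ext_iff]
  · intro W hW
    obtain ⟨y, rfl⟩ := (Submodule.mem_span_range_iff_exists_fun ℝ).mp hW
    have h : ∑ q, y q • frameF4 q = psi (toC (∑ q : Fin 2 × Fin 8, y q • fD q.1.castSucc q.2)) := by
      rw [← psiC_apply, map_sum]
      exact Finset.sum_congr rfl fun q _ => by rw [map_smul, psiC_apply, ← frameF4_eq]
    rw [h]
    exact mem_psi_image_lieF4 (isDerivation_sum _ _ fun q => (isDerivation_fD _ _).smul _)
  · rintro ⟨i, k⟩ _ ⟨_, ⟨D, hD, h1, rfl⟩, rfl⟩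
    rw [lieSO9_idempotent] at h1
    rw [frameF4_eq, ip_psi_fD hD, dlt_eq, dg_sub, mulVec_sub, Pi.sub_apply]
    have hf : fstIdx i.castSucc = 0 := by fin_cases i <;> rfl
    have hs : sndIdx i.castSucc ≠ 0 := by fin_cases i <;> simp [sndIdx]
    rw [hf, h1, hD.mulVec_eD_off_of_annihilates hs.symm h1 hf hs]
    simp
  · rintro _ ⟨_, ⟨D, hD, rfl⟩, rfl⟩
    let w := D *ᵥ eD 0
    -- The factor `-2` inverts the `-1/2` by which a frame element sends `e_0` to its basis vector.
    let D' := ∑ q : Fin 2 × Fin 8, (-2 * w (iOff q.1.castSucc q.2)) • fD q.1.castSucc q.2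
    have hD' : IsDerivation D' := isDerivation_sum _ _ fun q => (isDerivation_fD _ _).smul _
    have hw : D' *ᵥ eD 0 = w := by
      have hsum : w = ∑ q : Fin 2 × Fin 8, w (iOff q.1.castSucc q.2) • off q.1.castSucc q.2 := by
        have h2 (k : Fin 8) : w (iOff 2 k) = 0 :=
          hD.mulVec_eD_off (by simp [fstIdx]) (by simp [sndIdx]) k
        conv_lhs => rw [eq_sum_off (w := w) (hD.mulVec_eD_dot_dg 0)]
        rw [Fin.sum_univ_castSucc, Fintype.sum_prod_type]
        simp [h2]
      conv_rhs => rw [hsum]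
      rw [sum_mulVec]
      refine Finset.sum_congr rfl fun q _ => ?_
      have hf : fstIdx q.1.castSucc = 0 := by
        obtain ⟨i, k⟩ := q
        fin_cases i <;> rfl
      have := fD_mulVec_eD_fst q.1.castSucc q.2
      rw [hf] at this
      rw [smul_mulVec, this, smul_smul]
      congr 1; ring
    refine ⟨psi (toC (D + (-1 : ℝ) • D')), ⟨_, ⟨_, hD.add (hD'.smul _), ?_, rfl⟩, rfl⟩,
      psi (toC D'), ?_, ?_⟩
    · rw [lieSO9_idempotent, add_mulVec, smul_mulVec, hw]
      change w + _ = 0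
      rw [neg_one_smul, add_neg_cancel]
    · rw [← psiC_apply, map_sum]
      refine Submodule.sum_mem _ fun q _ => ?_
      rw [map_smul, psiC_apply, ← frameF4_eq]
      exact Submodule.smul_mem _ _ (Submodule.subset_span ⟨_, rfl⟩)
    · simp only [← psiC_apply, ← map_add]
      congr 1
      module
  · rintro _ ⟨_, ⟨D, hD, -, rfl⟩, rfl⟩
    exact psi_image_lieF4_eq_zero_of_ip_self (mem_psi_image_lieF4 hD)

theorem toC_injective : Function.Injective toC := fun M N h => by
  ext i j
  exact Complex.ofReal_injective (congrFun (congrFun h i) j)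

theorem toC_mul (M N : Matrix I27 I27 ℝ) : toC (M * N) = toC M * toC N := map_mul cM M N

theorem cTilde_eq (a : I26) : cTilde a = (-Complex.I) • toC (Lm (Pi.single (Sum.inl a) 1)) := by
  rw [cTilde, Lm, jvec_single]

/-- `[D, L_d] = L_{Dd}` vanishes exactly when `Dd` does, and every derivation kills the identity; so
commuting with the two diagonal generators means annihilating the whole diagonal. -/
theorem mem_lieSO8_iff {X : Matrix I27 I27 ℂ} :
    X ∈ lieSO8 ↔ ∃ D, IsDerivation D ∧ (∀ d, D *ᵥ dg d = 0) ∧ X = toC D := by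
  have key (D : Matrix I27 I27 ℝ) (hD : IsDerivation D) (s : Fin 2) :
      toC D * cTilde (Sum.inl s) = cTilde (Sum.inl s) * toC D ↔
        D *ᵥ dg (dgRow (Sum.inl s)) = 0 := by
    rw [cTilde_eq, single_iDiag, Matrix.mul_smul, Matrix.smul_mul,
      (smul_right_injective _ (neg_ne_zero.mpr Complex.I_ne_zero)).eq_iff, ← toC_mul, ← toC_mul,
      toC_injective.eq_iff, ← sub_eq_zero, hD.commutator_Lm]
    constructor
    · intro h
      rw [← jmul_jone (D *ᵥ _), ← Lm_mulVec, h, zero_mulVec]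
    · intro h
      rw [h]; simpa using Lm_smul 0 0
  constructor
  · rintro ⟨⟨D, hD, rfl⟩, h⟩
    refine ⟨D, hD, fun d => ?_, rfl⟩
    have h0 := (key D hD 0).mp (h 0)
    have h1 := (key D hD 1).mp (h 1)
    have h2 := hD.mulVec_jone
    rw [← dg_one] at h2
    -- The two traceless diagonal directions and the identity are an orthogonal basis of the
    -- diagonal; these are the coefficients of the projections.
    have e : d = ((d 0 - d 1) / 2) • dgRow (Sum.inl 0)
        + ((d 0 + d 1 - 2 * d 2) * √3 / 6) • dgRow (Sum.inl 1) + ((d 0 + d 1 + d 2) / 3) • 1 := by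
      funext i
      fin_cases i <;> simp [dgRow] <;> field_simp <;> ring
    rw [e, dg_add, dg_add, dg_smul, dg_smul, dg_smul, mulVec_add, mulVec_add, mulVec_smul,
      mulVec_smul, mulVec_smul, h0, h1, h2]
    simp
  · rintro ⟨D, hD, h, rfl⟩
    exact ⟨⟨D, hD, rfl⟩, fun s => (key D hD s).mpr (h _)⟩

/-- With `e_0` annihilated, `D e_1` is confined to the position `(23)`. Removing it with the frame
leaves a derivation that kills `e_0` and `e_1`, and then also `e_2`, because it kills the identity.
-/
theorem isOrthoFrame_frameSO9 : IsOrthoFrame (psi '' lieSO9) (psi '' lieSO8) frameSO9 := by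
  refine isOrthoFrame_of_decomposition ?_ ?_ ?_ ?_ ?_
  · intro k l
    rw [frameSO9_eq, frameSO9_eq, ip_psi_fD_fD]
    simp
  · intro W hW
    obtain ⟨y, rfl⟩ := (Submodule.mem_span_range_iff_exists_fun ℝ).mp hW
    have h : ∑ q, y q • frameSO9 q = psi (toC (∑ k, y k • fD 2 k)) := by
      rw [← psiC_apply, map_sum]
      exact Finset.sum_congr rfl fun q _ => by rw [map_smul, psiC_apply, ← frameSO9_eq]
    rw [h]
    refine ⟨_, ⟨_, isDerivation_sum _ _ fun q => (isDerivation_fD _ _).smul _, ?_, rfl⟩, rfl⟩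
    rw [lieSO9_idempotent, sum_mulVec]
    refine Finset.sum_eq_zero fun k _ => ?_
    rw [smul_mulVec, fD_mulVec_dg]
    simp [fstIdx, sndIdx]
  · rintro k _ ⟨X, hX, rfl⟩
    obtain ⟨D, hD, h, rfl⟩ := mem_lieSO8_iff.mp hX
    rw [frameSO9_eq, ip_psi_fD hD, h]
    simp
  · rintro _ ⟨_, ⟨D, hD, h0, rfl⟩, rfl⟩
    rw [lieSO9_idempotent] at h0
    let w := D *ᵥ eD 1
    let D' := ∑ k, (-2 * w (iOff 2 k)) • fD 2 k
    have hD' : IsDerivation D' := isDerivation_sum _ _ fun q => (isDerivation_fD _ _).smul _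
    have hw : D' *ᵥ eD 1 = w := by
      have hsum : w = ∑ k, w (iOff 2 k) • off 2 k := by
        have h1 (k : Fin 8) : w (iOff 1 k) = 0 :=
          hD.mulVec_eD_off (by simp [fstIdx]) (by simp [sndIdx]) k
        have h2 (k : Fin 8) : w (iOff 0 k) = 0 :=
          hD.mulVec_eD_off_of_annihilates (by simp) h0 (by simp [fstIdx]) (by simp [sndIdx]) k
        conv_lhs => rw [eq_sum_off (w := w) (hD.mulVec_eD_dot_dg 1)]
        rw [Fin.sum_univ_three]
        simp [h1, h2]
      conv_rhs => rw [hsum]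
      rw [sum_mulVec]
      refine Finset.sum_congr rfl fun k _ => ?_
      have := fD_mulVec_eD_fst 2 k
      rw [show fstIdx 2 = 1 from rfl] at this
      rw [smul_mulVec, this, smul_smul]
      congr 1; ring
    have hw0 : D' *ᵥ eD 0 = 0 := by
      rw [sum_mulVec]
      refine Finset.sum_eq_zero fun k _ => ?_
      rw [smul_mulVec, fD_mulVec_dg]
      simp [fstIdx, sndIdx]
    have hE := hD.add (hD'.smul (-1))
    refine ⟨psi (toC (D + (-1 : ℝ) • D')), ⟨_, mem_lieSO8_iff.mpr ⟨_, hE, ?_, rfl⟩, rfl⟩,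
      psi (toC D'), ?_, ?_⟩
    · have e0 : (D + (-1 : ℝ) • D') *ᵥ eD 0 = 0 := by
        rw [add_mulVec, smul_mulVec, hw0, h0]; simp
      have e1 : (D + (-1 : ℝ) • D') *ᵥ eD 1 = 0 := by
        rw [add_mulVec, smul_mulVec, hw]
        change w + _ = 0
        rw [neg_one_smul, add_neg_cancel]
      have e2 : (D + (-1 : ℝ) • D') *ᵥ eD 2 = 0 := by
        have h := hE.mulVec_jone
        rw [← dg_one, dg_eq_sum, Fin.sum_univ_three] at h
        simpa only [Pi.one_apply, one_smul, mulVec_add, e0, e1, zero_add] using h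
      intro d
      rw [dg_eq_sum, Fin.sum_univ_three, mulVec_add, mulVec_add, mulVec_smul, mulVec_smul,
        mulVec_smul, e0, e1, e2]
      simp
    · rw [← psiC_apply, map_sum]
      refine Submodule.sum_mem _ fun q _ => ?_
      rw [map_smul, psiC_apply, ← frameSO9_eq]
      exact Submodule.smul_mem _ _ (Submodule.subset_span ⟨_, rfl⟩)
    · simp only [← psiC_apply, ← map_add]
      congr 1
      module
  · rintro _ ⟨_, ⟨⟨D, hD, rfl⟩, -⟩, rfl⟩
    exact psi_image_lieF4_eq_zero_of_ip_self (mem_psi_image_lieF4 hD)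

/-! ### Derivatives of matrix-valued maps -/

section MatrixDerivative

variable {E : Type} [NormedAddCommGroup E] [NormedSpace ℝ E] {n : Type}

/-- Entrywise differentiability. -/
def MDiff (σ : E → Matrix n n ℂ) (p : E) : Prop :=
  ∀ i j, DifferentiableAt ℝ (fun q => σ q i j) p

/-- Entrywise directional derivative. -/
def mfderiv' (σ : E → Matrix n n ℂ) (p v : E) : Matrix n n ℂ :=
  of fun i j => fderiv ℝ (fun q => σ q i j) p v

theorem MDiff.mul [Fintype n] {σ τ : E → Matrix n n ℂ} {p : E} (hσ : MDiff σ p) (hτ : MDiff τ p) :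
    MDiff (fun q => σ q * τ q) p := fun i j => by
  simp only [mul_apply]
  exact DifferentiableAt.fun_sum fun k _ => (hσ i k).mul (hτ k j)

theorem mfderiv'_mul [Fintype n] {σ τ : E → Matrix n n ℂ} {p : E} (hσ : MDiff σ p) (hτ : MDiff τ p) (v : E) :
    mfderiv' (fun q => σ q * τ q) p v = mfderiv' σ p v * τ p + σ p * mfderiv' τ p v := by
  ext i j
  simp only [mfderiv', of_apply, mul_apply, Matrix.add_apply]
  rw [fderiv_fun_sum fun k _ => (hσ i k).fun_mul (hτ k j), _root_.sum_apply,
    ← Finset.sum_add_distrib]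
  refine Finset.sum_congr rfl fun k _ => ?_
  rw [fderiv_fun_mul (hσ i k) (hτ k j)]
  simp only [_root_.add_apply, _root_.smul_apply, smul_eq_mul]
  ring

theorem MDiff.det [Fintype n] [DecidableEq n] {σ : E → Matrix n n ℂ} {p : E} (hσ : MDiff σ p) :
    DifferentiableAt ℝ (fun q => (σ q).det) p := by
  simp only [det_apply]
  refine DifferentiableAt.fun_sum fun π _ => DifferentiableAt.fun_const_smul ?_ _
  have h := HasFDerivAt.finsetProd (u := Finset.univ) (g := fun i q => σ q (π i) i)
    fun i _ => (hσ (π i) i).hasFDerivAt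
  exact h.differentiableAt

/-- Cramer's rule: the entries are cofactors, polynomial in the entries of `σ`, over a determinant
that never vanishes. -/
theorem MatDiffAt.inv [Fintype n] [DecidableEq n] {σ : E → GL n ℂ} {p : E} (hσ : MatDiffAt σ p) :
    MatDiffAt (fun q => (σ q)⁻¹) p := fun i j => by
  have hd (q : E) : (σ q).val.det ≠ 0 := (isUnits_det_units (σ q)).ne_zero
  simp only [Matrix.coe_units_inv, inv_def, Matrix.smul_apply, Ring.inverse_eq_inv', adjugate_apply,
    smul_eq_mul]
  refine ((MDiff.det hσ).inv (hd p)).mul (MDiff.det fun k l => ?_)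
  by_cases hk : k = j
  · subst hk; simp only [updateRow_self]; exact differentiableAt_const _
  · simp only [updateRow_ne hk]; exact hσ k l

theorem MatDiffAt.mul [Fintype n] [DecidableEq n] {σ τ : E → GL n ℂ} {p : E} (hσ : MatDiffAt σ p) (hτ : MatDiffAt τ p) :
    MatDiffAt (fun q => σ q * τ q) p := MDiff.mul hσ hτ

theorem MatDiffAt.comp [Fintype n] [DecidableEq n] {F : Type} [NormedAddCommGroup F] [NormedSpace ℝ F] {σ : F → GL n ℂ}
    {f : E → F} {p : E} (hσ : MatDiffAt σ (f p)) (hf : DifferentiableAt ℝ f p) :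
    MatDiffAt (fun q => σ (f q)) p := fun i j => (hσ i j).comp p hf

theorem matDiffAt_const [Fintype n] [DecidableEq n] (g : GL n ℂ) (p : E) : MatDiffAt (fun _ : E => g) p := fun _ _ =>
  differentiableAt_const _

theorem mfderiv'_const (A : Matrix n n ℂ) (p v : E) : mfderiv' (fun _ : E => A) p v = 0 := by
  ext; simp [mfderiv']

theorem mfderiv'_comp {F : Type} [NormedAddCommGroup F] [NormedSpace ℝ F] {σ : F → Matrix n n ℂ}
    {f : E → F} {p : E} (hσ : MDiff σ (f p)) (hf : DifferentiableAt ℝ f p) (v : E) :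
    mfderiv' (fun q => σ (f q)) p v = mfderiv' σ (f p) (fderiv ℝ f p v) := by
  ext i j
  simp only [mfderiv', of_apply]
  have := fderiv_comp p (hσ i j) hf
  rw [Function.comp_def] at this
  rw [this]; rfl

/-- The map `v ↦ dσ(v)` is linear. -/
def mfderivₗ (σ : E → Matrix n n ℂ) (p : E) : E →ₗ[ℝ] Matrix n n ℂ where
  toFun := mfderiv' σ p
  map_add' v w := by ext; simp [mfderiv']
  map_smul' r v := by ext; simp [mfderiv']

end MatrixDerivative

section Current

variable {E : Type} [NormedAddCommGroup E] [NormedSpace ℝ E]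

theorem current_eq (σ : E → GL I56 ℂ) (p v : E) :
    current σ p v = (σ p)⁻¹.val * mfderiv' (fun q => (σ q).val) p v := rfl

/-- The cocycle rule for the left current; it is the source of every conjugation in the computation
of the determinant. -/
theorem current_mul {σ τ : E → GL I56 ℂ} {p : E} (hσ : MatDiffAt σ p) (hτ : MatDiffAt τ p) (v : E) :
    current (fun q => σ q * τ q) p v =
      (τ p)⁻¹.val * current σ p v * (τ p).val + current τ p v := by
  have h : mfderiv' (fun q => (σ q * τ q).val) p v = _ := mfderiv'_mul hσ hτ v
  rw [current_eq, h, current_eq, current_eq, _root_.mul_inv_rev, Units.val_mul, Matrix.mul_add]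
  simp only [Matrix.mul_assoc]
  rw [← Matrix.mul_assoc (σ p)⁻¹.val (σ p).val, ← Units.val_mul, inv_mul_cancel, Units.val_one,
    Matrix.one_mul]

theorem current_const (g : GL I56 ℂ) (p v : E) : current (fun _ : E => g) p v = 0 := by
  rw [current_eq, mfderiv'_const, Matrix.mul_zero]

theorem current_comp {F : Type} [NormedAddCommGroup F] [NormedSpace ℝ F] {σ : F → GL I56 ℂ}
    {f : E → F} {p : E} (hσ : MatDiffAt σ (f p)) (hf : DifferentiableAt ℝ f p) (v : E) :
    current (fun q => σ (f q)) p v = current σ (f p) (fderiv ℝ f p v) := by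
  have h : mfderiv' (fun q => (σ (f q)).val) p v = _ := mfderiv'_comp hσ hf v
  rw [current_eq, current_eq, h]

/-- The current as a linear map. -/
def currentₗ (σ : E → GL I56 ℂ) (p : E) : E →ₗ[ℝ] Matrix I56 I56 ℂ :=
  (LinearMap.mulLeft ℝ (σ p)⁻¹.val) ∘ₗ mfderivₗ (fun q => (σ q).val) p

theorem currentₗ_apply (σ : E → GL I56 ℂ) (p v : E) : currentₗ σ p v = current σ p v := rfl

end Current

/-! ### The adjoint action of exponentials -/

section Exp

theorem exists_linear_flow {F : Type*} [NormedAddCommGroup F] [NormedSpace ℝ F] [CompleteSpace F]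
    (T : F →L[ℝ] F) (x : F) : ∃ c : ℝ → F, c 0 = x ∧ ∀ t, HasDerivAt c (T (c t)) t := by
  refine ⟨fun t => NormedSpace.exp (t • T) x, by simp, fun t => ?_⟩
  have h1 := hasDerivAt_exp_smul_const' (𝕂 := ℝ) T t
  have h2 := h1.clm_apply (hasDerivAt_const t x)
  exact h2.congr_deriv (by simp)

section NormedRing

variable {A : Type*} [NormedRing A] [NormedAlgebra ℝ A] [CompleteSpace A]

/-- If `c' = [S, c]`, then `e^{-tS} c e^{tS}` has zero derivative. Any explicit solution of this
equation thus computes the adjoint action. -/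
theorem exp_conj_of_hasDerivAt {S : A} (hS : NormedSpace.exp S * NormedSpace.exp (-S) = 1)
    {c : ℝ → A} (hc : ∀ t, HasDerivAt c (S * c t - c t * S) t) :
    NormedSpace.exp S * c 0 * NormedSpace.exp (-S) = c 1 := by
  have h (t : ℝ) :
      HasDerivAt (fun t : ℝ => NormedSpace.exp (t • (-S)) * c t * NormedSpace.exp (t • S)) 0 t := by
    have h1 := hasDerivAt_exp_smul_const (𝕂 := ℝ) (-S) t
    have h2 := hasDerivAt_exp_smul_const' (𝕂 := ℝ) S t
    refine ((h1.mul (hc t)).mul h2).congr_deriv ?_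
    simp only [Pi.mul_apply]
    noncomm_ring
  have h01 := is_const_of_deriv_eq_zero (fun t => (h t).differentiableAt) (fun t => (h t).deriv) 0 1
  simp only [zero_smul, NormedSpace.exp_zero, one_mul, mul_one, one_smul] at h01
  rw [h01]
  simp only [← mul_assoc]
  rw [hS, one_mul, mul_assoc, hS, mul_one]

/-- The linear equation `c' = [S, c]` is solved inside the invariant subspace, so its solution never
leaves it. -/
theorem exp_conj_mem_of_lie_mem [FiniteDimensional ℝ A] (p : Submodule ℝ A) {S : A}
    (hS : NormedSpace.exp S * NormedSpace.exp (-S) = 1)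
    (hp : ∀ x ∈ p, S * x - x * S ∈ p) {x : A} (hx : x ∈ p) :
    NormedSpace.exp S * x * NormedSpace.exp (-S) ∈ p := by
  let B : A →ₗ[ℝ] A := LinearMap.mulLeft ℝ S - LinearMap.mulRight ℝ S
  let T : p →L[ℝ] p := LinearMap.toContinuousLinearMap (B.restrict (p := p) (q := p) hp)
  have hT (y : p) : (T y : A) = S * y - y * S := rfl
  obtain ⟨c, h0, hc⟩ := exists_linear_flow T ⟨x, hx⟩
  have hc' (t : ℝ) : HasDerivAt (fun t => (c t : A)) (S * c t - c t * S) t :=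
    (p.subtypeL.hasFDerivAt).comp_hasDerivAt t (hc t)
  have h := exp_conj_of_hasDerivAt hS hc'
  rw [h0] at h
  rw [h]
  exact (c 1).2

theorem exp_conj_eq_of_rotation {V Y Z : A} (hV : NormedSpace.exp V * NormedSpace.exp (-V) = 1)
    {r : ℝ} (hY : V * Y - Y * V = r • Z) (hZ : V * Z - Z * V = -r • Y) :
    NormedSpace.exp V * Y * NormedSpace.exp (-V) = Real.cos r • Y + Real.sin r • Z := by
  let c : ℝ → A := fun t => Real.cos (t * r) • Y + Real.sin (t * r) • Z
  have hc (t : ℝ) : HasDerivAt c (V * c t - c t * V) t := by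
    have h0 : HasDerivAt (fun t : ℝ => t * r) r t := by simpa using (hasDerivAt_id t).mul_const r
    refine ((h0.cos.smul_const Y).add (h0.sin.smul_const Z)).congr_deriv ?_
    simp only [c, mul_add, add_mul, mul_smul_comm, smul_mul_assoc]
    linear_combination (norm := module) -Real.cos (t * r) • hY - Real.sin (t * r) • hZ
  have h := exp_conj_of_hasDerivAt hV hc
  simpa [c] using h

end NormedRing

variable {n : Type} [Fintype n] [DecidableEq n]

theorem exp_mul_exp_neg (S : Matrix n n ℂ) : NormedSpace.exp S * NormedSpace.exp (-S) = 1 :=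
  (expGL S).mul_inv

theorem matrix_exp_conj_mem (p : Submodule ℝ (Matrix n n ℂ)) {S : Matrix n n ℂ}
    (hp : ∀ x ∈ p, ⁅S, x⁆ ∈ p) {x : Matrix n n ℂ} (hx : x ∈ p) :
    NormedSpace.exp S * x * NormedSpace.exp (-S) ∈ p := by
  let _ : NormedRing (Matrix n n ℂ) := Matrix.linftyOpNormedRing
  let _ : NormedAlgebra ℝ (Matrix n n ℂ) := Matrix.linftyOpNormedAlgebra
  exact exp_conj_mem_of_lie_mem p (exp_mul_exp_neg S) hp hx

theorem matrix_exp_conj_rotation {V Y Z : Matrix n n ℂ} {r : ℝ} (hY : ⁅V, Y⁆ = r • Z)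
    (hZ : ⁅V, Z⁆ = -r • Y) :
    NormedSpace.exp V * Y * NormedSpace.exp (-V) = Real.cos r • Y + Real.sin r • Z := by
  let _ : NormedRing (Matrix n n ℂ) := Matrix.linftyOpNormedRing
  let _ : NormedAlgebra ℝ (Matrix n n ℂ) := Matrix.linftyOpNormedAlgebra
  exact exp_conj_eq_of_rotation (exp_mul_exp_neg V) hY hZ

theorem expGroup_conj_mem {𝔥 : Set (Matrix n n ℂ)} {p : Submodule ℝ (Matrix n n ℂ)}
    (h : ∀ S ∈ 𝔥, ∀ x ∈ p, ⁅S, x⁆ ∈ p) {g : GL n ℂ} (hg : g ∈ expGroup 𝔥)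
    {x : Matrix n n ℂ} (hx : x ∈ p) : g.val * x * g⁻¹.val ∈ p := by
  -- Both conjugations are carried through the induction, because a generated subgroup is also
  -- closed under inverses.
  suffices ∀ x ∈ p, g.val * x * g⁻¹.val ∈ p ∧ g⁻¹.val * x * g.val ∈ p from (this x hx).1
  clear hx x
  induction hg using Subgroup.closure_induction with
  | mem g hg =>
    obtain ⟨S, hS, rfl⟩ := hg
    refine fun x hx => ⟨matrix_exp_conj_mem p (h S hS) hx, ?_⟩
    have := matrix_exp_conj_mem p (S := -S) (fun x hx => by
      have e : ⁅-S, x⁆ = -⁅S, x⁆ := by rw [Ring.lie_def, Ring.lie_def]; noncomm_ring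
      rw [e]; exact p.neg_mem (h S hS x hx)) hx
    rwa [neg_neg] at this
  | one => intro x hx; simpa using hx
  | mul a b _ _ ha hb =>
    refine fun x hx => ⟨?_, ?_⟩
    · have := (ha _ (hb x hx).1).1
      simpa only [_root_.mul_inv_rev, Units.val_mul, Matrix.mul_assoc] using this
    · have := (hb _ (ha x hx).2).2
      simpa only [_root_.mul_inv_rev, Units.val_mul, Matrix.mul_assoc] using this
  | inv a _ ha => exact fun x hx => ⟨by rw [inv_inv]; exact (ha x hx).2, by rw [inv_inv]; exact (ha x hx).1⟩

theorem matDiffAt_expGL_smul (X : Matrix n n ℂ) (t : ℝ) : MatDiffAt (fun t : ℝ => expGL (t • X)) t :=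
  fun i j => by
    let _ : NormedRing (Matrix n n ℂ) := Matrix.linftyOpNormedRing
    let _ : NormedAlgebra ℝ (Matrix n n ℂ) := Matrix.linftyOpNormedAlgebra
    have h := hasDerivAt_exp_smul_const (𝕂 := ℝ) X t
    exact ((entryLinearMap ℝ ℂ i j).toContinuousLinearMap.hasFDerivAt.comp_hasDerivAt t
      h).differentiableAt

theorem mfderiv'_expGL_smul (X : Matrix n n ℂ) (t v : ℝ) :
    mfderiv' (fun t : ℝ => (expGL (t • X)).val) t v = v • (NormedSpace.exp (t • X) * X) := by
  let _ : NormedRing (Matrix n n ℂ) := Matrix.linftyOpNormedRing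
  let _ : NormedAlgebra ℝ (Matrix n n ℂ) := Matrix.linftyOpNormedAlgebra
  ext i j
  have h := hasDerivAt_exp_smul_const (𝕂 := ℝ) X t
  have h2 := ((entryLinearMap ℝ ℂ i j).toContinuousLinearMap.hasFDerivAt.comp_hasDerivAt t h)
  have h3 : fderiv ℝ (fun t : ℝ => (expGL (t • X)).val i j) t = _ := h2.hasFDerivAt.fderiv
  simp only [mfderiv', of_apply, h3]
  rfl

end Exp

theorem current_expGL_smul (X : Matrix I56 I56 ℂ) (t v : ℝ) :
    current (fun t : ℝ => expGL (t • X)) t v = v • X := by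
  rw [current_eq, mfderiv'_expGL_smul, Matrix.mul_smul, ← Matrix.mul_assoc]
  have : (expGL (t • X))⁻¹.val * NormedSpace.exp (t • X) = 1 := (expGL (t • X)).inv_mul
  rw [this, Matrix.one_mul]

/-! ### Absolute determinants and rotations of frames -/

theorem absDet_mul_right {κ ι : Type} [Fintype κ] [Fintype ι] [DecidableEq ι] (M : Matrix κ ι ℝ)
    (F : Matrix ι ι ℝ) : absDet (M * F) = |F.det| * absDet M := by
  rw [absDet, absDet, transpose_mul, Matrix.mul_assoc, ← Matrix.mul_assoc Mᵀ, det_mul, det_mul,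
    det_transpose, mul_comm (Mᵀ * M).det, ← mul_assoc, ← sq, Real.sqrt_mul (sq_nonneg _),
    Real.sqrt_sq_eq_abs]

theorem absDet_mul_left {κ ι : Type} [Fintype κ] [DecidableEq κ] [Fintype ι] [DecidableEq ι]
    {R : Matrix κ κ ℝ} (hR : Rᵀ * R = 1) (M : Matrix κ ι ℝ) : absDet (R * M) = absDet M := by
  rw [absDet, absDet, transpose_mul, Matrix.mul_assoc, ← Matrix.mul_assoc Rᵀ, hR, Matrix.one_mul]

theorem absDet_submatrix {κ κ' ι ι' : Type} [Fintype κ] [Fintype κ'] [Fintype ι] [DecidableEq ι]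
    [Fintype ι'] [DecidableEq ι'] (M : Matrix κ ι ℝ) (e : κ' ≃ κ) (e' : ι' ≃ ι) :
    absDet (M.submatrix e e') = absDet M := by
  have h : (M.submatrix e e')ᵀ * M.submatrix e e' = (Mᵀ * M).submatrix e' e' := by
    rw [transpose_submatrix, submatrix_mul_equiv]
  rw [absDet, h, det_submatrix_equiv_self, absDet]

theorem absDet_mul {κ μ ι : Type} [Fintype κ] [Fintype μ] [DecidableEq μ] [Fintype ι]
    [DecidableEq ι] (A : Matrix κ μ ℝ) (B : Matrix μ ι ℝ) (e : ι ≃ μ) :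
    absDet (A * B) = absDet A * absDet B := by
  have h : A * B = A.submatrix id e * B.submatrix e id := by
    rw [submatrix_mul_equiv, submatrix_id_id]
  rw [h, absDet_mul_right, absDet_eq B e, mul_comm]
  congr 1
  exact absDet_submatrix A (Equiv.refl κ) e

theorem absDet_fromBlocks_zero {κ₁ κ₂ ι₁ ι₂ : Type} [Fintype κ₁] [Fintype κ₂] [Fintype ι₁]
    [Fintype ι₂] [DecidableEq ι₁] [DecidableEq ι₂] (A : Matrix κ₁ ι₁ ℝ) (B : Matrix κ₁ ι₂ ℝ)
    (D : Matrix κ₂ ι₂ ℝ) (e₁ : ι₁ ≃ κ₁) (e₂ : ι₂ ≃ κ₂) :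
    absDet (fromBlocks A B 0 D) = absDet A * absDet D := by
  have h : (fromBlocks A B 0 D).submatrix (Equiv.sumCongr e₁ e₂) id =
      fromBlocks (A.submatrix e₁ id) (B.submatrix e₁ id) 0 (D.submatrix e₂ id) := by
    ext (i | i) (j | j) <;> rfl
  rw [absDet_eq _ (Equiv.sumCongr e₁ e₂), h, det_fromBlocks_zero₂₁, abs_mul, ← absDet_eq,
    ← absDet_eq]

theorem absDet_diagonal {ι : Type} [Fintype ι] [DecidableEq ι] (d : ι → ℝ) :
    absDet (diagonal d) = |∏ i, d i| := by
  rw [absDet_eq _ (Equiv.refl ι)]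
  simp

section Rotation

variable {κ : Type} [Fintype κ] [DecidableEq κ] {Y : κ → Matrix I56 I56 ℂ}

theorem eq_sum_ip_smul (hY : ∀ k l, ip (Y k) (Y l) = if k = l then 1 else 0)
    {X : Matrix I56 I56 ℂ} (hX : X ∈ Submodule.span ℝ (Set.range Y)) :
    X = ∑ l, ip X (Y l) • Y l := by
  obtain ⟨y, rfl⟩ := (Submodule.mem_span_range_iff_exists_fun ℝ).mp hX
  refine Finset.sum_congr rfl fun l _ => ?_
  congr 1
  simp [ip_sum_left, ip_smul_left, hY]

/-- A conjugation preserves `ip`; if it also preserves the span of an orthonormal frame, its matrix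
there is orthogonal and does not change `absDet`. -/
theorem exists_rotation (hY : ∀ k l, ip (Y k) (Y l) = if k = l then 1 else 0) {g : GL I56 ℂ}
    (hg : ∀ k, g.val * Y k * g⁻¹.val ∈ Submodule.span ℝ (Set.range Y)) :
    ∃ R : Matrix κ κ ℝ, Rᵀ * R = 1 ∧
      ∀ k J, ip (Y k) (g⁻¹.val * J * g.val) = ∑ l, R k l * ip (Y l) J := by
  let R : Matrix κ κ ℝ := of fun k l => ip (g.val * Y k * g⁻¹.val) (Y l)
  have hR (k : κ) : g.val * Y k * g⁻¹.val = ∑ l, R k l • Y l := eq_sum_ip_smul hY (hg k)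
  have key (k J) : ip (Y k) (g⁻¹.val * J * g.val) = ∑ l, R k l * ip (Y l) J := by
    rw [← ip_conj, hR]
    simp only [ip_sum_left, ip_smul_left]
  refine ⟨R, mul_eq_one_comm.mp ?_, key⟩
  ext k l
  rw [mul_apply, one_apply, ← hY k l]
  have h := key k (g.val * Y l * g⁻¹.val)
  have e : g⁻¹.val * (g.val * Y l * g⁻¹.val) * g.val = Y l := by
    have h1 : g⁻¹.val * g.val = 1 := g.inv_mul
    rw [← Matrix.mul_assoc, ← Matrix.mul_assoc, h1, Matrix.one_mul, Matrix.mul_assoc, h1,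
      Matrix.mul_one]
  rw [e] at h
  rw [h]
  refine Finset.sum_congr rfl fun m _ => ?_
  rw [transpose_apply, ip_comm]; rfl

end Rotation

/-! ### Invariance of the density -/

/-- The grading operator, which commutes with `Lie(U)` and anticommutes with its complement. -/
def Gr : Matrix I56 I56 ℂ := fromBlocks 1 0 0 (-1)

theorem Gr_mul_Gr : Gr * Gr = 1 := by
  simp [Gr, fromBlocks_multiply]

theorem offDiag_mul_Gr (z : I27 → ℂ) : offDiag z * Gr = -(Gr * offDiag z) := by
  rw [offDiag, Gr, fromBlocks_multiply, fromBlocks_multiply, fromBlocks_neg]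
  simp

/-- Inserting `Gr² = 1` in the trace and moving one factor around changes its sign, since `P(z)`
anticommutes with `Gr`. -/
theorem ip_offDiag_of_commute (z : I27 → ℂ) {X : Matrix I56 I56 ℂ} (hX : Commute Gr X) :
    ip (offDiag z) X = 0 := by
  have h : (offDiag z * X).trace = -(offDiag z * X).trace := by
    conv_lhs => rw [← Matrix.mul_one X, ← Gr_mul_Gr, ← Matrix.mul_assoc X, ← hX.eq,
      Matrix.mul_assoc Gr, ← Matrix.mul_assoc, offDiag_mul_Gr, Matrix.neg_mul, trace_neg,
      Matrix.mul_assoc, trace_mul_comm, Matrix.mul_assoc, Matrix.mul_assoc, Gr_mul_Gr,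
      Matrix.mul_one]
  have h0 : (offDiag z * X).trace = 0 := self_eq_neg.mp h
  rw [ip, h0]; simp

theorem commute_Gr_fromBlocks (A B : Matrix (I27 ⊕ Unit) (I27 ⊕ Unit) ℂ) :
    Commute Gr (fromBlocks A 0 0 B) := by
  rw [Commute, SemiconjBy, Gr, fromBlocks_multiply, fromBlocks_multiply]
  simp

theorem commute_Gr_lieU {S : Matrix I56 I56 ℂ} (hS : S ∈ lieU) : Commute Gr S := by
  obtain ⟨ν, X, -, rfl⟩ := hS
  rw [Y1_eq, psi, fromBlocks_smul, smul_zero, fromBlocks_add, add_zero]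
  exact commute_Gr_fromBlocks _ _

theorem commute_exp {n : Type} [Fintype n] [DecidableEq n] {A S : Matrix n n ℂ} (h : Commute A S) :
    Commute A (NormedSpace.exp S) := by
  let _ : NormedRing (Matrix n n ℂ) := Matrix.linftyOpNormedRing
  let _ : NormedAlgebra ℚ (Matrix n n ℂ) := Matrix.linftyOpNormedAlgebra
  exact h.exp_right

theorem commute_Gr_expGroup {u : GL I56 ℂ} (hu : u ∈ expGroup lieU) : Commute Gr u.val := by
  induction hu using Subgroup.closure_induction with
  | mem g hg => obtain ⟨S, hS, rfl⟩ := hg; exact commute_exp (commute_Gr_lieU hS)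
  | one => exact Commute.one_right _
  | mul a b _ _ ha hb => exact ha.mul_right hb
  | inv a _ ha => exact ha.units_inv_right

theorem lie_mem_span_frameE7 {S : Matrix I56 I56 ℂ} (hS : S ∈ lieU) {X : Matrix I56 I56 ℂ}
    (hX : X ∈ Submodule.span ℝ (Set.range frameE7)) :
    ⁅S, X⁆ ∈ Submodule.span ℝ (Set.range frameE7) := by
  obtain ⟨ν, D, y, hD, hy, rfl⟩ := mem_lieU hS
  obtain ⟨u, v, rfl⟩ := mem_span_frameE7.mp hX
  have hadd (A B C : Matrix I56 I56 ℂ) : ⁅A + B, C⁆ = ⁅A, C⁆ + ⁅B, C⁆ := by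
    simp only [Ring.lie_def]; noncomm_ring
  have hadd' (A B C : Matrix I56 I56 ℂ) : ⁅A, B + C⁆ = ⁅A, B⁆ + ⁅A, C⁆ := by
    simp only [Ring.lie_def]; noncomm_ring
  have hsmul (r : ℝ) (A B : Matrix I56 I56 ℂ) : ⁅r • A, B⁆ = r • ⁅A, B⁆ := by
    simp only [Ring.lie_def, Matrix.smul_mul, Matrix.mul_smul, smul_sub]
  simp only [hadd, hadd', hsmul, lie_Y1_pR, lie_Y1_pI, lie_psi_toC_pR hD, lie_psi_toC_pI hD,
    lie_psiL_pR hy, lie_psiL_pI hy]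
  have hR := pR_mem_span
  have hI := pI_mem_span
  exact Submodule.add_mem _
    (Submodule.add_mem _ (Submodule.smul_mem _ _ (Submodule.smul_mem _ _ (hI _)))
      (Submodule.smul_mem _ _ (Submodule.smul_mem _ _ (hR _))))
    (Submodule.add_mem _ (Submodule.add_mem _ (hR _) (hI _))
      (Submodule.add_mem _ (Submodule.neg_mem _ (hI _)) (hR _)))

/-- Obtained by differentiating `Gr u = u Gr`. This suffices for orthogonality to 𝔭, so it need not
be shown that the current of a map to `U` lies in `Lie(U)`. -/
theorem commute_Gr_current {E : Type} [NormedAddCommGroup E] [NormedSpace ℝ E] {u : E → GL I56 ℂ}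
    {p : E} (hu : MatDiffAt u p) (h : ∀ᶠ q in 𝓝 p, u q ∈ expGroup lieU) (v : E) :
    Commute Gr (current u p v) := by
  have hc : ∀ᶠ q in 𝓝 p, Gr * (u q).val = (u q).val * Gr :=
    h.mono fun q hq => commute_Gr_expGroup hq
  have hG : MDiff (fun _ : E => Gr) p := fun _ _ => differentiableAt_const _
  have h1 := mfderiv'_mul hG hu v
  have h2 := mfderiv'_mul hu hG v
  have h3 : mfderiv' (fun q => Gr * (u q).val) p v = mfderiv' (fun q => (u q).val * Gr) p v := by
    ext i j
    simp only [mfderiv', of_apply]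
    rw [Filter.EventuallyEq.fderiv_eq (hc.mono fun q hq => by rw [hq])]
  rw [h1, h2, mfderiv'_const, Matrix.zero_mul, Matrix.mul_zero, zero_add, add_zero] at h3
  rw [current_eq]
  exact (commute_Gr_expGroup h.self_of_nhds).units_inv_right.mul_right h3

/-- Write `σ' = g σ(f) u` with `u` in `U`. The constant `g` drops out of the current, conjugation by
`u` rotates the frame, the current of `u` is orthogonal to it, and the chain rule supplies the
Jacobian of `f`. -/
theorem density_invariant (g : GL I56 ℂ) (σ σ' : Coord → GL I56 ℂ) (f : Coord → Coord) (p : Coord)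
    (hσ : MatDiffAt σ (f p)) (hσ' : MatDiffAt σ' p) (hf : DifferentiableAt ℝ f p)
    (h : ∀ᶠ q in 𝓝 p, (g * σ (f q))⁻¹ * σ' q ∈ expGroup lieU) :
    density coordBasis frameE7 σ' p =
      |(fderiv ℝ f p).det| * density coordBasis frameE7 σ (f p) := by
  let τ : Coord → GL I56 ℂ := fun q => g * σ (f q)
  let u : Coord → GL I56 ℂ := fun q => (τ q)⁻¹ * σ' q
  have hτ : MatDiffAt τ p := (matDiffAt_const g p).mul (hσ.comp hf)
  have hu : MatDiffAt u p := hτ.inv.mul hσ'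
  have hup : u p ∈ expGroup lieU := h.self_of_nhds
  have hcur (v : Coord) : current σ' p v =
      (u p)⁻¹.val * current σ (f p) (fderiv ℝ f p v) * (u p).val + current u p v := by
    have e : σ' = fun q => τ q * u q := by funext q; simp [u]
    rw [e, current_mul hτ hu]
    congr 3
    rw [current_mul (matDiffAt_const g p) (hσ.comp hf), current_const, Matrix.mul_zero,
      Matrix.zero_mul, zero_add, current_comp hσ hf]
  obtain ⟨R, hR, hRk⟩ := exists_rotation (Y := frameE7) isOrthoFrame_frameE7.1 (g := u p)
    fun k => expGroup_conj_mem (fun S hS X hX => lie_mem_span_frameE7 hS hX) hup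
      (Submodule.subset_span ⟨k, rfl⟩)
  let F := LinearMap.toMatrix coordBasis coordBasis (fderiv ℝ f p : Coord →ₗ[ℝ] Coord)
  have hF (i) : fderiv ℝ f p (coordBasis i) = ∑ j, F j i • coordBasis j := by
    have := (coordBasis.sum_repr (fderiv ℝ f p (coordBasis i))).symm
    rw [this]
    refine Finset.sum_congr rfl fun j _ => ?_
    congr 1
    simp [F, LinearMap.toMatrix_apply]
  have hdet : F.det = (fderiv ℝ f p).det := LinearMap.det_toMatrix _ _
  have hM : (of fun k i => ip (frameE7 k) (current σ' p (coordBasis i))) =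
      R * ((of fun k i => ip (frameE7 k) (current σ (f p) (coordBasis i))) * F) := by
    ext k i
    rw [of_apply, hcur, ip_add_right, hRk,
      show ip (frameE7 k) (current u p (coordBasis i)) = 0 from
        ip_offDiag_of_commute _ (commute_Gr_current hu h _), add_zero, mul_apply]
    refine Finset.sum_congr rfl fun l _ => ?_
    rw [mul_apply, hF, ← currentₗ_apply, map_sum, ip_sum_right]
    congr 1
    refine Finset.sum_congr rfl fun j _ => ?_
    rw [map_smul, ip_smul_right, of_apply, currentₗ_apply, mul_comm]
  rw [density, hM, absDet_mul_left hR, absDet_mul_right, hdet, density]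

/-! ### Exponentials of block matrices and the embedding of groups -/

section

variable {m n : Type} [Fintype m] [DecidableEq m] [Fintype n] [DecidableEq n]

theorem hasSum_exp_matrix (A : Matrix n n ℂ) :
    HasSum (fun k : ℕ => ((k.factorial : ℂ)⁻¹) • A ^ k) (NormedSpace.exp A) := by
  let _ : NormedRing (Matrix n n ℂ) := Matrix.linftyOpNormedRing
  let _ : NormedAlgebra ℂ (Matrix n n ℂ) := Matrix.linftyOpNormedAlgebra
  exact NormedSpace.exp_series_hasSum_exp' A

theorem exp_mul_of_intertwines {A : Matrix m m ℂ} {B : Matrix n n ℂ} {E : Matrix m n ℂ}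
    (h : A * E = E * B) : NormedSpace.exp A * E = E * NormedSpace.exp B := by
  have hp (k : ℕ) : A ^ k * E = E * B ^ k := by
    induction k with
    | zero => simp
    | succ k ih => rw [pow_succ, Matrix.mul_assoc, h, ← Matrix.mul_assoc, ih, Matrix.mul_assoc,
        ← pow_succ]
  have h1 := (hasSum_exp_matrix A).map (addMonoidHomMulRight E)
    (show Continuous fun X : Matrix m m ℂ => X * E from continuous_id.matrix_mul continuous_const)
  have h2 := (hasSum_exp_matrix B).map (addMonoidHomMulLeft E)
    (show Continuous fun X : Matrix n n ℂ => E * X from continuous_const.matrix_mul continuous_id)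
  refine h1.unique (h2.congr_fun ?_)
  intro k
  simp [addMonoidHomMulRight, addMonoidHomMulLeft, hp]

/-- The inclusions of the two summands intertwine the block matrix with its blocks, hence also their
exponentials. -/
theorem exp_fromBlocks_diag (A : Matrix m m ℂ) (B : Matrix n n ℂ) :
    NormedSpace.exp (fromBlocks A 0 0 B) =
      fromBlocks (NormedSpace.exp A) 0 0 (NormedSpace.exp B) := by
  have h1 : NormedSpace.exp (fromBlocks A 0 0 B) * fromRows (1 : Matrix m m ℂ) (0 : Matrix n m ℂ) =
      fromRows (1 : Matrix m m ℂ) (0 : Matrix n m ℂ) * NormedSpace.exp A := exp_mul_of_intertwines (by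
    rw [fromBlocks_mul_fromRows, fromRows_mul]; simp)
  have h2 : NormedSpace.exp (fromBlocks A 0 0 B) * fromRows (0 : Matrix m n ℂ) (1 : Matrix n n ℂ) =
      fromRows (0 : Matrix m n ℂ) (1 : Matrix n n ℂ) * NormedSpace.exp B := exp_mul_of_intertwines (by
    rw [fromBlocks_mul_fromRows, fromRows_mul]; simp)
  rw [← fromBlocks_toBlocks (NormedSpace.exp (fromBlocks A 0 0 B))] at h1 h2 ⊢
  rw [fromBlocks_mul_fromRows, fromRows_mul] at h1 h2
  replace h1 := fromRows_inj h1
  replace h2 := fromRows_inj h2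
  simp only [Matrix.mul_one, Matrix.mul_zero, Matrix.one_mul, Matrix.zero_mul, add_zero,
    zero_add] at h1 h2
  rw [h1.1, h1.2, h2.1, h2.2]

theorem exp_cM (D : Matrix n n ℝ) : ∃ R : Matrix n n ℝ, NormedSpace.exp (cM D) = cM R := by
  let _ : NormedRing (Matrix n n ℝ) := Matrix.linftyOpNormedRing
  let _ : NormedAlgebra ℝ (Matrix n n ℝ) := Matrix.linftyOpNormedAlgebra
  have h1 : HasSum (fun k : ℕ => ((k.factorial : ℝ)⁻¹) • D ^ k) (NormedSpace.exp D) :=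
    NormedSpace.exp_series_hasSum_exp' D
  have h2 := h1.map (cM : Matrix n n ℝ →+* Matrix n n ℂ)
    (continuous_id.matrix_map Complex.continuous_ofReal)
  refine ⟨_, (hasSum_exp_matrix (cM D)).unique (h2.congr_fun fun k => ?_)⟩
  simp [cM_smul]

theorem exp_mulVec_of_mulVec_eq_zero {X : Matrix n n ℂ} {v : n → ℂ} (h : X *ᵥ v = 0) :
    NormedSpace.exp X *ᵥ v = v := by
  have h1 : X * replicateCol Unit v = replicateCol Unit v * (0 : Matrix Unit Unit ℂ) := by
    rw [← replicateCol_mulVec, h]; simp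
  have h2 := exp_mul_of_intertwines h1
  rw [NormedSpace.exp_zero, Matrix.mul_one, ← replicateCol_mulVec] at h2
  exact replicateCol_injective h2

theorem mem_expGroup {𝔥 : Set (Matrix n n ℂ)} {X : Matrix n n ℂ} (hX : X ∈ 𝔥) :
    expGL X ∈ expGroup 𝔥 := Subgroup.subset_closure ⟨X, hX, rfl⟩

theorem expGroup_mono {𝔥 𝔨 : Set (Matrix n n ℂ)} (h : 𝔥 ⊆ 𝔨) : expGroup 𝔥 ≤ expGroup 𝔨 :=
  Subgroup.closure_mono (Set.image_mono h)

end

theorem psiGL_mul (k l : GL I27 ℂ) : psiGL (k * l) = psiGL k * psiGL l := by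
  apply Units.ext
  simp only [psiGL, Units.val_mul, _root_.mul_inv_rev, fromBlocks_multiply, transpose_mul]
  simp

/-- The embedding of the group `E₆` as a homomorphism. -/
def psiHom : GL I27 ℂ →* GL I56 ℂ := MonoidHom.mk' psiGL psiGL_mul

theorem psiGL_expGL (X : Matrix I27 I27 ℂ) : psiGL (expGL X) = expGL (psi X) := by
  apply Units.ext
  change fromBlocks (fromBlocks (NormedSpace.exp X) 0 0 1) 0 0
    (fromBlocks (NormedSpace.exp (-X))ᵀ 0 0 1) = NormedSpace.exp (psi X)
  rw [psi, exp_fromBlocks_diag, exp_fromBlocks_diag, exp_fromBlocks_diag, NormedSpace.exp_zero,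
    ← transpose_neg, Matrix.exp_transpose]

theorem psiGL_mem_expGroup {𝔥 : Set (Matrix I27 I27 ℂ)} {k : GL I27 ℂ} (hk : k ∈ expGroup 𝔥) :
    psiGL k ∈ expGroup (psi '' 𝔥) := by
  have h : expGroup 𝔥 ≤ (expGroup (psi '' 𝔥)).comap psiHom := ?_
  · exact h hk
  rw [expGroup, Subgroup.closure_le]
  rintro _ ⟨X, hX, rfl⟩
  rw [SetLike.mem_coe, Subgroup.mem_comap, psiHom, MonoidHom.mk'_apply, psiGL_expGL]
  exact mem_expGroup ⟨X, hX, rfl⟩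

theorem lieSO9_subset_lieF4 : lieSO9 ⊆ lieF4 := fun _ ⟨D, hD, _, h⟩ => ⟨D, hD, h⟩

theorem pI_mem_lieE7 (u : I27 → ℝ) : pI u ∈ lieE7 := ⟨0, zero_mem_lieU, _, (zero_add _).symm⟩

/-- The eigenvalues of `V`, as the diagonal entries of an element of `𝔍`. -/
def cartanD (v : Fin 3 → ℝ) : Fin 3 → ℝ :=
  v 0 • dgRow (Sum.inr ()) + v 1 • dgRow (Sum.inl 0) + v 2 • dgRow (Sum.inl 1)

theorem cartanV_eq (v : Fin 3 → ℝ) : cartanV v = pI (dg (cartanD v)) := by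
  have h0 := single_iDiag 0
  have h1 := single_iDiag 1
  have h2 := single_iOne
  rw [cartanV, frameE7_zero, frameE7_zero, frameE7_zero, cartanD, dg_add, dg_add, dg_smul, dg_smul,
    dg_smul, ← h0, ← h1, ← h2, pI_add, pI_add, pI_smul, pI_smul, pI_smul]

theorem Lm_commutator_cyclic (a b c : I27 → ℝ) :
    (Lm a * Lm (jmul b c) - Lm (jmul b c) * Lm a) + (Lm b * Lm (jmul a c) - Lm (jmul a c) * Lm b)
      + (Lm c * Lm (jmul a b) - Lm (jmul a b) * Lm c) = 0 :=
  eq_of_mulVec_eq fun z => by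
    simp only [add_mulVec, sub_mulVec, zero_mulVec, ← mulVec_mulVec, Lm_mulVec]
    linear_combination (norm := module) jmul_sq_comm_polarized a b c z

/-- In the cyclic identity for `e_i, e_j, e_j` the terms containing `e_i ∘ e_j = 0` disappear and
only `[L_{e_i}, L_{e_j}]` is left. -/
theorem commute_Lm_eD (i j : Fin 3) : Commute (Lm (eD i)) (Lm (eD j)) := by
  by_cases hij : i = j
  · rw [hij]
  have h := Lm_commutator_cyclic (eD i) (eD j) (eD j)
  have h1 : (Pi.single j 1 * Pi.single j 1 : Fin 3 → ℝ) = Pi.single j 1 := by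
    rw [← Pi.single_mul, one_mul]
  have h2 : (Pi.single i 1 * Pi.single j 1 : Fin 3 → ℝ) = (0 : ℝ) • 1 := by
    funext k
    by_cases hk : k = i
    · subst hk; simp [hij]
    · simp [hk]
  rw [eD, eD, jmul_dg_dg, jmul_dg_dg, h1, h2, dg_smul, Lm_smul] at h
  simp only [zero_smul, Matrix.mul_zero, Matrix.zero_mul, sub_zero, add_zero] at h
  exact sub_eq_zero.mp h

theorem commute_Lm_dg (d d' : Fin 3 → ℝ) : Commute (Lm (dg d)) (Lm (dg d')) := by
  rw [dg_eq_sum d, dg_eq_sum d', Lm_sum, Lm_sum]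
  refine Commute.sum_left _ _ _ fun i _ => Commute.sum_right _ _ _ fun j _ => ?_
  rw [Lm_smul, Lm_smul]
  exact ((commute_Lm_eD i j).smul_left _).smul_right _

theorem commute_pI_dg (d d' : Fin 3 → ℝ) : Commute (pI (dg d)) (pI (dg d')) := by
  have h := lie_pI_pI (dg d) (dg d')
  rw [(commute_Lm_dg d d').eq, sub_self, toC_zero, psi_zero, neg_zero, Ring.lie_def] at h
  exact sub_eq_zero.mp h

theorem MatDiffAt.psiGL {E : Type} [NormedAddCommGroup E] [NormedSpace ℝ E] {B : E → GL I27 ℂ}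
    {p : E} (hB : MatDiffAt B p) : MatDiffAt (fun q => psiGL (B q)) p := by
  have h0 (z : ℂ) : DifferentiableAt ℝ (fun _ : E => z) p := differentiableAt_const z
  rintro ((i | i) | (i | i)) ((j | j) | (j | j))
  exacts [hB i j, h0 _, h0 _, h0 _, h0 _, h0 _, h0 _, h0 _, h0 _, h0 _, hB.inv j i, h0 _, h0 _,
    h0 _, h0 _, h0 _]

/-- The three directions of `V` commute, so only one-parameter exponentials ever have to be
differentiated. -/
theorem expGL_cartanV (v : Fin 3 → ℝ) :
    expGL (cartanV v) = expGL (v 0 • pI (dg (dgRow (Sum.inr ())))) *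
      (expGL (v 1 • pI (dg (dgRow (Sum.inl 0)))) * expGL (v 2 • pI (dg (dgRow (Sum.inl 1))))) := by
  apply Units.ext
  change NormedSpace.exp _ = NormedSpace.exp _ * (NormedSpace.exp _ * NormedSpace.exp _)
  rw [cartanV_eq, ← Matrix.exp_add_of_commute, ← Matrix.exp_add_of_commute]
  · simp only [cartanD, dg_add, dg_smul, pI_add, pI_smul, add_assoc]
  · simp only [← pI_smul, ← dg_smul]
    exact (commute_pI_dg _ _).add_right (commute_pI_dg _ _)
  · simp only [← pI_smul, ← dg_smul]; exact commute_pI_dg _ _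

theorem matDiffAt_expGL_cartanV (v : Fin 3 → ℝ) : MatDiffAt (fun v => expGL (cartanV v)) v := by
  have h (i : Fin 3) (X : Matrix I56 I56 ℂ) : MatDiffAt (fun v : Fin 3 → ℝ => expGL (v i • X)) v :=
    (matDiffAt_expGL_smul X (v i)).comp (f := fun v : Fin 3 → ℝ => v i) (differentiableAt_apply i v)
  simp only [expGL_cartanV]
  exact (h _ _).mul ((h _ _).mul (h _ _))

/-! ### Currents of maps to `F₄` and `SO(9)` -/

section

variable {E : Type} [NormedAddCommGroup E] [NormedSpace ℝ E] {n : Type} [Fintype n]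

/-- Otherwise some linear functional would vanish on `P` but not on the derivative, although its
composition with `σ` is constantly zero. -/
theorem mfderiv'_mem (P : Submodule ℝ (Matrix n n ℂ)) {σ : E → Matrix n n ℂ} {p : E}
    (hσ : MDiff σ p) (h : ∀ q, σ q ∈ P) (w : E) : mfderiv' σ p w ∈ P := by
  by_contra hw
  obtain ⟨f, hf, hP⟩ := Submodule.exists_le_ker_of_notMem hw
  let f' : (n → n → ℂ) →ₗ[ℝ] ℝ := f
  have h1 : HasFDerivAt (fun q i j => σ q i j)
      (ContinuousLinearMap.pi fun i => ContinuousLinearMap.pi fun j =>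
        fderiv ℝ (fun q => σ q i j) p) p :=
    hasFDerivAt_pi.2 fun i => hasFDerivAt_pi.2 fun j => (hσ i j).hasFDerivAt
  have h2 := f'.toContinuousLinearMap.hasFDerivAt.comp p h1
  have h3 : (f'.toContinuousLinearMap ∘ fun q i j => σ q i j) = fun _ => 0 :=
    funext fun q => hP (h q)
  rw [h3] at h2
  have h4 := congrArg (fun T => T w) (h2.unique (hasFDerivAt_const (0 : ℝ) p))
  exact hf h4

theorem mfderiv'_mulVec {σ : E → Matrix n n ℂ} {p : E} (hσ : MDiff σ p) {v : n → ℂ}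
    (h : ∀ q, σ q *ᵥ v = v) (w : E) : mfderiv' σ p w *ᵥ v = 0 := by
  have hC : MDiff (fun _ : E => vecMulVec v (1 : n → ℂ)) p := fun _ _ => differentiableAt_const _
  have h1 := mfderiv'_mul hσ hC w
  simp only [mul_vecMulVec, h, mfderiv'_const, Matrix.mul_zero, add_zero] at h1
  funext i
  have h2 := congrFun (congrFun h1 i) i
  simpa [vecMulVec_apply] using h2.symm

variable [DecidableEq n]

theorem mfderiv'_inv {B : E → GL n ℂ} {p : E} (hB : MatDiffAt B p) (w : E) :
    mfderiv' (fun q => (B q)⁻¹.val) p w =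
      -((B p)⁻¹.val * mfderiv' (fun q => (B q).val) p w * (B p)⁻¹.val) := by
  have h := mfderiv'_mul hB.inv hB w
  have h1 (q : E) : (B q)⁻¹.val * (B q).val = 1 := (B q).inv_mul
  have h2 : (B p).val * (B p)⁻¹.val = 1 := (B p).mul_inv
  simp only [h1, mfderiv'_const] at h
  have h3 := congrArg (· * (B p)⁻¹.val) h
  simp only [Matrix.zero_mul, Matrix.add_mul] at h3
  rw [Matrix.mul_assoc _ (B p).val, h2, Matrix.mul_one] at h3
  exact eq_neg_of_add_eq_zero_left h3.symm

end

variable {E : Type} [NormedAddCommGroup E] [NormedSpace ℝ E]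

theorem current_psiGL {B : E → GL I27 ℂ} {p : E} (hB : MatDiffAt B p) (w : E) :
    current (fun q => psiGL (B q)) p w =
      psi ((B p)⁻¹.val * mfderiv' (fun q => (B q).val) p w) := by
  have hd : mfderiv' (fun q => (psiGL (B q)).val) p w =
      fromBlocks (fromBlocks (mfderiv' (fun q => (B q).val) p w) 0 0 0) 0 0
        (fromBlocks (mfderiv' (fun q => (B q)⁻¹.val) p w)ᵀ 0 0 0) := by
    have hc (z : ℂ) : fderiv ℝ (fun _ : E => z) p w = 0 := by simp
    ext ((i | i) | (i | i)) ((j | j) | (j | j))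
    exacts [rfl, hc _, hc _, hc _, hc _, hc _, hc _, hc _, hc _, hc _, rfl, hc _, hc _, hc _, hc _,
      hc _]
  have h1 : (B p)⁻¹.val * (B p).val = 1 := (B p).inv_mul
  have hi : (psiGL (B p))⁻¹.val =
      fromBlocks (fromBlocks (B p)⁻¹.val 0 0 1) 0 0 (fromBlocks (B p).valᵀ 0 0 1) := rfl
  rw [current_eq, hd, hi, mfderiv'_inv hB, psi]
  simp only [fromBlocks_multiply, Matrix.mul_zero, Matrix.zero_mul, add_zero, zero_add]
  rw [← transpose_mul, Matrix.neg_mul, Matrix.mul_assoc, h1, Matrix.mul_one, transpose_neg]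

/-- The matrices with real entries. -/
def realMat : Submodule ℝ (Matrix I27 I27 ℂ) :=
  LinearMap.range (⟨⟨toC, toC_add⟩, toC_smul⟩ : Matrix I27 I27 ℝ →ₗ[ℝ] Matrix I27 I27 ℂ)

theorem mem_realMat {X : Matrix I27 I27 ℂ} : X ∈ realMat ↔ ∃ M, toC M = X := Iff.rfl

/-- The multiplication operators. -/
def mulOps : Submodule ℝ (Matrix I27 I27 ℂ) :=
  LinearMap.range (⟨⟨fun u => toC (Lm u), fun u v => by rw [Lm_add, toC_add]⟩,
    fun r u => by simp [Lm_smul, toC_smul]⟩ : (I27 → ℝ) →ₗ[ℝ] Matrix I27 I27 ℂ)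

theorem mem_mulOps {X : Matrix I27 I27 ℂ} : X ∈ mulOps ↔ ∃ u, toC (Lm u) = X := Iff.rfl

theorem mul_mem_realMat {X Y : Matrix I27 I27 ℂ} (hX : X ∈ realMat) (hY : Y ∈ realMat) :
    X * Y ∈ realMat := by
  obtain ⟨M, rfl⟩ := mem_realMat.mp hX
  obtain ⟨N, rfl⟩ := mem_realMat.mp hY
  exact ⟨M * N, toC_mul M N⟩

theorem toC_mulVec (M : Matrix I27 I27 ℝ) (u : I27 → ℝ) :
    toC M *ᵥ (fun μ => (u μ : ℂ)) = fun μ => ((M *ᵥ u) μ : ℂ) := by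
  funext μ
  simp [toC, mulVec, dotProduct]

theorem toC_mulVec_eq_zero {M : Matrix I27 I27 ℝ} {u : I27 → ℝ} :
    toC M *ᵥ (fun μ => (u μ : ℂ)) = 0 ↔ M *ᵥ u = 0 := by
  rw [toC_mulVec, funext_iff, funext_iff]
  simp

theorem lieF4_group_real {k : GL I27 ℂ} (hk : k ∈ expGroup lieF4) : k.val ∈ realMat := by
  suffices k.val ∈ realMat ∧ k⁻¹.val ∈ realMat from this.1
  induction hk using Subgroup.closure_induction with
  | mem g hg =>
    obtain ⟨_, ⟨D, -, rfl⟩, rfl⟩ := hg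
    obtain ⟨R, hR⟩ := exp_cM D
    obtain ⟨R', hR'⟩ := exp_cM (-D)
    refine ⟨⟨R, hR.symm⟩, ⟨R', ?_⟩⟩
    rw [map_neg] at hR'
    exact hR'.symm
  | one => exact ⟨⟨1, map_one cM⟩, ⟨1, by rw [inv_one]; exact map_one cM⟩⟩
  | mul a b _ _ ha hb =>
    rw [_root_.mul_inv_rev, Units.val_mul, Units.val_mul]
    exact ⟨mul_mem_realMat ha.1 hb.1, mul_mem_realMat hb.2 ha.2⟩
  | inv a _ ha => rw [inv_inv]; exact ⟨ha.2, ha.1⟩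

theorem expGroup_mulVec {n : Type} [Fintype n] [DecidableEq n] {𝔥 : Set (Matrix n n ℂ)} {v : n → ℂ}
    (h : ∀ X ∈ 𝔥, X *ᵥ v = 0) {k : GL n ℂ} (hk : k ∈ expGroup 𝔥) : k.val *ᵥ v = v := by
  induction hk using Subgroup.closure_induction with
  | mem g hg => obtain ⟨X, hX, rfl⟩ := hg; exact exp_mulVec_of_mulVec_eq_zero (h X hX)
  | one => simp
  | mul a b _ _ ha hb => rw [Units.val_mul, ← mulVec_mulVec, hb, ha]
  | inv a _ ha =>
    have h1 : a⁻¹.val * a.val = 1 := a.inv_mul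
    conv_lhs => rw [← ha, mulVec_mulVec, h1, one_mulVec]

theorem lie_mem_mulOps {S : Matrix I27 I27 ℂ} (hS : S ∈ lieF4) {X : Matrix I27 I27 ℂ}
    (hX : X ∈ mulOps) : ⁅S, X⁆ ∈ mulOps := by
  obtain ⟨D, hD, rfl⟩ := hS
  obtain ⟨u, rfl⟩ := mem_mulOps.mp hX
  refine ⟨D *ᵥ u, ?_⟩
  change toC (Lm (D *ᵥ u)) = _
  rw [← hD.commutator_Lm, Ring.lie_def, ← toC_mul, ← toC_mul]
  exact map_sub cM _ _

/-- The elements of the group are real, fix the identity of 𝔍 and conjugate multiplication operators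
into multiplication operators. These linear conditions survive differentiation, so `D = B⁻¹ dB` is
real, kills the identity and satisfies `[D, L_u] = L_y` for some `y`. Evaluating on the identity
gives `y = Du`, and this is the Leibniz rule. -/
theorem lieF4_current_mem {B : E → GL I27 ℂ} {p : E} (hB : MatDiffAt B p)
    (h : ∀ q, B q ∈ expGroup lieF4) (w : E) :
    (B p)⁻¹.val * mfderiv' (fun q => (B q).val) p w ∈ lieF4 := by
  obtain ⟨D, hD⟩ := mem_realMat.mp (mul_mem_realMat (lieF4_group_real (inv_mem (h p)))
    (mfderiv'_mem realMat hB (fun q => lieF4_group_real (h q)) w))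
  have hB1 : (B p)⁻¹.val * (B p).val = 1 := (B p).inv_mul
  have hB2 : (B p).val * (B p)⁻¹.val = 1 := (B p).mul_inv
  have hdB : mfderiv' (fun q => (B q).val) p w = (B p).val * toC D := by
    rw [hD, ← Matrix.mul_assoc, hB2, Matrix.one_mul]
  refine ⟨D, ?_, hD.symm⟩
  have hone : D *ᵥ jone = 0 := by
    rw [← toC_mulVec_eq_zero, hD, ← mulVec_mulVec, mfderiv'_mulVec hB, mulVec_zero]
    refine fun q => expGroup_mulVec ?_ (h q)
    rintro _ ⟨D', hD', rfl⟩
    exact toC_mulVec_eq_zero.mpr hD'.mulVec_jone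
  have hL (u : I27 → ℝ) : ∃ y, Lm y = D * Lm u - Lm u * D := by
    have hu : toC (Lm u) ∈ mulOps := ⟨u, rfl⟩
    have hc : MDiff (fun _ : E => toC (Lm u)) p := fun _ _ => differentiableAt_const _
    -- The derivative of `B L_u B⁻¹` is a multiplication operator; conjugating it back with `B⁻¹`
    -- turns it into `[D, L_u]`.
    have h1 := mfderiv'_mem mulOps ((MDiff.mul hB hc).mul hB.inv)
      (fun q => expGroup_conj_mem (fun S hS X hX => lie_mem_mulOps hS hX) (h q) hu) w
    have h2 := expGroup_conj_mem (fun S hS X hX => lie_mem_mulOps hS hX) (inv_mem (h p)) h1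
    rw [mfderiv'_mul (MDiff.mul hB hc) hB.inv, mfderiv'_mul hB hc, mfderiv'_const,
      mfderiv'_inv hB, hdB] at h2
    obtain ⟨y, hy⟩ := mem_mulOps.mp h2
    refine ⟨y, toC_injective ?_⟩
    have e : toC (D * Lm u - Lm u * D) = toC D * toC (Lm u) - toC (Lm u) * toC D := by
      rw [← toC_mul, ← toC_mul]; exact map_sub cM _ _
    rw [hy, e, inv_inv]
    simp only [Matrix.mul_zero, add_zero, Matrix.mul_add, Matrix.add_mul, Matrix.mul_neg,
      Matrix.neg_mul, Matrix.mul_assoc, hB1, hB2, Matrix.mul_one]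
    simp only [← Matrix.mul_assoc, hB1, Matrix.one_mul, sub_eq_add_neg]
  intro u v
  obtain ⟨y, hy⟩ := hL u
  have h1 := congrArg (· *ᵥ jone) hy
  simp only [sub_mulVec, ← mulVec_mulVec, Lm_mulVec, jmul_jone, hone, jmul_zero, sub_zero] at h1
  have h2 := congrArg (· *ᵥ v) hy
  simp only [sub_mulVec, ← mulVec_mulVec, Lm_mulVec, h1] at h2
  rw [h2]; abel

theorem lieSO9_current_mem {B : E → GL I27 ℂ} {p : E} (hB : MatDiffAt B p)
    (h : ∀ q, B q ∈ expGroup lieSO9) (w : E) :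
    (B p)⁻¹.val * mfderiv' (fun q => (B q).val) p w ∈ lieSO9 := by
  obtain ⟨D, hD, h1⟩ := lieF4_current_mem hB (fun q => expGroup_mono lieSO9_subset_lieF4 (h q)) w
  refine ⟨D, hD, ?_, h1⟩
  rw [← toC_mulVec_eq_zero, ← h1, ← mulVec_mulVec, mfderiv'_mulVec hB, mulVec_zero]
  refine fun q => expGroup_mulVec ?_ (h q)
  rintro _ ⟨D', -, hann, rfl⟩
  exact toC_mulVec_eq_zero.mpr hann

/-! ### The adjoint action of `e^V` -/

section

variable (d : Fin 3 → ℝ) (s : Fin 3) (k : Fin 8)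

/-- The half-sums `(d_i + d_j) / 2`. -/
def halfSum : ℝ := (d (fstIdx s) + d (sndIdx s)) / 2

/-- The half-differences `(d_i - d_j) / 2`. -/
def halfDiff : ℝ := (d (fstIdx s) - d (sndIdx s)) / 2

theorem commute_Lm_eD_off {i : Fin 3} (h1 : fstIdx s ≠ i) (h2 : sndIdx s ≠ i) :
    Commute (Lm (eD i)) (Lm (off s k)) := by
  have h := Lm_commutator_cyclic (eD i) (eD i) (off s k)
  have h3 : (Pi.single i 1 * Pi.single i 1 : Fin 3 → ℝ) = Pi.single i 1 := by
    rw [← Pi.single_mul, one_mul]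
  rw [eD, jmul_dg_off, jmul_dg_dg, h3, Lm_smul, Pi.single_eq_of_ne h1, Pi.single_eq_of_ne h2] at h
  simp only [add_zero, zero_div, zero_smul, Matrix.mul_zero, Matrix.zero_mul, sub_zero,
    zero_add] at h
  exact (sub_eq_zero.mp h).symm

/-- Modulo the identity and the idempotent at the index outside the position `s`, both of which give
operators commuting with that of `off s k`, a diagonal element is a multiple of `dlt s`. -/
theorem Lm_dg_off_commutator :
    Lm (dg d) * Lm (off s k) - Lm (off s k) * Lm (dg d) = halfDiff d s • fD s k := by
  obtain ⟨i, h1, h2, hd⟩ : ∃ i, fstIdx s ≠ i ∧ sndIdx s ≠ i ∧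
      d = halfDiff d s • dlt s + halfSum d s • 1 + (d i - halfSum d s) • Pi.single i 1 := by
    -- The index not involved in the positions `(12), (13), (23)`.
    refine ⟨![2, 1, 0] s, ?_, ?_, ?_⟩
    · fin_cases s <;> simp [fstIdx]
    · fin_cases s <;> simp [sndIdx]
    · funext j
      simp only [Pi.add_apply, Pi.smul_apply, Pi.one_apply, smul_eq_mul, mul_one]
      fin_cases s <;> fin_cases j <;>
        simp [halfDiff, halfSum, dlt, fstIdx, sndIdx, Pi.single_apply] <;> ring
  have hc := (commute_Lm_eD_off s k h1 h2).eq
  have hL : Lm (dg d) = halfDiff d s • Lm (dg (dlt s)) + halfSum d s • 1 +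
      (d i - halfSum d s) • Lm (eD i) := by
    conv_lhs => rw [hd]
    rw [dg_add, dg_add, dg_smul, dg_smul, dg_smul, dg_one, Lm_add, Lm_add, Lm_smul, Lm_smul,
      Lm_smul, Lm_jone, eD]
  rw [hL, fD]
  simp only [Matrix.add_mul, Matrix.mul_add, Matrix.smul_mul, Matrix.mul_smul, Matrix.one_mul,
    Matrix.mul_one, hc]
  module

/-- `pI (off s k)` and the derivation `fD s k` span a plane on which the bracket with `V` is an
infinitesimal rotation; this is the restricted root `(d_i - d_j)/2`. -/
theorem exp_conj_pI_off :
    NormedSpace.exp (pI (dg d)) * pI (off s k) * NormedSpace.exp (-pI (dg d)) =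
      Real.cos (halfDiff d s) • pI (off s k) - Real.sin (halfDiff d s) • psi (toC (fD s k)) := by
  have h := matrix_exp_conj_rotation (V := pI (dg d)) (Y := pI (off s k)) (Z := psi (toC (fD s k)))
    (r := -halfDiff d s) ?_ ?_
  · rw [h, Real.cos_neg, Real.sin_neg, neg_smul, sub_eq_add_neg]
  · rw [lie_pI_pI, Lm_dg_off_commutator, toC_smul, psi_smul, neg_smul]
  · have h1 : ⁅pI (dg d), psi (toC (fD s k))⁆ = -⁅psi (toC (fD s k)), pI (dg d)⁆ := by
      rw [Ring.lie_def, Ring.lie_def, neg_sub]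
    rw [h1, lie_psi_toC_pI (isDerivation_fD s k), fD_mulVec_dg, pI_smul, halfDiff]
    module

theorem lie_pI_psiL {y : I27 → ℝ} (hy : tr y = 0) (u : I27 → ℝ) :
    ⁅pI u, psiL y⁆ = -pR (jmul y u) := by
  rw [← lie_psiL_pI hy, Ring.lie_def, Ring.lie_def, neg_sub]

/-- The rotation plane of the restricted root `(d_i + d_j)/2`, with partner the generator `C̃` of
the same basis element. -/
theorem exp_conj_pR_off :
    NormedSpace.exp (pI (dg d)) * pR (off s k) * NormedSpace.exp (-pI (dg d)) =
      Real.cos (halfSum d s) • pR (off s k) + Real.sin (halfSum d s) • psiL (off s k) := by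
  refine matrix_exp_conj_rotation ?_ ?_
  · rw [lie_pI_pR, dg_dot_off, jmul_dg_off, mul_zero, mul_zero, zero_smul, zero_smul, add_zero,
      sub_zero, psiL_smul, halfSum]
  · rw [lie_pI_psiL (tr_off s k), jmul_comm, jmul_dg_off, pR_smul, neg_smul, halfSum]

theorem exp_conj_pI_dg (d' : Fin 3 → ℝ) :
    NormedSpace.exp (pI (dg d)) * pI (dg d') * NormedSpace.exp (-pI (dg d)) = pI (dg d') := by
  rw [← (commute_exp (commute_pI_dg d' d)).eq, Matrix.mul_assoc, exp_mul_exp_neg, Matrix.mul_one]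

theorem sum_dgRow_mul_dgRow (β γ : Fin 2 ⊕ Unit) :
    ∑ i, dgRow β i * dgRow γ i = if β = γ then 2 else 0 := by
  have h (β : Fin 2 ⊕ Unit) :
      dg (dgRow β) = Pi.single (Sum.elim (fun s => iDiag s) (fun _ => iOne) β) 1 := by
    rcases β with s | u
    · exact (single_iDiag s).symm
    · exact single_iOne.symm
  have h1 := dg_dot_dg (dgRow β) (dgRow γ)
  rw [h, h, single_one_dotProduct] at h1
  rw [Fin.sum_univ_three]
  have h2 : (Pi.single (Sum.elim (fun s => iDiag s) (fun _ => iOne) γ) 1 : I27 → ℝ)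
      (Sum.elim (fun s => iDiag s) (fun _ => iOne) β) = if β = γ then 1 else 0 := by
    rw [Pi.single_apply]
    congr 1
    rcases β with s | u <;> rcases γ with t | u' <;> simp [iDiag, iOne]
  rw [h2] at h1
  split_ifs at h1 ⊢ <;> linarith

/-- The diagonal entries of the diagonal basis elements, as a matrix. -/
def dgMat : Matrix (Fin 2 ⊕ Unit) (Fin 3) ℝ := of dgRow

theorem dgMat_mul_transpose : dgMat * dgMatᵀ = (2 : ℝ) • 1 := by
  ext β γ
  rw [mul_apply, Matrix.smul_apply, one_apply, smul_eq_mul, mul_ite, mul_one, mul_zero,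
    ← sum_dgRow_mul_dgRow β γ]
  rfl

/-- Orthogonality of the rows becomes completeness, as both index sets have three elements. -/
theorem transpose_mul_dgMat : dgMatᵀ * dgMat = (2 : ℝ) • 1 := by
  have h : dgMat * ((1 / 2 : ℝ) • dgMatᵀ) = 1 := by
    rw [Matrix.mul_smul, dgMat_mul_transpose, smul_smul]; norm_num
  have h2 := (mul_eq_one_comm_of_card_eq _ _ _ (by simp)).mp h
  rw [Matrix.smul_mul] at h2
  rw [← h2, smul_smul]; norm_num

theorem sum_dgRow_mul (i j : Fin 3) : ∑ β, dgRow β i * dgRow β j = if i = j then 2 else 0 := by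
  have h := congrFun (congrFun transpose_mul_dgMat i) j
  rw [mul_apply, Matrix.smul_apply, one_apply, smul_eq_mul, mul_ite, mul_one, mul_zero] at h
  exact h

/-- The generators `C̃` of the diagonal basis elements, and `Y₁`. -/
def cartanU : Fin 2 ⊕ Unit → Matrix I56 I56 ℂ :=
  Sum.elim (fun s => frameE6 (Sum.inl s)) fun _ => Y1

/-- The bracket is `d_i` times the traceless part of `e_i`, acting through `C̃`, plus a multiple of
`Y₁`. The coefficient of `Y₁` turns out to be the one that `e_i` has along the third, scalar, basis
element, so the three directions can be treated uniformly. -/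
theorem lie_pI_pR_eD (i : Fin 3) : ⁅pI (dg d), pR (eD i)⁆ =
    d i • ∑ β, (dgRow β i / 2) • cartanU β := by
  have h6 : √(2 / 3) = √6 / 3 := by
    rw [show (2 / 3 : ℝ) = 6 / 3 ^ 2 by norm_num, Real.sqrt_div (by norm_num),
      Real.sqrt_sq (by norm_num)]
  have hd : d * Pi.single i 1 = d i • Pi.single i 1 := by
    funext j
    by_cases hj : j = i
    · subst hj; simp
    · simp [hj]
  have hu : dg d ⬝ᵥ eD i = d i / 2 := by
    rw [eD, dg_dot_dg]; fin_cases i <;> simp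
  -- Completeness of the rows of `dgMat` with the constant row removed.
  have hv : (∑ s : Fin 2, (dgRow (Sum.inl s) i / 2) • dgRow (Sum.inl s)) =
      Pi.single i 1 - (1 / 3 : ℝ) • 1 := by
    funext j
    have h := sum_dgRow_mul i j
    have h1 (i : Fin 3) : dgRow (Sum.inr ()) i = √(2 / 3) := by fin_cases i <;> rfl
    have h2 : √(2 / 3) * √(2 / 3) = 2 / 3 := Real.mul_self_sqrt (by norm_num)
    rw [Fintype.sum_sum_type, Finset.univ_unique (α := Unit), Finset.sum_singleton, PUnit.default_eq_unit, h1,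
      h1, h2, Fin.sum_univ_two] at h
    rw [Fin.sum_univ_two]
    simp only [Pi.add_apply, Pi.smul_apply, smul_eq_mul, Pi.sub_apply, Pi.one_apply,
      Pi.single_apply, eq_comm (a := j)]
    split_ifs at h ⊢ <;> linarith
  have hs : (∑ s : Fin 2, (dgRow (Sum.inl s) i / 2) • frameE6 (Sum.inl s)) =
      psiL (eD i - (1 / 3 : ℝ) • jone) := by
    have h (s : Fin 2) : frameE6 (Sum.inl s) = psiL (dg (dgRow (Sum.inl s))) := by
      rw [frameE6_eq, ← single_iDiag]
    rw [eD, ← dg_one, ← dg_smul, ← dg_sub, ← hv, Fin.sum_univ_two, Fin.sum_univ_two, dg_add, psiL_add,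
      dg_smul, dg_smul, psiL_smul, psiL_smul, h, h]
  have hr : dgRow (Sum.inr ()) i = √6 / 3 := by rw [← h6]; fin_cases i <;> rfl
  rw [lie_pI_pR, hu, Fintype.sum_sum_type, Finset.univ_unique (α := Unit), Finset.sum_singleton]
  simp only [cartanU, Sum.elim_inl, Sum.elim_inr, PUnit.default_eq_unit]
  rw [hs, hr, eD, jmul_dg_dg, hd, dg_smul, ← eD]
  have : d i • eD i - (2 / 3 * (d i / 2)) • jone = d i • (eD i - (1 / 3 : ℝ) • jone) := by module
  rw [this, psiL_smul]
  module

theorem lie_pI_cartanU (β : Fin 2 ⊕ Unit) :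
    ⁅pI (dg d), cartanU β⁆ = -pR (dg (dgRow β * d)) := by
  rcases β with s | u
  · have h : frameE6 (Sum.inl s) = psiL (dg (dgRow (Sum.inl s))) := by
      rw [frameE6_eq, ← single_iDiag]
    have ht : tr (dg (dgRow (Sum.inl s))) = 0 := by rw [← single_iDiag]; exact tr_single_inl _
    rw [cartanU, Sum.elim_inl, h, lie_pI_psiL ht, jmul_dg_dg]
  · have h1 : ⁅pI (dg d), Y1⁆ = -⁅Y1, pI (dg d)⁆ := by rw [Ring.lie_def, Ring.lie_def, neg_sub]
    have h2 : dgRow (Sum.inr u) * d = (2 / √6) • d := by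
      have h6 : √(2 / 3) = 2 / √6 := by
        rw [show (2 / 3 : ℝ) = 2 ^ 2 / 6 by norm_num, Real.sqrt_div (by norm_num),
          Real.sqrt_sq (by norm_num)]
      funext i
      rw [Pi.mul_apply, Pi.smul_apply, smul_eq_mul, ← h6]
      fin_cases i <;> rfl
    rw [cartanU, Sum.elim_inr, h1, lie_Y1_pI, h2, dg_smul, pR_smul]

/-- The rotation of angle `d_i`. The basis elements of the diagonal are not themselves root vectors,
so the diagonal part of the frame is first expanded in the idempotents. -/
theorem exp_conj_pR_eD (i : Fin 3) :
    NormedSpace.exp (pI (dg d)) * pR (eD i) * NormedSpace.exp (-pI (dg d)) =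
      Real.cos (d i) • pR (eD i) + Real.sin (d i) • ∑ β, (dgRow β i / 2) • cartanU β := by
  refine matrix_exp_conj_rotation (lie_pI_pR_eD d i) ?_
  have hlie : ⁅pI (dg d), ∑ β, (dgRow β i / 2) • cartanU β⁆ =
      ∑ β, (dgRow β i / 2) • ⁅pI (dg d), cartanU β⁆ := by
    simp only [Ring.lie_def, Matrix.mul_sum, Matrix.sum_mul, ← Finset.sum_sub_distrib,
      Matrix.smul_mul, Matrix.mul_smul, smul_sub]
  have hv : ∑ β, (dgRow β i / 2) • (dgRow β * d) = d i • Pi.single i 1 := by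
    funext j
    have h := sum_dgRow_mul i j
    simp only [Finset.sum_apply, Pi.smul_apply, Pi.mul_apply, smul_eq_mul]
    have e : ∑ β, dgRow β i / 2 * (dgRow β j * d j) = (∑ β, dgRow β i * dgRow β j) * (d j / 2) := by
      rw [Finset.sum_mul]; exact Finset.sum_congr rfl fun β _ => by ring
    rw [e, h, Pi.single_apply]
    by_cases hij : i = j
    · subst hij; simp; ring
    · simp [hij, Ne.symm hij]
  have hsum : ∑ β, (dgRow β i / 2) • pR (dg (dgRow β * d)) = d i • pR (eD i) := by
    rw [eD, ← pR_smul, ← dg_smul, ← hv]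
    simp only [Fintype.sum_sum_type, Fintype.sum_unique, Fin.sum_univ_two, dg_add, pR_add, dg_smul,
      pR_smul]
  rw [hlie]
  simp only [lie_pI_cartanU, smul_neg, Finset.sum_neg_distrib]
  rw [hsum, neg_smul]

/-- The component in 𝔭 is left unspecified, since it is orthogonal to the current of a map to `U`.
-/
theorem exp_conj_pR_dgRow (β : Fin 2 ⊕ Unit) :
    ∃ u, NormedSpace.exp (pI (dg d)) * pR (dg (dgRow β)) * NormedSpace.exp (-pI (dg d)) =
      pR u + ∑ γ, (∑ i, dgRow β i / 2 * Real.sin (d i) * dgRow γ i) • cartanU γ := by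
  refine ⟨∑ i, (dgRow β i * Real.cos (d i)) • eD i, ?_⟩
  have h1 : pR (dg (dgRow β)) = ∑ i, dgRow β i • pR (eD i) := by
    rw [dg_eq_sum]; change pRₗ _ = ∑ i, _ • pRₗ _; simp only [map_sum, map_smul]
  have h2 : pR (∑ i, (dgRow β i * Real.cos (d i)) • eD i) =
      ∑ i, (dgRow β i * Real.cos (d i)) • pR (eD i) := by
    change pRₗ _ = ∑ i, _ • pRₗ _; simp only [map_sum, map_smul]
  rw [h1, h2, Matrix.mul_sum, Matrix.sum_mul]
  simp only [Matrix.mul_smul, Matrix.smul_mul, exp_conj_pR_eD, smul_add, Finset.sum_add_distrib,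
    smul_smul]
  congr 1
  simp only [Finset.smul_sum, Finset.sum_smul, smul_smul]
  rw [Finset.sum_comm]
  refine Finset.sum_congr rfl fun γ _ => Finset.sum_congr rfl fun i _ => ?_
  congr 1
  ring

end

/-! ### The current of the Euler parametrization -/

/-- By commutativity the conjugations in the cocycle rule act trivially, so the current of `e^V` is
just `dV`. -/
theorem current_expGL_cartanV (v w : Fin 3 → ℝ) :
    current (fun v => expGL (cartanV v)) v w = cartanV w := by
  have hm (i : Fin 3) (X : Matrix I56 I56 ℂ) : MatDiffAt (fun v : Fin 3 → ℝ => expGL (v i • X)) v :=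
    (matDiffAt_expGL_smul X (v i)).comp (f := fun v : Fin 3 → ℝ => v i) (differentiableAt_apply i v)
  have hc (i : Fin 3) (X : Matrix I56 I56 ℂ) :
      current (fun v : Fin 3 → ℝ => expGL (v i • X)) v w = w i • X := by
    rw [current_comp (f := fun v : Fin 3 → ℝ => v i) (matDiffAt_expGL_smul X (v i))
      (differentiableAt_apply i v), current_expGL_smul, (hasFDerivAt_apply (𝕜 := ℝ) i v).fderiv]
    rfl
  have he (d d' : Fin 3 → ℝ) (r t : ℝ) :
      (expGL (r • pI (dg d)))⁻¹.val * (t • pI (dg d')) * (expGL (r • pI (dg d))).val =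
        t • pI (dg d') := by
    have h := exp_conj_pI_dg (-r • d) (t • d')
    rw [dg_smul, pI_smul, dg_smul, pI_smul, neg_smul, neg_neg] at h
    exact h
  simp only [expGL_cartanV]
  rw [current_mul (hm _ _) ((hm _ _).mul (hm _ _)), current_mul (hm _ _) (hm _ _), hc, hc, hc, he,
    _root_.mul_inv_rev, Units.val_mul, Units.val_mul]
  have h1 := he (dgRow (Sum.inl 0)) (dgRow (Sum.inr ())) (v 1) (w 0)
  have h2 := he (dgRow (Sum.inl 1)) (dgRow (Sum.inr ())) (v 2) (w 0)
  simp only [Matrix.mul_assoc] at h1 h2 ⊢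
  rw [← Matrix.mul_assoc (w 0 • _), ← Matrix.mul_assoc _ (w 0 • _ * _), h1, h2, cartanV_eq, cartanD,
    dg_add, dg_add, dg_smul, dg_smul, dg_smul, pI_add, pI_add, pI_smul, pI_smul, pI_smul, add_assoc]

theorem commute_Y1_psiGL (k : GL I27 ℂ) : Commute Y1 (psiGL k).val := by
  rw [Commute, SemiconjBy, Y1, psiGL]
  simp [fromBlocks_multiply]

theorem Y1_conj_psiGL (k : GL I27 ℂ) (t : ℝ) :
    (psiGL k)⁻¹.val * (t • Y1) * (psiGL k).val = t • Y1 := by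
  have h : (psiGL k)⁻¹.val * (psiGL k).val = 1 := (psiGL k).inv_mul
  rw [Matrix.mul_smul, Matrix.smul_mul, Matrix.mul_assoc, (commute_Y1_psiGL k).eq,
    ← Matrix.mul_assoc, h, Matrix.one_mul]

section

variable {B₆ : (Fin 26 → ℝ) → GL I27 ℂ} {B₄ : (Fin 16 → ℝ) → GL I27 ℂ} {B₉ : (Fin 8 → ℝ) → GL I27 ℂ}

variable (B₆ B₄ B₉) in
/-- The Euler parametrization without the factor `e^V`. -/
def eulerU (x : Coord) : GL I56 ℂ :=
  expGL (x.1 • Y1) * psiGL (B₆ x.2.1) * psiGL (B₄ x.2.2.1) * psiGL (B₉ x.2.2.2.1)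

theorem eulerU_mem (h₆ : ∀ a, B₆ a ∈ expGroup lieE6)
    (h₄ : ∀ b, B₄ b ∈ expGroup lieF4) (h₉ : ∀ c, B₉ c ∈ expGroup lieSO9) (x : Coord) :
    eulerU B₆ B₄ B₉ x ∈ expGroup lieU := by
  have hU : psi '' lieE6 ⊆ lieU := by
    rintro _ ⟨X, hX, rfl⟩
    exact ⟨0, X, hX, by rw [zero_smul, zero_add]⟩
  have hψ {k : GL I27 ℂ} (hk : k ∈ expGroup lieE6) : psiGL k ∈ expGroup lieU :=
    expGroup_mono hU (psiGL_mem_expGroup hk)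
  exact mul_mem (mul_mem (mul_mem (mem_expGroup
    ⟨_, 0, lieF4_subset_lieE6 zero_mem_lieF4, by rw [psi_zero, add_zero]⟩) (hψ (h₆ _)))
    (hψ (expGroup_mono lieF4_subset_lieE6 (h₄ _))))
    (hψ (expGroup_mono (lieSO9_subset_lieF4.trans lieF4_subset_lieE6) (h₉ _)))

theorem matDiffAt_eulerU (h₆ : ∀ a, MatDiffAt B₆ a)
    (h₄ : ∀ b, MatDiffAt B₄ b) (h₉ : ∀ c, MatDiffAt B₉ c) (x : Coord) :
    MatDiffAt (eulerU B₆ B₄ B₉) x := by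
  refine MatDiffAt.mul (MatDiffAt.mul (MatDiffAt.mul ?_ ?_) ?_) ?_
  · exact (matDiffAt_expGL_smul Y1 x.1).comp (f := fun x : Coord => x.1) (by fun_prop)
  · exact (h₆ x.2.1).psiGL.comp (f := fun x : Coord => x.2.1) (by fun_prop)
  · exact (h₄ x.2.2.1).psiGL.comp (f := fun x : Coord => x.2.2.1) (by fun_prop)
  · exact (h₉ x.2.2.2.1).psiGL.comp (f := fun x : Coord => x.2.2.2.1) (by fun_prop)

theorem euler_mem (h₆ : ∀ a, B₆ a ∈ expGroup lieE6)
    (h₄ : ∀ b, B₄ b ∈ expGroup lieF4) (h₉ : ∀ c, B₉ c ∈ expGroup lieSO9) (x : Coord) :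
    euler B₆ B₄ B₉ x ∈ expGroup lieE7 := by
  refine mul_mem (expGroup_mono lieU_subset_lieE7 (eulerU_mem h₆ h₄ h₉ x)) (mem_expGroup ?_)
  rw [cartanV_eq]
  exact pI_mem_lieE7 _

theorem matDiffAt_euler (h₆ : ∀ a, MatDiffAt B₆ a)
    (h₄ : ∀ b, MatDiffAt B₄ b) (h₉ : ∀ c, MatDiffAt B₉ c) (x : Coord) :
    MatDiffAt (euler B₆ B₄ B₉) x :=
  (matDiffAt_eulerU h₆ h₄ h₉ x).mul
    ((matDiffAt_expGL_cartanV x.2.2.2.2).comp (f := fun x : Coord => x.2.2.2.2) (by fun_prop))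

/-- Each factor of the product is conjugated by the factors to its right; `Y₁` commutes with all of
them. -/
theorem current_eulerU (h₆ : ∀ a, MatDiffAt B₆ a)
    (h₄ : ∀ b, MatDiffAt B₄ b) (h₉ : ∀ c, MatDiffAt B₉ c) (x w : Coord) :
    current (eulerU B₆ B₄ B₉) x w = w.1 • Y1 +
      (psiGL (B₄ x.2.2.1) * psiGL (B₉ x.2.2.2.1))⁻¹.val *
        current (fun s => psiGL (B₆ s)) x.2.1 w.2.1 *
        (psiGL (B₄ x.2.2.1) * psiGL (B₉ x.2.2.2.1)).val +
      (psiGL (B₉ x.2.2.2.1))⁻¹.val * current (fun s => psiGL (B₄ s)) x.2.2.1 w.2.2.1 *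
        (psiGL (B₉ x.2.2.2.1)).val +
      current (fun s => psiGL (B₉ s)) x.2.2.2.1 w.2.2.2.1 := by
  have d1 : DifferentiableAt ℝ (fun x : Coord => x.1) x := by fun_prop
  have d2 : DifferentiableAt ℝ (fun x : Coord => x.2.1) x := by fun_prop
  have d3 : DifferentiableAt ℝ (fun x : Coord => x.2.2.1) x := by fun_prop
  have d4 : DifferentiableAt ℝ (fun x : Coord => x.2.2.2.1) x := by fun_prop
  have f1 : fderiv ℝ (fun x : Coord => x.1) x w = w.1 := by
    rw [(hasFDerivAt_fst (𝕜 := ℝ) (p := x)).fderiv]; rfl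
  have f2 : fderiv ℝ (fun x : Coord => x.2.1) x w = w.2.1 := by
    rw [(hasFDerivAt_snd (𝕜 := ℝ) (p := x)).fst.fderiv]; rfl
  have f3 : fderiv ℝ (fun x : Coord => x.2.2.1) x w = w.2.2.1 := by
    rw [(hasFDerivAt_snd (𝕜 := ℝ) (p := x)).snd.fst.fderiv]; rfl
  have f4 : fderiv ℝ (fun x : Coord => x.2.2.2.1) x w = w.2.2.2.1 := by
    rw [(hasFDerivAt_snd (𝕜 := ℝ) (p := x)).snd.snd.fst.fderiv]; rfl
  have m1 := (matDiffAt_expGL_smul Y1 x.1).comp d1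
  have m2 := (h₆ x.2.1).psiGL.comp (f := fun x : Coord => x.2.1) d2
  have m3 := (h₄ x.2.2.1).psiGL.comp (f := fun x : Coord => x.2.2.1) d3
  have m4 := (h₉ x.2.2.2.1).psiGL.comp (f := fun x : Coord => x.2.2.2.1) d4
  have c1 := current_comp (matDiffAt_expGL_smul Y1 x.1) d1 w
  have c2 := current_comp (f := fun x : Coord => x.2.1) (h₆ x.2.1).psiGL d2 w
  have c3 := current_comp (f := fun x : Coord => x.2.2.1) (h₄ x.2.2.1).psiGL d3 w
  have c4 := current_comp (f := fun x : Coord => x.2.2.2.1) (h₉ x.2.2.2.1).psiGL d4 w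
  rw [f1, current_expGL_smul] at c1
  rw [f2] at c2
  rw [f3] at c3
  rw [f4] at c4
  have h : eulerU B₆ B₄ B₉ = fun x => expGL (x.1 • Y1) * psiGL (B₆ x.2.1) * psiGL (B₄ x.2.2.1) *
    psiGL (B₉ x.2.2.2.1) := rfl
  rw [h, current_mul ((m1.mul m2).mul m3) m4, current_mul (m1.mul m2) m3, current_mul m1 m2, c1, c2,
    c3, c4, Y1_conj_psiGL]
  simp only [Matrix.mul_add, Matrix.add_mul, Y1_conj_psiGL]
  simp only [_root_.mul_inv_rev, Units.val_mul, Matrix.mul_assoc]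

theorem current_euler (h₆ : ∀ a, MatDiffAt B₆ a)
    (h₄ : ∀ b, MatDiffAt B₄ b) (h₉ : ∀ c, MatDiffAt B₉ c) (x w : Coord) :
    current (euler B₆ B₄ B₉) x w =
      (expGL (cartanV x.2.2.2.2))⁻¹.val * current (eulerU B₆ B₄ B₉) x w *
        (expGL (cartanV x.2.2.2.2)).val + cartanV w.2.2.2.2 := by
  have d5 : DifferentiableAt ℝ (fun x : Coord => x.2.2.2.2) x := by fun_prop
  have f5 : fderiv ℝ (fun x : Coord => x.2.2.2.2) x w = w.2.2.2.2 := by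
    rw [(hasFDerivAt_snd (𝕜 := ℝ) (p := x)).snd.snd.snd.fderiv]; rfl
  have c5 := current_comp (f := fun x : Coord => x.2.2.2.2)
    (matDiffAt_expGL_cartanV x.2.2.2.2) d5 w
  rw [f5, current_expGL_cartanV] at c5
  have h : euler B₆ B₄ B₉ = fun x => eulerU B₆ B₄ B₉ x * expGL (cartanV x.2.2.2.2) := rfl
  rw [h, current_mul (matDiffAt_eulerU h₆ h₄ h₉ x) ((matDiffAt_expGL_cartanV _).comp (f := fun x : Coord => x.2.2.2.2) d5), c5]

end

/-! ### Factorization of the determinant -/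

theorem absDet_of_zero₂₁ {κ₁ κ₂ ι₁ ι₂ : Type} [Fintype κ₁] [Fintype κ₂] [Fintype ι₁]
    [Fintype ι₂] [DecidableEq ι₁] [DecidableEq ι₂] (M : Matrix (κ₁ ⊕ κ₂) (ι₁ ⊕ ι₂) ℝ)
    (h : ∀ k i, M (Sum.inr k) (Sum.inl i) = 0) (e₁ : ι₁ ≃ κ₁) (e₂ : ι₂ ≃ κ₂) :
    absDet M = absDet M.toBlocks₁₁ * absDet M.toBlocks₂₂ := by
  have h0 : M.toBlocks₂₁ = 0 := by ext k i; exact h k i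
  conv_lhs => rw [← fromBlocks_toBlocks M, h0]
  exact absDet_fromBlocks_zero _ _ _ e₁ e₂

theorem absDet_of_zero₁₂ {κ₁ κ₂ ι₁ ι₂ : Type} [Fintype κ₁] [Fintype κ₂] [Fintype ι₁]
    [Fintype ι₂] [DecidableEq ι₁] [DecidableEq ι₂] (M : Matrix (κ₁ ⊕ κ₂) (ι₁ ⊕ ι₂) ℝ)
    (h : ∀ k i, M (Sum.inl k) (Sum.inr i) = 0) (e₁ : ι₁ ≃ κ₁) (e₂ : ι₂ ≃ κ₂) :
    absDet M = absDet M.toBlocks₁₁ * absDet M.toBlocks₂₂ := by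
  rw [← absDet_submatrix M (Equiv.sumComm _ _) (Equiv.sumComm _ _),
    absDet_of_zero₂₁ _ (fun k i => h k i) e₂ e₁, mul_comm]
  rfl

theorem lie_psi_psi (X Y : Matrix I27 I27 ℂ) : ⁅psi X, psi Y⁆ = psi (X * Y - Y * X) := by
  rw [Ring.lie_def, psi, psi, psi]
  simp only [fromBlocks_multiply, Matrix.mul_zero, Matrix.zero_mul, add_zero, zero_add,
    sub_eq_add_neg, fromBlocks_neg, fromBlocks_add, neg_zero, transpose_add, transpose_neg,
    transpose_mul, Matrix.neg_mul, Matrix.mul_neg, neg_neg, neg_add]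
  congr 2
  exact add_comm _ _

theorem lie_psi_toC_psi_toC (M N : Matrix I27 I27 ℝ) :
    ⁅psi (toC M), psi (toC N)⁆ = psi (toC (M * N - N * M)) := by
  rw [lie_psi_psi, ← toC_mul, ← toC_mul]
  congr 1
  exact (map_sub cM _ _).symm

theorem lie_psi_toC_psiL {D : Matrix I27 I27 ℝ} (hD : IsDerivation D) (y : I27 → ℝ) :
    ⁅psi (toC D), psiL y⁆ = psiL (D *ᵥ y) := by
  have h : toC (D * Lm y - Lm y * D) = toC D * toC (Lm y) - toC (Lm y) * toC D := by
    rw [← toC_mul, ← toC_mul]; exact map_sub cM _ _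
  rw [psiL, lie_psi_psi, psiL, ← hD.commutator_Lm, h, Matrix.mul_smul, Matrix.smul_mul, ← smul_sub]

/-- The coordinate along the last basis element is a multiple of the trace, so a traceless `y`
involves only the first 26. -/
theorem psiL_mem_span {y : I27 → ℝ} (hy : tr y = 0) :
    psiL y ∈ Submodule.span ℝ (Set.range frameE6) := by
  have h0 : y (Sum.inr ()) = 0 := by
    have h1 : dgRow (Sum.inr ()) = √(2 / 3) • 1 := by
      funext i; rw [Pi.smul_apply, Pi.one_apply, smul_eq_mul, mul_one]; fin_cases i <;> rfl
    have h2 := dotProduct_single_one y iOne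
    rw [single_iOne, h1, dg_smul, dg_one, dotProduct_smul, dot_jone, hy] at h2
    simpa using h2.symm
  have h : y = ∑ a : I26, y (Sum.inl a) • Pi.single (Sum.inl a) (1 : ℝ) := by
    conv_lhs => rw [eq_sum_single y]
    rw [Fintype.sum_sum_type, Finset.univ_unique (α := Unit), Finset.sum_singleton,
      PUnit.default_eq_unit, h0, zero_smul, add_zero]
  rw [h]
  change psiLₗ _ ∈ _
  rw [map_sum]
  refine Submodule.sum_mem _ fun a _ => ?_
  rw [map_smul]
  exact Submodule.smul_mem _ _ (Submodule.subset_span ⟨a, frameE6_eq a⟩)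

theorem lie_mem_span_frameE6 {S : Matrix I56 I56 ℂ} (hS : S ∈ psi '' lieF4) {X : Matrix I56 I56 ℂ}
    (hX : X ∈ Submodule.span ℝ (Set.range frameE6)) :
    ⁅S, X⁆ ∈ Submodule.span ℝ (Set.range frameE6) := by
  obtain ⟨_, ⟨D, hD, rfl⟩, rfl⟩ := hS
  obtain ⟨y, rfl⟩ := (Submodule.mem_span_range_iff_exists_fun ℝ).mp hX
  have h : ∑ a, y a • frameE6 a = psiL (∑ a, y a • Pi.single (Sum.inl a) 1) := by
    change _ = psiLₗ _
    simp only [map_sum, map_smul, frameE6_eq]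
    rfl
  rw [h, lie_psi_toC_psiL hD]
  exact psiL_mem_span (hD.tr_mulVec _)

/-- The span is the orthogonal complement of `Lie(SO(9))` in `Lie(F₄)`, and invariance of `ip`
carries it to itself under brackets with `Lie(SO(9))`. -/
theorem lie_mem_span_frameF4 {S : Matrix I56 I56 ℂ} (hS : S ∈ psi '' lieSO9)
    {X : Matrix I56 I56 ℂ} (hX : X ∈ Submodule.span ℝ (Set.range frameF4)) :
    ⁅S, X⁆ ∈ Submodule.span ℝ (Set.range frameF4) := by
  obtain ⟨_, ⟨D, hD, hD0, rfl⟩, rfl⟩ := hS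
  rw [← SetLike.mem_coe, isOrthoFrame_frameF4.2] at hX ⊢
  obtain ⟨⟨_, ⟨D', hD', rfl⟩, rfl⟩, hX⟩ := hX
  refine ⟨?_, fun Z hZ => ?_⟩
  · rw [lie_psi_toC_psi_toC]
    exact mem_psi_image_lieF4 (hD.commutator hD')
  · rw [ip_lie, hX, neg_zero]
    obtain ⟨_, ⟨D'', hD'', hD0'', rfl⟩, rfl⟩ := hZ
    rw [lie_psi_toC_psi_toC]
    refine ⟨_, ⟨_, hD.commutator hD'', ?_, rfl⟩, rfl⟩
    rw [sub_mulVec, ← mulVec_mulVec, ← mulVec_mulVec, hD0, hD0'', mulVec_zero, mulVec_zero, sub_zero]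

/-- The index set of the coordinates, with the frames of the factors. -/
abbrev FactorIdx := Unit ⊕ I26 ⊕ (Fin 2 × Fin 8) ⊕ Fin 8 ⊕ Fin 3

theorem coordBasis_phase : coordBasis (Sum.inl ()) = (1, 0, 0, 0, 0) := by
  simp [coordBasis, Module.Basis.prod_apply, Prod.ext_iff]

theorem coordBasis_E6 (i : Fin 26) :
    coordBasis (Sum.inr (Sum.inl i)) = (0, Pi.basisFun ℝ (Fin 26) i, 0, 0, 0) := by
  simp [coordBasis, Module.Basis.prod_apply, Prod.ext_iff]

theorem coordBasis_F4 (i : Fin 16) :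
    coordBasis (Sum.inr (Sum.inr (Sum.inl i))) = (0, 0, Pi.basisFun ℝ (Fin 16) i, 0, 0) := by
  simp [coordBasis, Module.Basis.prod_apply, Prod.ext_iff]

theorem coordBasis_SO9 (i : Fin 8) :
    coordBasis (Sum.inr (Sum.inr (Sum.inr (Sum.inl i)))) =
      (0, 0, 0, Pi.basisFun ℝ (Fin 8) i, 0) := by
  simp [coordBasis, Module.Basis.prod_apply, Prod.ext_iff]

theorem coordBasis_cartan (i : Fin 3) :
    coordBasis (Sum.inr (Sum.inr (Sum.inr (Sum.inr i)))) =
      (0, 0, 0, 0, Pi.basisFun ℝ (Fin 3) i) := by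
  simp [coordBasis, Module.Basis.prod_apply, Prod.ext_iff]

theorem current_zero {E : Type} [NormedAddCommGroup E] [NormedSpace ℝ E] (σ : E → GL I56 ℂ) (p : E) :
    current σ p 0 = 0 := (currentₗ σ p).map_zero

section

variable {B₆ : (Fin 26 → ℝ) → GL I27 ℂ} {B₄ : (Fin 16 → ℝ) → GL I27 ℂ} {B₉ : (Fin 8 → ℝ) → GL I27 ℂ}

variable (B₆ B₄ B₉) in
/-- The components of the current of `eulerU` along the frames of the factors, together with the
coordinates `x₅₂, x₅₃, x₅₄`. -/
def factorForm (x : Coord) : FactorIdx → Coord → ℝ :=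
  Sum.elim (fun _ w => ip Y1 (current (eulerU B₆ B₄ B₉) x w)) <|
  Sum.elim (fun a w => ip (frameE6 a) (current (eulerU B₆ B₄ B₉) x w)) <|
  Sum.elim (fun q w => ip (frameF4 q) (current (eulerU B₆ B₄ B₉) x w)) <|
  Sum.elim (fun k w => ip (frameSO9 k) (current (eulerU B₆ B₄ B₉) x w)) fun j w => w.2.2.2.2 j

theorem frame_mem {κ : Type} [DecidableEq κ] {𝔨 𝔥 : Set (Matrix I56 I56 ℂ)}
    {Y : κ → Matrix I56 I56 ℂ} (h : IsOrthoFrame 𝔨 𝔥 Y) (k : κ) :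
    Y k ∈ 𝔨 ∧ ∀ Z ∈ 𝔥, ip (Y k) Z = 0 := by
  have := (Set.ext_iff.mp h.2 (Y k)).mp (Submodule.subset_span ⟨k, rfl⟩)
  exact this

/-- This removes the conjugation by the later factors from the density of each factor of the Euler
product. -/
theorem absDet_conj {κ ι : Type} [Fintype κ] [DecidableEq κ] [Fintype ι] [DecidableEq ι]
    {Y : κ → Matrix I56 I56 ℂ} (hY : ∀ k l, ip (Y k) (Y l) = if k = l then 1 else 0)
    {𝔥 : Set (Matrix I56 I56 ℂ)} (h : ∀ S ∈ 𝔥, ∀ X ∈ Submodule.span ℝ (Set.range Y),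
      ⁅S, X⁆ ∈ Submodule.span ℝ (Set.range Y)) {g : GL I56 ℂ} (hg : g ∈ expGroup 𝔥)
    (J : ι → Matrix I56 I56 ℂ) :
    absDet (of fun k i => ip (Y k) (g⁻¹.val * J i * g.val)) =
      absDet (of fun k i => ip (Y k) (J i)) := by
  obtain ⟨R, hR, hk⟩ := exists_rotation hY (g := g) fun k =>
    expGroup_conj_mem h hg (Submodule.subset_span ⟨k, rfl⟩)
  rw [← absDet_mul_left hR (of fun k i => ip (Y k) (J i))]
  congr 1
  ext k i
  rw [of_apply, hk, mul_apply]
  rfl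

/-- In the order `Y₁`, `E₆`, `F₄`, `SO(9)`, `V` the matrix is block triangular. The column of `Y₁`
is zero below the corner. Among the remaining blocks, the current of a smaller group is orthogonal
to the frames of the larger ones. -/
theorem absDet_factorForm (h₆ : ∀ a, MatDiffAt B₆ a)
    (h₄ : ∀ b, B₄ b ∈ expGroup lieF4 ∧ MatDiffAt B₄ b)
    (h₉ : ∀ c, B₉ c ∈ expGroup lieSO9 ∧ MatDiffAt B₉ c) (x : Coord) :
    absDet (of fun m i => factorForm B₆ B₄ B₉ x m (coordBasis i)) =
      density (Pi.basisFun ℝ (Fin 26)) frameE6 (fun s => psiGL (B₆ s)) x.2.1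
        * density (Pi.basisFun ℝ (Fin 16)) frameF4 (fun s => psiGL (B₄ s)) x.2.2.1
        * density (Pi.basisFun ℝ (Fin 8)) frameSO9 (fun s => psiGL (B₉ s)) x.2.2.2.1 := by
  have hJ := current_eulerU h₆ (fun b => (h₄ b).2) (fun c => (h₉ c).2) x
  set P₄ := psiGL (B₄ x.2.2.1)
  set P₉ := psiGL (B₉ x.2.2.2.1)
  have hP₄ : P₄ ∈ expGroup (psi '' lieF4) := psiGL_mem_expGroup (h₄ _).1
  have hP₉ : P₉ ∈ expGroup (psi '' lieSO9) := psiGL_mem_expGroup (h₉ _).1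
  have hP₉' : P₉ ∈ expGroup (psi '' lieF4) :=
    expGroup_mono (Set.image_mono lieSO9_subset_lieF4) hP₉
  -- The conjugate of the current of `B₄` by a fixed element of `SO(9)` is the current of the
  -- translated map, which is again `F₄`-valued; so it is given by a derivation.
  have c4 (w : Fin 16 → ℝ) : ∃ D, IsDerivation D ∧
      P₉⁻¹.val * current (fun s => psiGL (B₄ s)) x.2.2.1 w * P₉.val = psi (toC D) := by
    have hm : MatDiffAt (fun s => B₄ s * B₉ x.2.2.2.1) x.2.2.1 :=
      (h₄ _).2.mul (matDiffAt_const _ _)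
    have h1 := current_psiGL hm w
    obtain ⟨D, hD, h2⟩ := lieF4_current_mem hm (fun q => mul_mem (h₄ q).1
      (expGroup_mono lieSO9_subset_lieF4 (h₉ _).1)) w
    rw [h2] at h1
    refine ⟨D, hD, ?_⟩
    rw [← h1]
    simp only [psiGL_mul]
    rw [current_mul (h₄ _).2.psiGL (matDiffAt_const _ _), current_const, add_zero]
  have c9 (w : Fin 8 → ℝ) :
      current (fun s => psiGL (B₉ s)) x.2.2.2.1 w ∈ psi '' lieSO9 := by
    rw [current_psiGL (h₉ _).2]
    exact ⟨_, lieSO9_current_mem (h₉ _).2 (fun q => (h₉ q).1) w, rfl⟩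
  have hF4 (q : Fin 2 × Fin 8) : ∃ D, frameF4 q = psi (toC D) := ⟨_, frameF4_eq q.1 q.2⟩
  have hSO9 (k : Fin 8) : ∃ D, frameSO9 k = psi (toC D) := ⟨_, frameSO9_eq k⟩
  have hzero (g : GL I56 ℂ) : g⁻¹.val * 0 * g.val = 0 := by
    rw [Matrix.mul_zero, Matrix.zero_mul]
  have J1 : current (eulerU B₆ B₄ B₉) x (coordBasis (Sum.inl ())) = Y1 := by
    simp only [hJ, coordBasis_phase, current_zero, hzero, add_zero, one_smul]
  have J2 (i) : current (eulerU B₆ B₄ B₉) x (coordBasis (Sum.inr (Sum.inl i))) =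
      (P₄ * P₉)⁻¹.val * current (fun s => psiGL (B₆ s)) x.2.1 (Pi.basisFun ℝ (Fin 26) i) *
        (P₄ * P₉).val := by
    simp only [hJ, coordBasis_E6, current_zero, hzero, add_zero, zero_add, zero_smul]
  have J3 (i) : current (eulerU B₆ B₄ B₉) x (coordBasis (Sum.inr (Sum.inr (Sum.inl i)))) =
      P₉⁻¹.val * current (fun s => psiGL (B₄ s)) x.2.2.1 (Pi.basisFun ℝ (Fin 16) i) * P₉.val := by
    simp only [hJ, coordBasis_F4, current_zero, hzero, add_zero, zero_add, zero_smul]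
  have J4 (i) : current (eulerU B₆ B₄ B₉) x (coordBasis (Sum.inr (Sum.inr (Sum.inr (Sum.inl i))))) =
      current (fun s => psiGL (B₉ s)) x.2.2.2.1 (Pi.basisFun ℝ (Fin 8) i) := by
    simp only [hJ, coordBasis_SO9, current_zero, hzero, add_zero, zero_add, zero_smul]
  have J5 (i) : current (eulerU B₆ B₄ B₉) x (coordBasis (Sum.inr (Sum.inr (Sum.inr (Sum.inr i))))) =
      0 := by
    simp only [hJ, coordBasis_cartan, current_zero, hzero, add_zero, zero_smul]
  have e26 : Fin 26 ≃ I26 := Fintype.equivOfCardEq (by simp)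
  have e16 : Fin 16 ≃ Fin 2 × Fin 8 := Fintype.equivOfCardEq (by simp)
  set N : Matrix FactorIdx _ ℝ := of fun m i => factorForm B₆ B₄ B₉ x m (coordBasis i)
  have hone (κ : Type) [Fintype κ] [DecidableEq κ] (M : Matrix κ κ ℝ)
      (h : ∀ i j, M i j = if i = j then 1 else 0) : absDet M = 1 := by
    rw [show M = diagonal fun _ => 1 by ext i j; rw [h, diagonal_apply], absDet_diagonal]
    simp
  have A1 : absDet N.toBlocks₁₁ = 1 := hone _ _ fun _ _ => by
    rw [if_pos (Subsingleton.elim _ _)]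
    change ip Y1 (current (eulerU B₆ B₄ B₉) x (coordBasis (Sum.inl ()))) = 1
    rw [J1, ip_Y1_Y1]
  have A2 : absDet N.toBlocks₂₂.toBlocks₁₁ =
      density (Pi.basisFun ℝ (Fin 26)) frameE6 (fun s => psiGL (B₆ s)) x.2.1 := by
    rw [density, ← absDet_conj isOrthoFrame_frameE6.1 (fun S hS X hX => lie_mem_span_frameE6 hS hX)
      (mul_mem hP₄ hP₉')]
    refine congrArg absDet (Matrix.ext fun k i => ?_)
    rw [of_apply, ← J2]
    rfl
  have A3 : absDet N.toBlocks₂₂.toBlocks₂₂.toBlocks₁₁ =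
      density (Pi.basisFun ℝ (Fin 16)) frameF4 (fun s => psiGL (B₄ s)) x.2.2.1 := by
    rw [density, ← absDet_conj isOrthoFrame_frameF4.1 (fun S hS X hX => lie_mem_span_frameF4 hS hX)
      hP₉]
    refine congrArg absDet (Matrix.ext fun k i => ?_)
    rw [of_apply, ← J3]
    rfl
  have A4 : absDet N.toBlocks₂₂.toBlocks₂₂.toBlocks₂₂.toBlocks₁₁ =
      density (Pi.basisFun ℝ (Fin 8)) frameSO9 (fun s => psiGL (B₉ s)) x.2.2.2.1 := by
    rw [density]
    refine congrArg absDet (Matrix.ext fun k i => ?_)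
    rw [of_apply, ← J4]
    rfl
  have A5 : absDet N.toBlocks₂₂.toBlocks₂₂.toBlocks₂₂.toBlocks₂₂ = 1 := hone _ _ fun j i => by
    change (coordBasis (Sum.inr (Sum.inr (Sum.inr (Sum.inr i))))).2.2.2.2 j = _
    rw [coordBasis_cartan, Pi.basisFun_apply]
    exact Pi.single_apply i 1 j
  -- The blocks are split off one at a time. The first is lower-left zero and the others upper-right
  -- zero, so the components of the `E₆` current along `Y₁` and along the smaller frames never have
  -- to be computed.
  rw [absDet_of_zero₂₁ N ?_ (Equiv.refl _) (e26.sumCongr (e16.sumCongr (Equiv.refl _))),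
    absDet_of_zero₁₂ N.toBlocks₂₂ ?_ e26 (e16.sumCongr (Equiv.refl _)),
    absDet_of_zero₁₂ N.toBlocks₂₂.toBlocks₂₂ ?_ e16 (Equiv.refl _),
    absDet_of_zero₁₂ N.toBlocks₂₂.toBlocks₂₂.toBlocks₂₂ ?_ (Equiv.refl _) (Equiv.refl _),
    A1, A2, A3, A4, A5]
  · ring
  · intro k i
    change ip (frameSO9 k) (current _ x (coordBasis (Sum.inr (Sum.inr (Sum.inr (Sum.inr i)))))) = 0
    rw [J5, ip_zero_right]
  · rintro q (i | i)
    · change ip (frameF4 q) (current _ x (coordBasis (Sum.inr (Sum.inr (Sum.inr (Sum.inl i)))))) = 0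
      rw [J4]
      exact (frame_mem isOrthoFrame_frameF4 q).2 _ (c9 _)
    · change ip (frameF4 q) (current _ x (coordBasis (Sum.inr (Sum.inr (Sum.inr (Sum.inr i)))))) = 0
      rw [J5, ip_zero_right]
  · rintro a (i | i | i)
    · change ip (frameE6 a) (current _ x (coordBasis (Sum.inr (Sum.inr (Sum.inl i))))) = 0
      obtain ⟨D, -, hD⟩ := c4 (Pi.basisFun ℝ (Fin 16) i)
      rw [J3, hD, frameE6_eq, ip_psiL_psi_toC]
    · change ip (frameE6 a) (current _ x (coordBasis (Sum.inr (Sum.inr (Sum.inr (Sum.inl i)))))) = 0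
      obtain ⟨_, ⟨D, -, -, rfl⟩, hD⟩ := c9 (Pi.basisFun ℝ (Fin 8) i)
      rw [J4, ← hD, frameE6_eq, ip_psiL_psi_toC]
    · change ip (frameE6 a) (current _ x (coordBasis (Sum.inr (Sum.inr (Sum.inr (Sum.inr i)))))) = 0
      rw [J5, ip_zero_right]
  · rintro (a | q | k | j) ⟨⟩
    · change ip (frameE6 a) (current _ x (coordBasis (Sum.inl ()))) = 0
      rw [J1, ip_comm, frameE6_eq, ip_Y1_psiL (tr_single_inl a)]
    · change ip (frameF4 q) (current _ x (coordBasis (Sum.inl ()))) = 0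
      obtain ⟨D, hD⟩ := hF4 q
      rw [J1, ip_comm, hD, ip_Y1_psi_toC]
    · change ip (frameSO9 k) (current _ x (coordBasis (Sum.inl ()))) = 0
      obtain ⟨D, hD⟩ := hSO9 k
      rw [J1, ip_comm, hD, ip_Y1_psi_toC]
    · change (coordBasis (Sum.inl ())).2.2.2.2 j = 0
      rw [coordBasis_phase]
      rfl

end

/-! ### The sine factors, and the comparison of the frame of 𝔭 with the frames of the factors. -/

/-- The common index set of the frame of `Lie(E₇) ⊖ Lie(U)` and of the frames of the factors. -/
abbrev PairIdx := (Fin 2 ⊕ Unit) ⊕ (Fin 3 × Fin 8) ⊕ (Fin 2 × Fin 8) ⊕ Fin 8 ⊕ Fin 3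

/-- The correspondence of the common index set with the frames of the factors. -/
def factorIdx : PairIdx → FactorIdx
  | Sum.inl (Sum.inl s) => Sum.inr (Sum.inl (Sum.inl s))
  | Sum.inl (Sum.inr _) => Sum.inl ()
  | Sum.inr (Sum.inl q) => Sum.inr (Sum.inl (Sum.inr q))
  | Sum.inr (Sum.inr r) => Sum.inr (Sum.inr r)

/-- The correspondence of the common index set with the frame of `Lie(E₇) ⊖ Lie(U)`. -/
def frameIdx : PairIdx → Fin 2 × I27
  | Sum.inl (Sum.inl s) => (1, iDiag s)
  | Sum.inl (Sum.inr _) => (1, iOne)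
  | Sum.inr (Sum.inl q) => (1, iOff q.1 q.2)
  | Sum.inr (Sum.inr (Sum.inl q)) => (0, iOff q.1.castSucc q.2)
  | Sum.inr (Sum.inr (Sum.inr (Sum.inl k))) => (0, iOff 2 k)
  | Sum.inr (Sum.inr (Sum.inr (Sum.inr j))) => (0, ![iOne, iDiag 0, iDiag 1] j)

theorem factorIdx_bijective : Function.Bijective factorIdx := by
  rw [Fintype.bijective_iff_injective_and_card]
  refine ⟨?_, by simp⟩
  rintro ((s | ⟨⟩) | q | r) ((s' | ⟨⟩) | q' | r') h <;> simp [factorIdx] at h ⊢ <;> exact h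

theorem frameIdx_bijective : Function.Bijective frameIdx := by
  rw [Fintype.bijective_iff_injective_and_card]
  refine ⟨?_, by simp⟩
  have h2 (i : Fin 2) : i.castSucc ≠ 2 := Fin.castSucc_ne_last i
  have hj (j : Fin 3) : ![iOne, iDiag 0, iDiag 1] j = iOne ∨ ∃ s, ![iOne, iDiag 0, iDiag 1] j = iDiag s := by
    fin_cases j <;> simp
  have hinj : Function.Injective (![iOne, iDiag 0, iDiag 1]) := by
    intro j j' h
    fin_cases j <;> fin_cases j' <;> simp [iOne, iDiag] at h ⊢
  have hjo (j : Fin 3) (s : Fin 3) (k : Fin 8) : iOff s k ≠ ![iOne, iDiag 0, iDiag 1] j := by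
    rcases hj j with h | ⟨t, h⟩ <;> rw [h] <;> simp [iOne, iDiag, iOff]
  rintro ((s | ⟨⟩) | ⟨s, k⟩ | ⟨i, k⟩ | k | j) ((s' | ⟨⟩) | ⟨s', k'⟩ | ⟨i', k'⟩ | k' | j') h <;>
    simp [frameIdx, iDiag, iOne, iOff, h2, (h2 _).symm] at h ⊢ <;> 
    first | exact h | exact hjo _ _ _ h | exact hjo _ _ _ h.symm | exact hinj h

/-- `factorIdx` as an equivalence. -/
def factorEquiv : PairIdx ≃ FactorIdx := Equiv.ofBijective _ factorIdx_bijective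

/-- `frameIdx` as an equivalence. -/
def frameEquiv : PairIdx ≃ Fin 2 × I27 := Equiv.ofBijective _ frameIdx_bijective

/-- The action of `e^V` from the diagonal part of the frame to the factors. -/
def rootMat (d : Fin 3 → ℝ) : Matrix (Fin 2 ⊕ Unit) (Fin 2 ⊕ Unit) ℝ :=
  of fun β γ => ∑ i, dgRow β i / 2 * Real.sin (d i) * dgRow γ i

/-- The action of `e^V` from the off-diagonal part of the frame to the factors. -/
def rootScale (d : Fin 3 → ℝ) : (Fin 3 × Fin 8) ⊕ (Fin 2 × Fin 8) ⊕ Fin 8 ⊕ Fin 3 → ℝ :=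
  Sum.elim (fun q => Real.sin (halfSum d q.1)) <|
  Sum.elim (fun q => -Real.sin (halfDiff d q.1.castSucc)) <|
  Sum.elim (fun _ => -Real.sin (halfDiff d 2)) fun _ => 1

/-- Up to relabelling, `dgMat / √2` is orthogonal, and the matrix is `diag (sin d_i)` conjugated by
it. -/
theorem absDet_rootMat (d : Fin 3 → ℝ) :
    absDet (rootMat d) = |Real.sin (d 0) * Real.sin (d 1) * Real.sin (d 2)| := by
  have e : Fin 2 ⊕ Unit ≃ Fin 3 := Fintype.equivOfCardEq (by simp)
  have h : rootMat d = ((1 / 2 : ℝ) • dgMat) * (diagonal (fun i => Real.sin (d i)) * dgMatᵀ) := by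
    ext β γ
    rw [rootMat, of_apply, mul_apply]
    refine Finset.sum_congr rfl fun i _ => ?_
    rw [diagonal_mul, Matrix.smul_apply, transpose_apply, smul_eq_mul]
    simp only [dgMat, of_apply]
    ring
  have h1 : absDet ((1 / 2 : ℝ) • dgMat) = √(1 / 8) := by
    rw [absDet, transpose_smul, Matrix.smul_mul, Matrix.mul_smul, transpose_mul_dgMat, smul_smul,
      smul_smul, det_smul, det_one, Fintype.card_fin]
    norm_num
  have h2 : absDet dgMatᵀ = √8 := by
    rw [absDet, transpose_transpose, dgMat_mul_transpose, det_smul, det_one]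
    norm_num
  have h3 : √(1 / 8) * √8 = (1 : ℝ) := by rw [← Real.sqrt_mul (by norm_num)]; norm_num
  rw [h, absDet_mul _ _ e, absDet_mul _ _ e, h1, h2, absDet_diagonal, Fin.prod_univ_three]
  linear_combination |Real.sin (d 0) * Real.sin (d 1) * Real.sin (d 2)| * h3

theorem absDet_rootScale (d : Fin 3 → ℝ) :
    absDet (diagonal (rootScale d)) =
      |∏ s, Real.sin (halfSum d s) ^ 8 * Real.sin (halfDiff d s) ^ 8| := by
  rw [absDet_diagonal, Fintype.prod_sum_type, Fintype.prod_sum_type, Fintype.prod_sum_type,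
    Fintype.prod_prod_type, Fintype.prod_prod_type, Fin.prod_univ_two]
  congr 1
  simp only [rootScale, Fin.prod_univ_three (M := ℝ), Sum.elim_inl, Sum.elim_inr, Finset.prod_const, Finset.card_univ,
    Fintype.card_fin, Even.neg_pow (show Even 8 by decide)]
  simp only [Fin.castSucc_zero, Fin.castSucc_one, one_pow]
  ring

section

variable {B₆ : (Fin 26 → ℝ) → GL I27 ℂ} {B₄ : (Fin 16 → ℝ) → GL I27 ℂ} {B₉ : (Fin 8 → ℝ) → GL I27 ℂ}

/-- Conjugation by `e^V` is moved onto the frame by invariance of `ip`. The cosine terms stay in 𝔭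
and are orthogonal to the current of `eulerU`, which commutes with `Gr`. What is left is the sine of
each root times the component along its partner in `Lie(U)`, and `dV` along the three fixed
directions. -/
theorem ip_frameE7_current_euler (h₆ : ∀ a, B₆ a ∈ expGroup lieE6 ∧ MatDiffAt B₆ a)
    (h₄ : ∀ b, B₄ b ∈ expGroup lieF4 ∧ MatDiffAt B₄ b)
    (h₉ : ∀ c, B₉ c ∈ expGroup lieSO9 ∧ MatDiffAt B₉ c) (x w : Coord) (m : PairIdx) :
    ip (frameE7 (frameIdx m)) (current (euler B₆ B₄ B₉) x w) =
      (fromBlocks (rootMat (cartanD x.2.2.2.2)) 0 0 (diagonal (rootScale (cartanD x.2.2.2.2))) *ᵥ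
        fun m' => factorForm B₆ B₄ B₉ x (factorIdx m') w) m := by
  set d := cartanD x.2.2.2.2
  have hG : Commute Gr (current (eulerU B₆ B₄ B₉) x w) :=
    commute_Gr_current (matDiffAt_eulerU (fun a => (h₆ a).2) (fun b => (h₄ b).2) (fun c => (h₉ c).2) x)
      (Filter.Eventually.of_forall
        (eulerU_mem (fun a => (h₆ a).1) (fun b => (h₄ b).1) fun c => (h₉ c).1)) w
  have hJ (Y : Matrix I56 I56 ℂ) : ip Y (current (euler B₆ B₄ B₉) x w) =
      ip (NormedSpace.exp (pI (dg d)) * Y * NormedSpace.exp (-pI (dg d)))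
        (current (eulerU B₆ B₄ B₉) x w) + ip Y (cartanV w.2.2.2.2) := by
    rw [current_euler (fun a => (h₆ a).2) (fun b => (h₄ b).2) (fun c => (h₉ c).2), ip_add_right,
      ← ip_conj, cartanV_eq]
    rfl
  set J := current (eulerU B₆ B₄ B₉) x w
  have hR (u : I27 → ℝ) : ip (pR u) J = 0 := ip_offDiag_of_commute _ hG
  have hI (u : I27 → ℝ) : ip (pI u) J = 0 := ip_offDiag_of_commute _ hG
  have hoff (s : Fin 3) (k : Fin 8) : Pi.single (iOff s k) 1 = off s k := rfl
  have hβ (β : Fin 2 ⊕ Unit) : ip (pR (dg (dgRow β))) (current (euler B₆ B₄ B₉) x w) =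
      ∑ γ, rootMat d β γ * ip (cartanU γ) J := by
    obtain ⟨u, hu⟩ := exp_conj_pR_dgRow d β
    rw [hJ, hu, ip_add_left, hR, cartanV_eq, ip_pR_pI, zero_add, add_zero, ip_sum_left]
    exact Finset.sum_congr rfl fun γ _ => ip_smul_left _ _ _
  have hf0 (s : Fin 3) (k : Fin 8) : ip (pI (off s k)) (current (euler B₆ B₄ B₉) x w) =
      -Real.sin (halfDiff d s) * ip (psi (toC (fD s k))) J := by
    rw [hJ, exp_conj_pI_off, sub_eq_add_neg, ← neg_smul, ip_add_left, ip_smul_left, ip_smul_left, hI,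
      cartanV_eq, ip_pI_pI, dotProduct_comm, dg_dot_off]
    ring
  have hcart (β : Fin 2 ⊕ Unit) : ip (pI (dg (dgRow β))) (current (euler B₆ B₄ B₉) x w) =
      dg (dgRow β) ⬝ᵥ dg (cartanD w.2.2.2.2) := by
    rw [hJ, exp_conj_pI_dg, hI, cartanV_eq, ip_pI_pI, zero_add]
  have hsplit (f : PairIdx → ℝ) :
      fromBlocks (rootMat d) 0 0 (diagonal (rootScale d)) *ᵥ f =
        Sum.elim (rootMat d *ᵥ (f ∘ Sum.inl)) (diagonal (rootScale d) *ᵥ (f ∘ Sum.inr)) := by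
    rw [fromBlocks_mulVec]; simp
  rw [hsplit]
  have hcU (β : Fin 2 ⊕ Unit) : factorForm B₆ B₄ B₉ x (factorIdx (Sum.inl β)) w = ip (cartanU β) J := by
    rcases β with s | u <;> rfl
  rcases m with β | m
  · have h1 : frameE7 (frameIdx (Sum.inl β)) = pR (dg (dgRow β)) := by
      rcases β with s | u
      · rw [← single_iDiag]; exact frameE7_one _
      · rw [← single_iOne]; exact frameE7_one _
    rw [h1, hβ, Sum.elim_inl, mulVec, dotProduct]
    exact Finset.sum_congr rfl fun γ _ => by rw [Function.comp_apply, hcU]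
  rw [Sum.elim_inr, mulVec_diagonal, Function.comp_apply]
  rcases m with ⟨s, k⟩ | ⟨i, k⟩ | k | j
  · change ip (frameE7 (1, iOff s k)) _ = Real.sin (halfSum d s) * ip (frameE6 (Sum.inr (s, k))) J
    rw [frameE7_one, frameE6_eq, hoff, hJ, exp_conj_pR_off, ip_add_left, ip_smul_left, ip_smul_left, hR,
      cartanV_eq, ip_pR_pI]
    ring
  · change ip (frameE7 (0, iOff i.castSucc k)) _ = -Real.sin (halfDiff d i.castSucc) * ip (frameF4 (i, k)) J
    rw [frameE7_zero, hoff, hf0, frameF4_eq]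
  · change ip (frameE7 (0, iOff 2 k)) _ = -Real.sin (halfDiff d 2) * ip (frameSO9 k) J
    rw [frameE7_zero, hoff, hf0, frameSO9_eq]
  · change ip (frameE7 (0, ![iOne, iDiag 0, iDiag 1] j)) _ = 1 * w.2.2.2.2 j
    have hq (β γ : Fin 2 ⊕ Unit) : dg (dgRow β) ⬝ᵥ dg (dgRow γ) = if β = γ then 1 else 0 := by
      have h := sum_dgRow_mul_dgRow β γ
      rw [Fin.sum_univ_three] at h
      rw [dg_dot_dg, h]
      split_ifs <;> norm_num
    have hw (β : Fin 2 ⊕ Unit) : dg (dgRow β) ⬝ᵥ dg (cartanD w.2.2.2.2) =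
        w.2.2.2.2 0 * (if β = Sum.inr () then 1 else 0) +
          w.2.2.2.2 1 * (if β = Sum.inl 0 then 1 else 0) +
          w.2.2.2.2 2 * (if β = Sum.inl 1 then 1 else 0) := by
      simp only [cartanD, dg_add, dg_smul, dotProduct_add, dotProduct_smul, hq, smul_eq_mul]
    rw [frameE7_zero, one_mul]
    fin_cases j
    · change ip (pI (Pi.single iOne 1)) _ = _
      rw [single_iOne, hcart, hw]; simp
    · change ip (pI (Pi.single (iDiag 0) 1)) _ = _
      rw [single_iDiag, hcart, hw]; simp
    · change ip (pI (Pi.single (iDiag 1) 1)) _ = _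
      rw [single_iDiag, hcart, hw]; simp

/-- The variables `x, y, z` are, up to order and one sign, the diagonal entries of `V`. The
arguments of the sines in `Wxyz` are therefore the restricted roots up to sign. -/
theorem cartanD_eq (v : Fin 3 → ℝ) :
    cartanD v = ![changeVar v 1, -changeVar v 2, changeVar v 0] := by
  have h3 : √3 * √3 = 3 := Real.mul_self_sqrt (by norm_num)
  have h30 : √3 ≠ 0 := by positivity
  have h6 : √6 = √2 * √3 := by rw [← Real.sqrt_mul (by norm_num)]; norm_num
  have h23 : √(2 / 3) = √2 / √3 := Real.sqrt_div (by norm_num) _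
  funext i
  simp only [cartanD, dgRow, Pi.add_apply, Pi.smul_apply, smul_eq_mul, changeVar, h6, h23]
  fin_cases i
  · simp; field_simp; ring
  · simp; field_simp; ring
  · simp; field_simp; rw [show √3 ^ 2 = 3 by rw [sq, h3]]; ring

theorem W_eq (v : Fin 3 → ℝ) :
    W (v 0) (v 1) (v 2) = Wxyz (changeVar v 0) (changeVar v 1) (changeVar v 2) := by
  have h3 : √3 ^ 2 = 3 := Real.sq_sqrt (by norm_num)
  have h30 : √3 ≠ 0 := by positivity
  have h6 : √6 = √2 * √3 := by rw [← Real.sqrt_mul (by norm_num)]; norm_num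
  have hneg (a b : ℝ) (h : a = -b) : Real.sin a ^ 8 = Real.sin b ^ 8 := by
    rw [h, Real.sin_neg, Even.neg_pow (by decide)]
  set x := changeVar v 0 with hx
  set y := changeVar v 1 with hy
  set z := changeVar v 2 with hz
  simp only [changeVar, cons_val_zero, cons_val_one, cons_val, h6] at hx hy hz
  have e1 : (√3 * v 1 + 2 * √2 * v 0 - v 2) / (2 * √3) = (x + y) / 2 := by
    rw [hx, hy]; field_simp; rw [h3]; ring
  have e2 : (√3 * v 1 - 2 * √2 * v 0 + v 2) / (2 * √3) = -((x - z) / 2) := by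
    rw [hx, hz]; field_simp; rw [h3]; ring
  have e3 : (v 1 - √3 * v 2) / 2 = (x + z) / 2 := by
    rw [hx, hz]; field_simp; rw [h3]; linear_combination (-3 * v 2) * h3
  have e4 : (v 1 + √3 * v 2) / 2 = -((x - y) / 2) := by
    rw [hx, hy]; field_simp; rw [h3]; linear_combination (3 * v 2) * h3
  have e5 : (√2 * v 0 + v 2) / √3 = (y - z) / 2 := by
    rw [hy, hz]; field_simp; ring
  have e6 : v 1 = (y + z) / 2 := by
    rw [hy, hz]; field_simp; ring
  rw [W, Wxyz, h6, e1, hneg _ _ e2, e3, hneg _ _ e4, e5, ← hy, ← hz, ← hx, ← e6]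
  ring

theorem abs_W_eq (v : Fin 3 → ℝ) :
    |W (v 0) (v 1) (v 2)| = absDet (rootMat (cartanD v)) * absDet (diagonal (rootScale (cartanD v))) := by
  have hs : ∏ s, Real.sin (halfSum (cartanD v) s) ^ 8 * Real.sin (halfDiff (cartanD v) s) ^ 8 =
      Real.sin ((changeVar v 0 - changeVar v 1) / 2) ^ 8
        * Real.sin ((changeVar v 0 + changeVar v 1) / 2) ^ 8
        * Real.sin ((changeVar v 0 - changeVar v 2) / 2) ^ 8
        * Real.sin ((changeVar v 0 + changeVar v 2) / 2) ^ 8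
        * Real.sin ((changeVar v 1 - changeVar v 2) / 2) ^ 8
        * Real.sin ((changeVar v 1 + changeVar v 2) / 2) ^ 8 := by
    have hneg (a b : ℝ) (h : a = -b) : Real.sin a ^ 8 = Real.sin b ^ 8 := by
      rw [h, Real.sin_neg, Even.neg_pow (by decide)]
    rw [Fin.prod_univ_three, cartanD_eq]
    simp only [halfSum, halfDiff, fstIdx, sndIdx]
    simp
    rw [hneg ((changeVar v 1 - changeVar v 0) / 2) ((changeVar v 0 - changeVar v 1) / 2) (by ring),
      hneg ((-changeVar v 2 - changeVar v 0) / 2) ((changeVar v 0 + changeVar v 2) / 2) (by ring)]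
    ring_nf
  rw [absDet_rootMat, absDet_rootScale, hs, W_eq, Wxyz, cartanD_eq, ← abs_mul]
  simp
  ring_nf

/-- After relabelling the rows, the matrix of the current is the block matrix of sines times the
matrix of the factors; both are square, so `absDet` is multiplicative. -/
theorem density_euler (h₆ : ∀ a, B₆ a ∈ expGroup lieE6 ∧ MatDiffAt B₆ a)
    (h₄ : ∀ b, B₄ b ∈ expGroup lieF4 ∧ MatDiffAt B₄ b)
    (h₉ : ∀ c, B₉ c ∈ expGroup lieSO9 ∧ MatDiffAt B₉ c) (x : Coord) :
    density coordBasis frameE7 (euler B₆ B₄ B₉) x =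
      density (Pi.basisFun ℝ (Fin 26)) frameE6 (fun s => psiGL (B₆ s)) x.2.1
        * density (Pi.basisFun ℝ (Fin 16)) frameF4 (fun s => psiGL (B₄ s)) x.2.2.1
        * density (Pi.basisFun ℝ (Fin 8)) frameSO9 (fun s => psiGL (B₉ s)) x.2.2.2.1
        * |W (x.2.2.2.2 0) (x.2.2.2.2 1) (x.2.2.2.2 2)| := by
  set S := fromBlocks (rootMat (cartanD x.2.2.2.2)) 0 0
    (diagonal (rootScale (cartanD x.2.2.2.2))) with hS
  set N : Matrix FactorIdx (Unit ⊕ Fin 26 ⊕ Fin 16 ⊕ Fin 8 ⊕ Fin 3) ℝ :=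
    of fun m i => factorForm B₆ B₄ B₉ x m (coordBasis i)
  have h : (of fun k i => ip (frameE7 k) (current (euler B₆ B₄ B₉) x (coordBasis i))).submatrix
      frameEquiv (Equiv.refl _) = S * N.submatrix factorEquiv (Equiv.refl _) :=
    Matrix.ext fun m i => ip_frameE7_current_euler h₆ h₄ h₉ x (coordBasis i) m
  have e : Unit ⊕ Fin 26 ⊕ Fin 16 ⊕ Fin 8 ⊕ Fin 3 ≃ PairIdx := Fintype.equivOfCardEq (by simp)
  rw [density, ← absDet_submatrix _ frameEquiv (Equiv.refl _), h, absDet_mul _ _ e,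
    absDet_submatrix, absDet_factorForm (fun a => (h₆ a).2) h₄ h₉, hS,
    absDet_fromBlocks_zero _ _ _ (Equiv.refl _) (Equiv.refl _), abs_W_eq]
  ring

end

/-! ### The invariant measure -/

/-- The derivative need not be continuous: the derivative of any map to a complete space, in a fixed
direction, is measurable. -/
theorem measurable_density {n : ℕ} {κ : Type} [Fintype κ] (Y : κ → Matrix I56 I56 ℂ)
    {σ : (Fin n → ℝ) → GL I56 ℂ} (hσ : ∀ p, MatDiffAt σ p) :
    Measurable (density (Pi.basisFun ℝ (Fin n)) Y σ) := by
  have hc (w : Fin n → ℝ) (i j : I56) : Measurable fun p => current σ p w i j := by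
    simp only [current, mul_apply, of_apply]
    refine Finset.measurable_fun_sum _ fun k _ => Measurable.mul ?_ ?_
    · have h : Differentiable ℝ fun p => (σ p)⁻¹.val i k := fun p => (hσ p).inv i k
      exact h.continuous.measurable
    · exact measurable_fderiv_apply_const ℝ _ w
  have hip (k : κ) (w : Fin n → ℝ) : Measurable fun p => ip (Y k) (current σ p w) := by
    simp only [ip, trace, diag_apply, mul_apply]
    refine Measurable.const_mul (Complex.measurable_re.comp ?_) _
    exact Finset.measurable_fun_sum _ fun i _ => Finset.measurable_fun_sum _ fun j _ =>
      (hc w j i).const_mul _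
  change Measurable fun p => density _ _ _ p
  simp only [density, absDet, det_apply, mul_apply, transpose_apply, of_apply]
  refine Measurable.sqrt (Finset.measurable_fun_sum _ fun π _ => Measurable.const_smul ?_ _)
  exact Finset.measurable_fun_prod _ fun i _ => Finset.measurable_fun_sum _ fun k _ =>
    (hip k _).mul (hip k _)

theorem measurable_abs_W : Measurable fun v : Fin 3 → ℝ => |W (v 0) (v 1) (v 2)| := by
  unfold W
  fun_prop

theorem prod_withDensity_four {α β γ δ : Type} [MeasureSpace α] [MeasureSpace β] [MeasureSpace γ]
    [MeasureSpace δ] [SFinite (volume : Measure α)] [SFinite (volume : Measure β)]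
    [SFinite (volume : Measure γ)] [SFinite (volume : Measure δ)] {f : α → ENNReal}
    {g : β → ENNReal} {h : γ → ENNReal} {k : δ → ENNReal} (hf : Measurable f) (hg : Measurable g)
    (hh : Measurable h) (hk : Measurable k) :
    (volume : Measure ℝ).prod ((volume.withDensity f).prod ((volume.withDensity g).prod
      ((volume.withDensity h).prod (volume.withDensity k)))) =
      (volume : Measure (ℝ × α × β × γ × δ)).withDensity fun x =>
        f x.2.1 * (g x.2.2.1 * (h x.2.2.2.1 * k x.2.2.2.2)) := by
  rw [prod_withDensity hh hk, prod_withDensity hg (by fun_prop), prod_withDensity hf (by fun_prop),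
    prod_withDensity_right (by fun_prop)]
  rfl

theorem densityMeasure_euler {B₆ : (Fin 26 → ℝ) → GL I27 ℂ} {B₄ : (Fin 16 → ℝ) → GL I27 ℂ}
    {B₉ : (Fin 8 → ℝ) → GL I27 ℂ} (h₆ : ∀ a, B₆ a ∈ expGroup lieE6 ∧ MatDiffAt B₆ a)
    (h₄ : ∀ b, B₄ b ∈ expGroup lieF4 ∧ MatDiffAt B₄ b)
    (h₉ : ∀ c, B₉ c ∈ expGroup lieSO9 ∧ MatDiffAt B₉ c) :
    densityMeasure coordBasis frameE7 (euler B₆ B₄ B₉) =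
      (volume : Measure ℝ).prod
        ((densityMeasure (Pi.basisFun ℝ (Fin 26)) frameE6 fun s => psiGL (B₆ s)).prod
          ((densityMeasure (Pi.basisFun ℝ (Fin 16)) frameF4 fun s => psiGL (B₄ s)).prod
            ((densityMeasure (Pi.basisFun ℝ (Fin 8)) frameSO9 fun s => psiGL (B₉ s)).prod
              measureW))) := by
  have m₆ := (measurable_density frameE6 fun a => (h₆ a).2.psiGL).ennreal_ofReal
  have m₄ := (measurable_density frameF4 fun b => (h₄ b).2.psiGL).ennreal_ofReal
  have m₉ := (measurable_density frameSO9 fun c => (h₉ c).2.psiGL).ennreal_ofReal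
  have mW := measurable_abs_W.ennreal_ofReal
  simp only [densityMeasure, measureW]
  rw [prod_withDensity_four m₆ m₄ m₉ mW]
  congr 1
  funext x
  have hn {n : ℕ} {κ : Type} [Fintype κ] (Y : κ → Matrix I56 I56 ℂ) (σ : (Fin n → ℝ) → GL I56 ℂ) p :
      0 ≤ density (Pi.basisFun ℝ (Fin n)) Y σ p := Real.sqrt_nonneg _
  rw [density_euler h₆ h₄ h₉, ENNReal.ofReal_mul (mul_nonneg (mul_nonneg (hn ..) (hn ..)) (hn ..)),
    ENNReal.ofReal_mul (mul_nonneg (hn ..) (hn ..)), ENNReal.ofReal_mul (hn ..)]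
  simp only [mul_assoc]

/-! ### The change of variables -/

theorem map_changeVar : (volume : Measure (Fin 3 → ℝ)).map changeVar =
    ENNReal.ofReal (1 / (2 * √2)) • (volume : Measure (Fin 3 → ℝ)) := by
  let M : Matrix (Fin 3) (Fin 3) ℝ := !![√6 / 3, 0, -2 * √3 / 3; √2 / √3, 1, 1 / √3;
    -√2 / √3, 1, -1 / √3]
  have h3 : √3 * √3 = 3 := Real.mul_self_sqrt (by norm_num)
  have h30 : √3 ≠ 0 := by positivity
  have h6 : √6 = √2 * √3 := by rw [← Real.sqrt_mul (by norm_num)]; norm_num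
  -- The change of variables reverses orientation; only the modulus of the determinant enters the
  -- measure.
  have hdet : M.det = -(2 * √2) := by
    rw [det_fin_three]
    simp [M, h6]
    field_simp
    ring
  have hM : changeVar = toLin' M := by
    funext v i
    rw [toLin'_apply]
    fin_cases i <;> simp [M, changeVar, mulVec, dotProduct, Fin.sum_univ_three] <;> field_simp <;>
      ring
  rw [hM, Real.map_matrix_volume_pi_eq_smul_volume_pi, hdet, abs_inv, abs_neg, abs_of_pos, one_div]
  · positivity
  · rw [hdet]
    simp

theorem Wxyz_nonneg {x y z : ℝ} (hz : 0 ≤ z) (hzy : z ≤ y) (hyx : y ≤ x) (hx : x ≤ Real.pi) :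
    0 ≤ Wxyz x y z := by
  have h1 := Real.sin_nonneg_of_nonneg_of_le_pi hz (hzy.trans (hyx.trans hx))
  have h2 := Real.sin_nonneg_of_nonneg_of_le_pi (hz.trans hzy) (hyx.trans hx)
  have h3 := Real.sin_nonneg_of_nonneg_of_le_pi (hz.trans (hzy.trans hyx)) hx
  have h8 (t : ℝ) : 0 ≤ Real.sin t ^ 8 := Even.pow_nonneg (by decide) _
  have := h8 ((x - y) / 2)
  have := h8 ((x + y) / 2)
  have := h8 ((x - z) / 2)
  have := h8 ((x + z) / 2)
  have := h8 ((y - z) / 2)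
  have := h8 ((y + z) / 2)
  unfold Wxyz
  positivity

end E7

end

theorem mainTheorem2 :
    -- the frames are orthonormal bases of the complements of the subalgebras
    (E7.IsOrthoFrame E7.lieE7 E7.lieU E7.frameE7 ∧
      E7.IsOrthoFrame (E7.psi '' E7.lieE6) (E7.psi '' E7.lieF4) E7.frameE6 ∧
      E7.IsOrthoFrame (E7.psi '' E7.lieF4) (E7.psi '' E7.lieSO9) E7.frameF4 ∧
      E7.IsOrthoFrame (E7.psi '' E7.lieSO9) (E7.psi '' E7.lieSO8) E7.frameSO9) ∧
    -- the density on `E₇ / U` depends only on the map to the quotient, is invariant under `E₇`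
    -- and transforms as a density under changes of coordinates
    (∀ (g : GL E7.I56 ℂ) (σ σ' : E7.Coord → GL E7.I56 ℂ) (f : E7.Coord → E7.Coord) (p : E7.Coord),
      g ∈ E7.expGroup E7.lieE7 →
      (∀ q, σ q ∈ E7.expGroup E7.lieE7) → (∀ q, σ' q ∈ E7.expGroup E7.lieE7) →
      E7.MatDiffAt σ (f p) → E7.MatDiffAt σ' p → DifferentiableAt ℝ f p →
      (∀ᶠ q in 𝓝 p, (g * σ (f q))⁻¹ * σ' q ∈ E7.expGroup E7.lieU) →
      E7.density E7.coordBasis E7.frameE7 σ' p =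
        |(fderiv ℝ f p).det| * E7.density E7.coordBasis E7.frameE7 σ (f p)) ∧
    -- the factorization in the Euler coordinates
    (∀ (B₆ : (Fin 26 → ℝ) → GL E7.I27 ℂ) (B₄ : (Fin 16 → ℝ) → GL E7.I27 ℂ)
      (B₉ : (Fin 8 → ℝ) → GL E7.I27 ℂ),
      (∀ a, B₆ a ∈ E7.expGroup E7.lieE6 ∧ E7.MatDiffAt B₆ a) →
      (∀ b, B₄ b ∈ E7.expGroup E7.lieF4 ∧ E7.MatDiffAt B₄ b) →
      (∀ c, B₉ c ∈ E7.expGroup E7.lieSO9 ∧ E7.MatDiffAt B₉ c) →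
      (∀ x, E7.euler B₆ B₄ B₉ x ∈ E7.expGroup E7.lieE7 ∧
        E7.MatDiffAt (E7.euler B₆ B₄ B₉) x) ∧
      (∀ x₁ a b c v,
        E7.density E7.coordBasis E7.frameE7 (E7.euler B₆ B₄ B₉) (x₁, a, b, c, v) =
          E7.density (Pi.basisFun ℝ (Fin 26)) E7.frameE6 (fun s => E7.psiGL (B₆ s)) a
            * E7.density (Pi.basisFun ℝ (Fin 16)) E7.frameF4 (fun s => E7.psiGL (B₄ s)) b
            * E7.density (Pi.basisFun ℝ (Fin 8)) E7.frameSO9 (fun s => E7.psiGL (B₉ s)) c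
            * |E7.W (v 0) (v 1) (v 2)|) ∧
      E7.densityMeasure E7.coordBasis E7.frameE7 (E7.euler B₆ B₄ B₉) =
        (volume : Measure ℝ).prod
          ((E7.densityMeasure (Pi.basisFun ℝ (Fin 26)) E7.frameE6 fun s => E7.psiGL (B₆ s)).prod
            ((E7.densityMeasure (Pi.basisFun ℝ (Fin 16)) E7.frameF4 fun s => E7.psiGL (B₄ s)).prod
              ((E7.densityMeasure (Pi.basisFun ℝ (Fin 8)) E7.frameSO9 fun s =>
                E7.psiGL (B₉ s)).prod E7.measureW)))) ∧
    -- the change of variables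
    (∀ v : Fin 3 → ℝ, E7.W (v 0) (v 1) (v 2) =
      E7.Wxyz (E7.changeVar v 0) (E7.changeVar v 1) (E7.changeVar v 2)) ∧
    (volume : Measure (Fin 3 → ℝ)).map E7.changeVar =
      ENNReal.ofReal (1 / (2 * √2)) • (volume : Measure (Fin 3 → ℝ)) ∧
    (∀ x y z : ℝ, 0 ≤ z → z ≤ y → y ≤ x → x ≤ Real.pi → 0 ≤ E7.Wxyz x y z) := by
  exact ⟨⟨E7.isOrthoFrame_frameE7, E7.isOrthoFrame_frameE6, E7.isOrthoFrame_frameF4,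
      E7.isOrthoFrame_frameSO9⟩,
    fun g σ σ' f p _ _ _ hσ hσ' hf h => E7.density_invariant g σ σ' f p hσ hσ' hf h,
    fun B₆ B₄ B₉ h₆ h₄ h₉ =>
      ⟨fun x => ⟨E7.euler_mem (fun a => (h₆ a).1) (fun b => (h₄ b).1) (fun c => (h₉ c).1) x,
          E7.matDiffAt_euler (fun a => (h₆ a).2) (fun b => (h₄ b).2) (fun c => (h₉ c).2) x⟩,
        fun x₁ a b c v => E7.density_euler h₆ h₄ h₉ (x₁, a, b, c, v),
        E7.densityMeasure_euler h₆ h₄ h₉⟩,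
    E7.W_eq, E7.map_changeVar, fun _ _ _ => E7.Wxyz_nonneg⟩
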